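/- Let $\varepsilon>0$ and $V_o>0$. There is a constant $C=C(\varepsilon,V_o)>0$ such that the following holds for every open set $\Omega\subset\mathbb R^2$ and every $T>0$. Write $\Omega_T=\Omega\times(0,T]$ and $d\mu=dx\,dt$; $L^p_{\rm loc}(\Omega_T)$ denotes the functions that are in $L^p(K)$ for every compact $K\subset\Omega\times(0,T]$. Let $u:\Omega_T\to\mathbb R^2$ be a weak solution of the incompressible Euler equations $\partial_tu+(u\cdot\nabla)u+\nabla p=0$, $\operatorname{div}u=0$ in $\Omega_T$, that is, $u\in L^2_{\rm loc}(\Omega_T)$; for every $\psi\in C_c^\infty(\Omega)$ one has $\int_\Omega u(x,t)\cdot\nabla\psi(x)\,dx=0$ for almost every $t\in[0,T]$; and $$\int_0^T\!\!\int_\Omega u\cdot\partial_t\phi+\sum_{i=1}^2u_i(u\cdot\nabla)\phi_i\,dx\,dt=0$$ for every $\phi\in C_c^\infty(\Omega\times(0,T);\mathbb R^2)$ with $\nabla\cdot\phi=0$. Assume that $u\in L^\infty_{\rm loc}(0,T;L^2_{\rm loc}(\Omega))$ and $u\in L^{2+\varepsilon}_{\rm loc}(\Omega_T)$. Assume further that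 $u$ satisfies the vorticity estimates with constant $V_o$: the distributional vorticity $\omega=\partial_{x_1}u_2-\partial_{x_2}u_1$ belongs to $L^2_{\rm loc}(\Omega_T)$, and $$\operatorname*{ess\,sup}_{0\le t\le T}\int_\Omega|\omega|^{1+\alpha}\zeta(x,t)\,dx\le V_o\int_0^T\!\!\int_\Omega|\omega|^{1+\alpha}\big[|u||\nabla\zeta|+|\partial_t\zeta|\big]\,d\mu$$ (both sides in $[0,\infty]$) for every $\alpha\in[0,1)$ and every non-negative $\zeta$ that is the restriction to $\Omega_T$ of a function in $C_c^\infty(\Omega\times(0,\infty))$. For $x_o\in\mathbb R^2$, $t_o\in\mathbb R$ and $r>0$ put $B_r=B_r(x_o)$, $I_r=(t_o-r,t_o)$ and $Q_r=B_r\times I_r$. Then for every such cylinder with $\overline{Q_{4r}}\subset\Omega_T$, where in the case $t_o=T$ it is also required that $\|u\|_{L^\infty(I_{4r};L^1(B_{4r}),avg)}<\infty$ (for $t_o<T$ this is automatic), we have $$u\in L^\infty\big(I_r;\exp(\sqrt[\gamma]{L(B_r)})\big),\qquad\text{i.e.}\qquad \operatorname*{ess\,sup}_{t\in I_r}\int_{B_r}e^{|u(x,t)|^{1/\gamma}}\,dx<\infty,$$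 where $$\gamma=C\left[\left(r^2\frac1{|Q_{4r}|}\int_{Q_{4r}}|\omega|^2\,d\mu+1\right)^{\frac12}\left(\frac1{|Q_{4r}|}\int_{Q_{4r}}|u|^{2+\varepsilon}\,d\mu+1\right)^{\frac1{2+\varepsilon}}+\|u\|_{L^\infty(I_{4r};L^1(B_{4r}),avg)}\right]$$ and $\|u\|_{L^\infty(I_{4r};L^1(B_{4r}),avg)}=\operatorname*{ess\,sup}_{t\in I_{4r}}\frac1{|B_{4r}|}\int_{B_{4r}}|u(x,t)|\,dx$. -/

import Mathlib

open MeasureTheory Set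
open scoped ENNReal

noncomputable section

namespace EulerPlane

/-- The Euclidean plane. -/
abbrev Plane : Type := EuclideanSpace ℝ (Fin 2)

/-- Space-time points `(x, t)`. -/
abbrev SpaceTime : Type := Plane × ℝ

/-- The space-time cylinder `Ω_T = Ω × (0, T]`. -/
def spaceTimeDomain (Ω : Set Plane) (T : ℝ) : Set SpaceTime := Ω ×ˢ Ioc 0 T

/-- The ball `B_r` centred at `x₀`. -/
def spaceBall (x₀ : Plane) (r : ℝ) : Set Plane := Metric.ball x₀ r

/-- The time interval `I_r = (t₀ - r, t₀)`. -/
def timeInterval (t₀ r : ℝ) : Set ℝ := Ioo (t₀ - r) t₀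

/-- The cylinder `Q_r = B_r × I_r` with vertex `(x₀, t₀)`. -/
def cylinder (x₀ : Plane) (t₀ r : ℝ) : Set SpaceTime :=
  spaceBall x₀ r ×ˢ timeInterval t₀ r

/-- The spatial partial derivative `∂_{x_i} f`. -/
def spaceDeriv (i : Fin 2) (f : SpaceTime → ℝ) (z : SpaceTime) : ℝ :=
  fderiv ℝ (fun y : Plane => f (y, z.2)) z.1 (EuclideanSpace.single i 1)

/-- The spatial gradient `∇ f`. -/
def spaceGrad (f : SpaceTime → ℝ) (z : SpaceTime) : Plane :=
  gradient (fun y : Plane => f (y, z.2)) z.1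

/-- The time derivative `∂_t f`. -/
def timeDeriv (f : SpaceTime → ℝ) (z : SpaceTime) : ℝ :=
  deriv (fun s : ℝ => f (z.1, s)) z.2

/-- `f ∈ L^p_loc(Ω_T)`: `f ∈ L^p(K)` for every compact `K ⊆ Ω × (0, T]`. -/
def MemLpLoc {F : Type*} [NormedAddCommGroup F] (p : ℝ≥0∞) (Ω : Set Plane) (T : ℝ)
    (f : SpaceTime → F) : Prop :=
  ∀ K : Set SpaceTime, IsCompact K → K ⊆ spaceTimeDomain Ω T →
    MemLp f p (volume.restrict K)

/-- The bound in `u ∈ L^∞_loc(0, T; L²_loc(Ω))`, over compact `J ⊆ (0, T)` and `K ⊆ Ω`. -/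
def LocallyBoundedEnergy (Ω : Set Plane) (T : ℝ) (u : SpaceTime → Plane) : Prop :=
  ∀ (J : Set ℝ) (K : Set Plane), IsCompact J → J ⊆ Ioo 0 T → IsCompact K → K ⊆ Ω →
    essSup (fun t => ∫⁻ x in K, ‖u (x, t)‖ₑ ^ 2) (volume.restrict J) < ∞

/-- Weak solutions in `Ω_T` of
`∂_t u + (u · ∇) u + ∇ p = 0`, `div u = 0`. -/
structure IsWeakSolution (Ω : Set Plane) (T : ℝ) (u : SpaceTime → Plane) : Prop where
  memLpLoc_two : MemLpLoc 2 Ω T u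
  divergence_free : ∀ ψ : Plane → ℝ, ContDiff ℝ (⊤ : ℕ∞) ψ → HasCompactSupport ψ → tsupport ψ ⊆ Ω →
    ∀ᵐ t ∂(volume.restrict (Icc 0 T)), ∫ x in Ω, inner ℝ (u (x, t)) (gradient ψ x) = 0
  momentum : ∀ φ : SpaceTime → Plane, ContDiff ℝ (⊤ : ℕ∞) φ → HasCompactSupport φ →
    tsupport φ ⊆ Ω ×ˢ Ioo 0 T →
    (∀ z, ∑ i, spaceDeriv i (fun w => φ w i) z = 0) →
    ∫ z in spaceTimeDomain Ω T,
      ((∑ i, u z i * timeDeriv (fun w => φ w i) z) +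
        ∑ i, u z i * ∑ j, u z j * spaceDeriv j (fun w => φ w i) z) = 0

/-- `ω = ∂_{x₁} u₂ - ∂_{x₂} u₁` in the sense of distributions on `Ω × (0, T)`. -/
def IsVorticity (Ω : Set Plane) (T : ℝ) (u : SpaceTime → Plane) (ω : SpaceTime → ℝ) : Prop :=
  ∀ ψ : SpaceTime → ℝ, ContDiff ℝ (⊤ : ℕ∞) ψ → HasCompactSupport ψ → tsupport ψ ⊆ Ω ×ˢ Ioo 0 T →
    ∫ z in spaceTimeDomain Ω T, ω z * ψ z =
      -∫ z in spaceTimeDomain Ω T, (u z 1 * spaceDeriv 0 ψ z - u z 0 * spaceDeriv 1 ψ z)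

/-- The vorticity estimates with constant `V`, for a velocity `u` whose vorticity is `ω`.
The test functions are the restrictions to `Ω_T` of smooth functions with compact support in
`Ω × (0, ∞)`: they vanish near the parabolic boundary, but need not vanish at `t = T`.
Both sides are computed in `[0, ∞]`. -/
structure VorticityEstimates (Ω : Set Plane) (T V : ℝ) (u : SpaceTime → Plane)
    (ω : SpaceTime → ℝ) : Prop where
  memLpLoc_two : MemLpLoc 2 Ω T ω
  estimate : ∀ α : ℝ, 0 ≤ α → α < 1 → ∀ ζ : SpaceTime → ℝ, ContDiff ℝ (⊤ : ℕ∞) ζ →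
    HasCompactSupport ζ → tsupport ζ ⊆ Ω ×ˢ Ioi 0 → (∀ z, 0 ≤ ζ z) →
    essSup (fun t => ∫⁻ x in Ω, ‖ω (x, t)‖ₑ ^ (1 + α) * ‖ζ (x, t)‖ₑ)
        (volume.restrict (Icc 0 T)) ≤
      ENNReal.ofReal V * ∫⁻ z in spaceTimeDomain Ω T,
        ‖ω z‖ₑ ^ (1 + α) * (‖u z‖ₑ * ‖spaceGrad ζ z‖ₑ + ‖timeDeriv ζ z‖ₑ)

/-- The averaged norm `‖u‖_{L^∞(I_r; L¹(B_r), avg)}`, as an element of `[0, ∞]`. -/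
def supAvgNorm (u : SpaceTime → Plane) (x₀ : Plane) (t₀ r : ℝ) : ℝ≥0∞ :=
  essSup (fun t => laverage (volume.restrict (spaceBall x₀ r)) fun x => ‖u (x, t)‖ₑ) (volume.restrict (timeInterval t₀ r))

/-- The exponent `γ` determined by `Q_{4r}` and the constant `C`. -/
def gammaExponent (C ε : ℝ) (u : SpaceTime → Plane) (ω : SpaceTime → ℝ)
    (x₀ : Plane) (t₀ r : ℝ) : ℝ :=
  C * ((r ^ 2 * (⨍ z in cylinder x₀ t₀ (4 * r), |ω z| ^ 2) + 1) ^ (1 / 2 : ℝ) *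
      ((⨍ z in cylinder x₀ t₀ (4 * r), ‖u z‖ ^ (2 + ε)) + 1) ^ (1 / (2 + ε)) +
    (supAvgNorm u x₀ t₀ (4 * r)).toReal)

/-- The bound in `u ∈ L^∞(I; exp(L^{1/γ}(B)))`: the integrals `∫_B exp(|u(x,t)|^{1/γ}) dx`
are essentially bounded in `t ∈ I`. -/
def UniformlyExpIntegrable (γ : ℝ) (u : SpaceTime → Plane) (I : Set ℝ) (B : Set Plane) : Prop :=
  essSup (fun t => ∫⁻ x in B, ENNReal.ofReal (Real.exp (‖u (x, t)‖ ^ (1 / γ))))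
    (volume.restrict I) < ∞

end EulerPlane

end

noncomputable section

namespace EulerPlane

/-! Moser-type iteration between velocity and vorticity. Let `Y` bound the `L^p` norm of `1 + |u|`
on a cylinder, `p > 2`. The vorticity estimate with exponent `q = 1 + α` bounds `∫ |ω(t)|^q` on a
smaller ball, for almost every `t`, by a multiple of `∫∫ |ω|^q (1 + |u|)`. With `q = 2 - 2/p` Hölder
pairs `|ω|^q` in `L^{p/(p-1)}`, where only `∫∫ |ω|²` is needed, with `1 + |u|` in `L^p`; so the
`L^q` norm of `ω(t)` is at most a constant times `Y^{1/q}`. The local Biot–Savart law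
(`ae_enorm_le_potential`) bounds `|u|` by the potential of `|ω|` with kernel `1/|x - y|`, plus a
local `L¹` norm of `u`. The critical exponent of that potential is `pq`, since `1/q - 1/2 = 1/(pq)`.
A fixed factor `l` with `1 < l < q₀ ≤ q` therefore stays subcritical, and Young's inequality
(`lintegral_rieszPotential_rpow_le`) gives an `L^{lp}` bound for `u`.

Each step costs a factor at most `K 4ⁿ`: powers of two from the cutoffs and from the Young constant,
which grows linearly in `p = p₀ lⁿ`. The previous norm enters with power `β = 1/q₀ < 1`, so the
recursion `Y_{n+1} ≤ K 4ⁿ Y_n^β` has only geometric growth, `Y_n ≤ G Dⁿ` with `D = 4^{1/(1-β)}`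
(`exists_ae_lintegral_le_geometric`).

Norms growing like `Dⁿ` along exponents `p₀ lⁿ` mean polynomial growth in the exponent, hence
exponential integrability of a power of `|u|`. If `D^{1/γ} ≤ √l`, then `|u|^{1/γ}` is of order
`l^{n/2}` where `|u|` is of order `G Dⁿ`, while the `n`-th moment controls weights of size `exp(p₀
lⁿ)`; the gap between `l^{n/2}` and `lⁿ` absorbs `G` (`exists_exp_rpow_le_tsum`). The rate `D`
depends on `ε` alone. All other data (`V`, the radius, the norms of `u` and `ω`) enter `G`, so a
lower bound on `γ` depending on `ε` suffices. It follows from `γ ≥ C`, because the bracket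
multiplying `C` is at least `1`. -/

/-! ### Polar coordinates and integrals of negative powers of the distance. -/

/-- The point of the plane with polar coordinates `p`. -/
def polarPoint (p : ℝ × ℝ) : Plane := !₂[p.1 * Real.cos p.2, p.1 * Real.sin p.2]

theorem repr_polarCoord_symm (p : ℝ × ℝ) :
    Complex.orthonormalBasisOneI.repr (Complex.polarCoord.symm p) = polarPoint p := by
  ext i
  fin_cases i <;>
    simp [polarPoint, Complex.orthonormalBasisOneI, Complex.polarCoord_symm_apply,
      Complex.cos_ofReal_re, Complex.sin_ofReal_re]

theorem norm_polarPoint (p : ℝ × ℝ) : ‖polarPoint p‖ = |p.1| := by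
  rw [← repr_polarCoord_symm, LinearIsometryEquiv.norm_map, Complex.norm_polarCoord_symm]

theorem integral_plane_polar (F : Plane → ℝ) :
    ∫ z, F z = ∫ p in Ioi (0 : ℝ) ×ˢ Ioo (-Real.pi) Real.pi, p.1 * F (polarPoint p) := by
  rw [← Complex.orthonormalBasisOneI.measurePreserving_repr.integral_comp
    Complex.orthonormalBasisOneI.repr.toHomeomorph.measurableEmbedding F,
    ← Complex.integral_comp_polarCoord_symm]
  simp only [repr_polarCoord_symm, smul_eq_mul]
  rfl

theorem lintegral_plane_polar (F : Plane → ℝ≥0∞) :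
    ∫⁻ z, F z = ∫⁻ p in Ioi (0 : ℝ) ×ˢ Ioo (-Real.pi) Real.pi,
      ENNReal.ofReal p.1 * F (polarPoint p) := by
  rw [← Complex.orthonormalBasisOneI.measurePreserving_repr.lintegral_comp_emb
    Complex.orthonormalBasisOneI.repr.toHomeomorph.measurableEmbedding F,
    ← Complex.lintegral_comp_polarCoord_symm]
  simp only [repr_polarCoord_symm, smul_eq_mul]
  rfl

/-- Polar coordinates reduce this to `2π ∫₀¹ x^{1-s} dx`. The explicit rate `1/(2 - s)` is kept
because `s` approaches `2` along the iteration. -/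
theorem lintegral_ball_norm_rpow {s : ℝ} (hs : s < 2) :
    ∫⁻ z in Metric.ball (0 : Plane) 1, ENNReal.ofReal (‖z‖ ^ (-s)) ≤
      ENNReal.ofReal (2 * Real.pi / (2 - s)) := by
  rw [← lintegral_indicator Metric.isOpen_ball.measurableSet, lintegral_plane_polar]
  calc _ ≤ ∫⁻ p in Ioi (0 : ℝ) ×ˢ Ioo (-Real.pi) Real.pi,
        (Ioc (0:ℝ) 1).indicator (fun x => ENNReal.ofReal (x ^ (1 - s))) p.1 * 1 := by
        refine setLIntegral_mono' (measurableSet_Ioi.prod measurableSet_Ioo) fun p hp => ?_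
        have h0 : 0 < p.1 := hp.1
        by_cases h1 : p.1 < 1
        · rw [indicator_of_mem (by simp [norm_polarPoint, abs_of_pos h0, h1]),
            indicator_of_mem (by exact ⟨h0, h1.le⟩), norm_polarPoint, abs_of_pos h0,
            ← ENNReal.ofReal_mul h0.le, mul_one]
          apply le_of_eq
          congr 1
          rw [sub_eq_add_neg, Real.rpow_add h0, Real.rpow_one]
        · rw [indicator_of_notMem (by simpa [norm_polarPoint, abs_of_pos h0] using h1)]
          simp
    _ = ENNReal.ofReal (2 * Real.pi / (2 - s)) := by
        rw [Measure.volume_eq_prod, ← Measure.prod_restrict, lintegral_prod_mul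
          (f := (Ioc (0:ℝ) 1).indicator (fun x => ENNReal.ofReal (x ^ (1 - s)))) (g := fun _ => 1)
          (Measurable.aemeasurable (by measurability)) (by fun_prop)]
        rw [setLIntegral_indicator measurableSet_Ioc]
        have h1 : Ioc (0:ℝ) 1 ∩ Ioi 0 = Ioc 0 1 := by ext; simp +contextual
        rw [h1, ← ofReal_integral_eq_lintegral_ofReal, ← intervalIntegral.integral_of_le zero_le_one,
          integral_rpow (Or.inl (by linarith)), Real.one_rpow, Real.zero_rpow (by linarith)]
        · simp only [lintegral_const, MeasurableSet.univ, Measure.restrict_apply, univ_inter,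
            Real.volume_Ioo, one_mul]
          rw [← ENNReal.ofReal_mul (by apply div_nonneg <;> linarith)]
          congr 1
          field_simp
          ring
        · exact (intervalIntegrable_iff_integrableOn_Ioc_of_le zero_le_one).1 <|
            intervalIntegral.intervalIntegrable_rpow' (by linarith)
        · filter_upwards [ae_restrict_mem measurableSet_Ioc] with x hx
          exact Real.rpow_nonneg hx.1.le _

/-- Within distance `1` of `x` the singularity is integrated exactly; farther away the integrand is
at most `1`. The bound is uniform in `x`. -/
theorem lintegral_norm_sub_rpow_le {s : ℝ} (hs0 : 0 ≤ s) (hs : s < 2) (A : Set Plane) (x : Plane) :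
    ∫⁻ y in A, ‖x - y‖ₑ⁻¹ ^ s ≤ ENNReal.ofReal (2 * Real.pi / (2 - s)) + volume A := by
  have hm : MeasurableSet (Metric.ball x 1) := Metric.isOpen_ball.measurableSet
  rw [← lintegral_inter_add_sdiff _ A hm]
  gcongr
  · calc _ ≤ ∫⁻ y in Metric.ball x 1, ‖x - y‖ₑ⁻¹ ^ s := lintegral_mono_set inter_subset_right
      _ = ∫⁻ z in Metric.ball (0 : Plane) 1, ENNReal.ofReal (‖z‖ ^ (-s)) := by
        rw [← lintegral_indicator hm, ← lintegral_indicator Metric.isOpen_ball.measurableSet,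
          ← lintegral_sub_left_eq_self _ x]
        refine lintegral_congr_ae ?_
        filter_upwards [compl_mem_ae_iff.2 (measure_singleton (0 : Plane))] with z hz
        have hz' : 0 < ‖z‖ := norm_pos_iff.2 hz
        by_cases h : ‖z‖ < 1
        · rw [indicator_of_mem (by simpa using h), indicator_of_mem (by simpa using h),
            sub_sub_cancel, ← ofReal_norm, ← ENNReal.ofReal_inv_of_pos hz',
            ENNReal.ofReal_rpow_of_nonneg (by positivity) hs0, Real.inv_rpow hz'.le,
            Real.rpow_neg hz'.le]
        · rw [indicator_of_notMem (by simpa using h), indicator_of_notMem (by simpa using h)]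
      _ ≤ _ := lintegral_ball_norm_rpow hs
  · calc _ ≤ ∫⁻ y in A \ Metric.ball x 1, 1 := by
          refine setLIntegral_mono_ae (by fun_prop) (Filter.Eventually.of_forall fun y hy => ?_)
          refine ENNReal.rpow_le_one ?_ hs0
          rw [ENNReal.inv_le_one, ← ofReal_norm, ENNReal.one_le_ofReal]
          have := hy.2
          simpa [dist_eq_norm, norm_sub_rev] using this
      _ ≤ _ := by
          rw [setLIntegral_one]; exact measure_mono sdiff_subset

/-! ### The gradient of the Newtonian kernel: its divergence and curl. -/

/-- The Biot-Savart type kernel `z_i / (2π |z|²)`. -/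
def kern (i : Fin 2) (z : Plane) : ℝ := z i / (2 * Real.pi * ‖z‖ ^ 2)

theorem measurable_kern (i : Fin 2) : Measurable (kern i) := by
  unfold kern; fun_prop

theorem abs_apply_le_norm (z : Plane) (i : Fin 2) : |z i| ≤ ‖z‖ := PiLp.norm_apply_le z i

theorem abs_kern_le (i : Fin 2) (z : Plane) : |kern i z| ≤ 2⁻¹ * ‖z‖⁻¹ * (Real.pi)⁻¹ := by
  rw [kern, abs_div, abs_of_nonneg (by positivity : 0 ≤ 2 * Real.pi * ‖z‖ ^ 2)]
  rcases eq_or_ne z 0 with rfl | hz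
  · simp
  have : 0 < ‖z‖ := norm_pos_iff.2 hz
  rw [div_le_iff₀ (by positivity)]
  have := abs_apply_le_norm z i
  field_simp
  exact this

theorem enorm_kern_le (i : Fin 2) (z : Plane) :
    ‖kern i z‖ₑ ≤ ENNReal.ofReal (2 * Real.pi)⁻¹ * ‖z‖ₑ⁻¹ := by
  rcases eq_or_ne z 0 with rfl | hz
  · simp [kern]
  have h : 0 < ‖z‖ := norm_pos_iff.2 hz
  rw [← ofReal_norm, ← ofReal_norm, ← ENNReal.ofReal_inv_of_pos h, ← ENNReal.ofReal_mul (by positivity)]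
  apply ENNReal.ofReal_le_ofReal
  rw [Real.norm_eq_abs]
  refine (abs_kern_le i z).trans (le_of_eq ?_)
  field_simp

/-- The partial derivative `∂_i g` of a function on the plane. -/
def pderiv (i : Fin 2) (g : Plane → ℝ) (x : Plane) : ℝ :=
  fderiv ℝ g x (EuclideanSpace.single i 1)

theorem polarPoint_eq (r θ : ℝ) : polarPoint (r, θ) =
    (r * Real.cos θ) • EuclideanSpace.single (0 : Fin 2) (1 : ℝ) +
      (r * Real.sin θ) • EuclideanSpace.single (1 : Fin 2) (1 : ℝ) := by
  ext i; fin_cases i <;> simp [polarPoint]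

theorem continuous_polarPoint : Continuous polarPoint := by
  have : polarPoint = fun p : ℝ × ℝ =>
      (p.1 * Real.cos p.2) • EuclideanSpace.single (0 : Fin 2) (1 : ℝ) +
      (p.1 * Real.sin p.2) • EuclideanSpace.single (1 : Fin 2) (1 : ℝ) :=
    funext fun p => polarPoint_eq p.1 p.2
  rw [this]; fun_prop

theorem continuous_pderiv {h : Plane → ℝ} (hh : ContDiff ℝ 1 h) (i : Fin 2) :
    Continuous (pderiv i h) :=
  (hh.continuous_fderiv one_ne_zero).clm_apply continuous_const

theorem hasDerivAt_comp_polarPoint_radius {h : Plane → ℝ} (hh : ContDiff ℝ 1 h) (r θ : ℝ) :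
    HasDerivAt (fun r => h (polarPoint (r, θ)))
      (Real.cos θ * pderiv 0 h (polarPoint (r, θ)) +
        Real.sin θ * pderiv 1 h (polarPoint (r, θ))) r := by
  have h1 : HasDerivAt (fun r => polarPoint (r, θ))
      ((1 * Real.cos θ) • EuclideanSpace.single (0 : Fin 2) (1 : ℝ) +
      (1 * Real.sin θ) • EuclideanSpace.single (1 : Fin 2) (1 : ℝ)) r := by
    simp only [polarPoint_eq]
    exact (((hasDerivAt_id r).mul_const _).smul_const _).add
      (((hasDerivAt_id r).mul_const _).smul_const _)
  have h2 := ((hh.differentiable one_ne_zero) (polarPoint (r, θ))).hasFDerivAt.comp_hasDerivAt r h1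
  refine h2.congr_deriv ?_
  simp [pderiv]

theorem hasDerivAt_comp_polarPoint_angle {h : Plane → ℝ} (hh : ContDiff ℝ 1 h) (r θ : ℝ) :
    HasDerivAt (fun θ => h (polarPoint (r, θ)))
      (r * (Real.cos θ * pderiv 1 h (polarPoint (r, θ)) -
        Real.sin θ * pderiv 0 h (polarPoint (r, θ)))) θ := by
  have h1 : HasDerivAt (fun θ => polarPoint (r, θ))
      ((r * -Real.sin θ) • EuclideanSpace.single (0 : Fin 2) (1 : ℝ) +
      (r * Real.cos θ) • EuclideanSpace.single (1 : Fin 2) (1 : ℝ)) θ := by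
    simp only [polarPoint_eq]
    exact (((Real.hasDerivAt_cos θ).const_mul _).smul_const _).add
      (((Real.hasDerivAt_sin θ).const_mul _).smul_const _)
  have h2 := ((hh.differentiable one_ne_zero) (polarPoint (r, θ))).hasFDerivAt.comp_hasDerivAt θ h1
  refine h2.congr_deriv ?_
  simp [pderiv]
  ring

theorem integrableOn_polar_of_continuous {f : ℝ × ℝ → ℝ} (hf : Continuous f) {R : ℝ}
    (h0 : ∀ p : ℝ × ℝ, R < p.1 → f p = 0) :
    IntegrableOn f (Ioi (0 : ℝ) ×ˢ Ioo (-Real.pi) Real.pi) := by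
  have h1 : IntegrableOn f (Icc 0 R ×ˢ Icc (-Real.pi) Real.pi) :=
    hf.continuousOn.integrableOn_compact (isCompact_Icc.prod isCompact_Icc)
  refine h1.of_forall_sdiff_eq_zero (measurableSet_Ioi.prod measurableSet_Ioo) ?_
  rintro ⟨r, θ⟩ ⟨⟨hr, hθ⟩, hn⟩
  refine h0 _ ?_
  by_contra hR
  exact hn ⟨⟨le_of_lt hr, not_lt.1 hR⟩, Ioo_subset_Icc_self hθ⟩

theorem exists_pderiv_polarPoint_eq_zero {h : Plane → ℝ} (hc : HasCompactSupport h) :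
    ∃ R : ℝ, 0 < R ∧ (∀ p : ℝ × ℝ, R < p.1 → h (polarPoint p) = 0) ∧
      ∀ (i : Fin 2) (p : ℝ × ℝ), R < p.1 → pderiv i h (polarPoint p) = 0 := by
  obtain ⟨R, hR0, hR⟩ := hc.isCompact.isBounded.exists_pos_norm_le
  have key : ∀ p : ℝ × ℝ, R < p.1 → polarPoint p ∉ tsupport h := fun p hp hmem => by
    have := hR _ hmem
    rw [norm_polarPoint] at this
    exact absurd (le_abs_self p.1) (not_le.2 (this.trans_lt hp))
  refine ⟨R, hR0, fun p hp => image_eq_zero_of_notMem_tsupport (key p hp), fun i p hp => ?_⟩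
  have : polarPoint p ∉ Function.support (fderiv ℝ h) := fun hm =>
    key p hp (support_fderiv_subset ℝ hm)
  rw [pderiv, Function.notMem_support.1 this]
  simp

theorem mul_kern_polarPoint {p : ℝ × ℝ} (hp : 0 < p.1) :
    p.1 * kern 0 (polarPoint p) = (2 * Real.pi)⁻¹ * Real.cos p.2 ∧
      p.1 * kern 1 (polarPoint p) = (2 * Real.pi)⁻¹ * Real.sin p.2 := by
  simp only [kern, norm_polarPoint, sq_abs]
  constructor <;> simp [polarPoint] <;> field_simp

/-- This says that the kernel has divergence `δ₀`. The polar Jacobian cancels the singularity and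
leaves `(2π)⁻¹ ∂_r h`, which integrates to `-h(0)/(2π)` along every ray. -/
theorem integral_kern_radial {h : Plane → ℝ} (hh : ContDiff ℝ 1 h) (hc : HasCompactSupport h) :
    ∫ z, (kern 0 z * pderiv 0 h z + kern 1 z * pderiv 1 h z) = - h 0 := by
  obtain ⟨R, hR0, hR, hR'⟩ := exists_pderiv_polarPoint_eq_zero hc
  rw [integral_plane_polar]
  set f : ℝ × ℝ → ℝ := fun p => (2 * Real.pi)⁻¹ * (Real.cos p.2 * pderiv 0 h (polarPoint p) +
        Real.sin p.2 * pderiv 1 h (polarPoint p)) with hf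
  have hcont : Continuous f := by
    have h0 := (continuous_pderiv hh 0).comp continuous_polarPoint
    have h1 := (continuous_pderiv hh 1).comp continuous_polarPoint
    simp only [Function.comp_def] at h0 h1
    fun_prop
  have hint := integrableOn_polar_of_continuous hcont (R := R)
    (fun p hp => by simp [hf, hR' _ p hp])
  rw [setIntegral_congr_fun (g := f) (measurableSet_Ioi.prod measurableSet_Ioo)
    (fun p hp => ?_)]
  · rw [IntegrableOn, Measure.volume_eq_prod, ← Measure.prod_restrict] at hint
    rw [Measure.volume_eq_prod, ← Measure.prod_restrict, integral_prod_symm _ hint]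
    have inner : ∀ θ : ℝ, ∫ r in Ioi (0:ℝ), f (r, θ) = (2 * Real.pi)⁻¹ * (- h 0) := by
      intro θ
      simp only [hf]
      rw [integral_const_mul]
      congr 1
      have hp0 : polarPoint (0, θ) = 0 := by rw [polarPoint_eq]; simp
      rw [integral_Ioi_of_hasDerivAt_of_tendsto' (f := fun r => h (polarPoint (r, θ))) (m := 0)
        (fun r _ => hasDerivAt_comp_polarPoint_radius hh r θ), hp0, zero_sub]
      · have hc2 : Continuous fun r : ℝ => (Real.cos θ * pderiv 0 h (polarPoint (r, θ)) +
            Real.sin θ * pderiv 1 h (polarPoint (r, θ))) := by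
          have h0 := (continuous_pderiv hh 0).comp (continuous_polarPoint.comp
            (Continuous.prodMk_left θ))
          have h1 := (continuous_pderiv hh 1).comp (continuous_polarPoint.comp
            (Continuous.prodMk_left θ))
          simp only [Function.comp_def] at h0 h1
          fun_prop
        refine (hc2.continuousOn.integrableOn_compact (isCompact_Icc (a := 0) (b := R))).of_forall_sdiff_eq_zero
          measurableSet_Ioi ?_
        rintro r ⟨hr, hn⟩
        have : R < r := by by_contra hc; exact hn ⟨le_of_lt hr, not_lt.1 hc⟩
        simp [hR' _ (r, θ) this]
      · refine tendsto_const_nhds.congr' ?_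
        filter_upwards [Filter.eventually_gt_atTop R] with r hr
        exact (hR (r, θ) hr).symm
    simp only [inner]
    simp only [integral_const, MeasurableSet.univ, measureReal_restrict_apply, univ_inter,
      Real.volume_real_Ioo_of_le (by linarith [Real.pi_pos] : -Real.pi ≤ Real.pi), smul_eq_mul]
    field_simp
    ring
  · have := mul_kern_polarPoint (p := p) hp.1
    simp only [hf]
    linear_combination (pderiv 0 h (polarPoint p)) * this.1 + (pderiv 1 h (polarPoint p)) * this.2

/-- This says that the kernel is curl free. In polar coordinates the integrand is `(2πr)⁻¹ ∂_θ h`,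
whose integral over each circle vanishes by periodicity. -/
theorem integral_kern_angular {h : Plane → ℝ} (hh : ContDiff ℝ 1 h) (hc : HasCompactSupport h) :
    ∫ z, (kern 0 z * pderiv 1 h z - kern 1 z * pderiv 0 h z) = 0 := by
  obtain ⟨R, hR0, hR, hR'⟩ := exists_pderiv_polarPoint_eq_zero hc
  rw [integral_plane_polar]
  set f : ℝ × ℝ → ℝ := fun p => (2 * Real.pi)⁻¹ * (Real.cos p.2 * pderiv 1 h (polarPoint p) -
        Real.sin p.2 * pderiv 0 h (polarPoint p)) with hf
  have hcont : Continuous f := by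
    have h0 := (continuous_pderiv hh 0).comp continuous_polarPoint
    have h1 := (continuous_pderiv hh 1).comp continuous_polarPoint
    simp only [Function.comp_def] at h0 h1
    fun_prop
  have hint := integrableOn_polar_of_continuous hcont (R := R)
    (fun p hp => by simp [hf, hR' _ p hp])
  rw [setIntegral_congr_fun (g := f) (measurableSet_Ioi.prod measurableSet_Ioo)
    (fun p hp => ?_)]
  · rw [IntegrableOn, Measure.volume_eq_prod, ← Measure.prod_restrict] at hint
    rw [Measure.volume_eq_prod, ← Measure.prod_restrict, integral_prod _ hint]
    refine setIntegral_eq_zero_of_forall_eq_zero fun r hr => ?_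
    have hr : 0 < r := hr
    have hper : polarPoint (r, Real.pi) = polarPoint (r, -Real.pi) := by simp [polarPoint_eq]
    have hpi : -Real.pi ≤ Real.pi := by linarith [Real.pi_pos]
    have hcr : Continuous fun θ => r * (Real.cos θ * pderiv 1 h (polarPoint (r, θ)) -
        Real.sin θ * pderiv 0 h (polarPoint (r, θ))) := by
      have h0 := (continuous_pderiv hh 0).comp (continuous_polarPoint.comp
        (Continuous.prodMk_right r))
      have h1 := (continuous_pderiv hh 1).comp (continuous_polarPoint.comp
        (Continuous.prodMk_right r))
      simp only [Function.comp_def] at h0 h1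
      fun_prop
    have key := intervalIntegral.integral_eq_sub_of_hasDerivAt (a := -Real.pi) (b := Real.pi)
      (fun θ _ => hasDerivAt_comp_polarPoint_angle hh r θ) (hcr.intervalIntegrable _ _)
    rw [hper, sub_self, intervalIntegral.integral_const_mul,
      mul_eq_zero_iff_left hr.ne', intervalIntegral.integral_of_le hpi,
      integral_Ioc_eq_integral_Ioo] at key
    simp only [hf]
    rw [integral_const_mul, key, mul_zero]
  · have := mul_kern_polarPoint (p := p) hp.1
    simp only [hf]
    linear_combination (pderiv 1 h (polarPoint p)) * this.1 - (pderiv 0 h (polarPoint p)) * this.2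

theorem integrableOn_kern (i : Fin 2) {A : Set Plane} (hA : volume A ≠ ∞) :
    IntegrableOn (kern i) A := by
  refine ⟨(measurable_kern i).aestronglyMeasurable, ?_⟩
  rw [hasFiniteIntegral_iff_enorm]
  calc _ ≤ ∫⁻ z in A, ENNReal.ofReal (2 * Real.pi)⁻¹ * ‖(0 : Plane) - z‖ₑ⁻¹ ^ (1 : ℝ) := by
        gcongr with z
        simpa using enorm_kern_le i z
    _ < ∞ := by
        rw [lintegral_const_mul _ (by fun_prop)]
        refine ENNReal.mul_lt_top ENNReal.ofReal_lt_top ?_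
        refine (lintegral_norm_sub_rpow_le zero_le_one one_lt_two A 0).trans_lt ?_
        exact ENNReal.add_lt_top.2 ⟨ENNReal.ofReal_lt_top, hA.lt_top⟩

theorem locallyIntegrable_kern (i : Fin 2) : LocallyIntegrable (kern i) :=
  locallyIntegrable_iff.2 fun _ hk => integrableOn_kern i hk.measure_ne_top

open scoped Convolution in
/-- The convolution of the kernel `kern i` with `g`. -/
def kernConv (i : Fin 2) (g : Plane → ℝ) : Plane → ℝ :=
  kern i ⋆[ContinuousLinearMap.mul ℝ ℝ] g

theorem kernConv_apply (i : Fin 2) (g : Plane → ℝ) (x : Plane) :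
    kernConv i g x = ∫ z, kern i z * g (x - z) := rfl

theorem kernConv_apply' (i : Fin 2) (g : Plane → ℝ) (y : Plane) :
    kernConv i g y = ∫ x, kern i (y - x) * g x := by
  rw [kernConv_apply, ← integral_sub_left_eq_self _ _ y]
  simp

theorem contDiff_kernConv (i : Fin 2) {g : Plane → ℝ} (hg : ContDiff ℝ (⊤ : ℕ∞) g)
    (hc : HasCompactSupport g) : ContDiff ℝ (⊤ : ℕ∞) (kernConv i g) :=
  hc.contDiff_convolution_right _ (locallyIntegrable_kern i) hg

theorem integrable_kern_mul (i : Fin 2) {g : Plane → ℝ} (hg : Continuous g)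
    (hc : HasCompactSupport g) (x : Plane) : Integrable fun z => kern i z * g (x - z) :=
  hc.convolutionExists_right (ContinuousLinearMap.mul ℝ ℝ) (locallyIntegrable_kern i) hg x

theorem hasCompactSupport_pderiv {g : Plane → ℝ} (hc : HasCompactSupport g) (j : Fin 2) :
    HasCompactSupport (pderiv j g) :=
  hc.fderiv_apply ℝ _

theorem pderiv_kernConv (i j : Fin 2) {g : Plane → ℝ} (hg : ContDiff ℝ 1 g)
    (hc : HasCompactSupport g) (x : Plane) :
    pderiv j (kernConv i g) x = ∫ z, kern i z * pderiv j g (x - z) := by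
  have h := hc.hasFDerivAt_convolution_right (ContinuousLinearMap.mul ℝ ℝ)
    (locallyIntegrable_kern i) hg x
  rw [pderiv, kernConv, h.fderiv]
  have hex : ConvolutionExistsAt (kern i) (fderiv ℝ g) x
      ((ContinuousLinearMap.mul ℝ ℝ).precompR Plane) volume :=
    (hc.fderiv ℝ).convolutionExists_right _ (locallyIntegrable_kern i)
      (hg.continuous_fderiv one_ne_zero) x
  rw [convolution, ContinuousLinearMap.integral_apply hex]
  rfl

theorem pderiv_comp_sub (j : Fin 2) {g : Plane → ℝ} (hg : ContDiff ℝ 1 g) (x z : Plane) :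
    pderiv j (fun z => g (x - z)) z = - pderiv j g (x - z) := by
  have h := ((hg.differentiable one_ne_zero) (x - z)).hasFDerivAt.comp z
    ((hasFDerivAt_const x z).sub (hasFDerivAt_id z))
  have h2 : fderiv ℝ (fun z => g (x - z)) z = _ := h.fderiv
  rw [pderiv, h2]
  simp [pderiv]

/-- The pair of `kernConv i g` is the gradient of the Newtonian potential of `g`: its divergence is
`g` and, in `curl_kernConv`, its curl is zero. Both follow from the distributional identities
applied to `z ↦ g (x - z)`. -/
theorem div_kernConv {g : Plane → ℝ} (hg : ContDiff ℝ 1 g) (hc : HasCompactSupport g)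
    (x : Plane) : pderiv 0 (kernConv 0 g) x + pderiv 1 (kernConv 1 g) x = g x := by
  have hs : ContDiff ℝ 1 fun z => g (x - z) := hg.comp (contDiff_const.sub contDiff_id)
  have hcs : HasCompactSupport fun z => g (x - z) := hc.comp_homeomorph (Homeomorph.subLeft x)
  have := integral_kern_radial hs hcs
  rw [pderiv_kernConv 0 0 hg hc, pderiv_kernConv 1 1 hg hc, ← integral_add]
  · simp only [pderiv_comp_sub _ hg, sub_zero, mul_neg, ← neg_add, integral_neg] at this
    linarith
  all_goals exact integrable_kern_mul _ (continuous_pderiv hg _) (hasCompactSupport_pderiv hc _) x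

theorem curl_kernConv {g : Plane → ℝ} (hg : ContDiff ℝ 1 g) (hc : HasCompactSupport g)
    (x : Plane) : pderiv 1 (kernConv 0 g) x = pderiv 0 (kernConv 1 g) x := by
  have hs : ContDiff ℝ 1 fun z => g (x - z) := hg.comp (contDiff_const.sub contDiff_id)
  have hcs : HasCompactSupport fun z => g (x - z) := hc.comp_homeomorph (Homeomorph.subLeft x)
  have := integral_kern_angular hs hcs
  rw [← sub_eq_zero, pderiv_kernConv 0 1 hg hc, pderiv_kernConv 1 0 hg hc, ← integral_sub]
  · simp only [pderiv_comp_sub _ hg, mul_neg, sub_neg_eq_add] at this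
    rw [← neg_eq_zero, ← integral_neg, ← this]
    congr 1; ext z; ring
  all_goals exact integrable_kern_mul _ (continuous_pderiv hg _) (hasCompactSupport_pderiv hc _) x

/-! ### Duality with tensor test functions, and potentials. -/

/-- An integrable function of `(x, t)` orthogonal to all tensor products of test functions supported
in `U` and `J` vanishes almost everywhere in `U × J`. -/
theorem ae_eq_zero_of_integral_tensor_eq_zero {F : SpaceTime → ℝ} (hF : Integrable F)
    {U : Set Plane} {J : Set ℝ} (hU : IsOpen U) (hJ : IsOpen J)
    (h0 : ∀ z, z ∉ U ×ˢ J → F z = 0)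
    (h : ∀ (g : Plane → ℝ) (η : ℝ → ℝ), ContDiff ℝ (⊤ : ℕ∞) g → HasCompactSupport g →
      tsupport g ⊆ U → ContDiff ℝ (⊤ : ℕ∞) η → HasCompactSupport η → tsupport η ⊆ J →
      ∫ z, F z * (g z.1 * η z.2) = 0) :
    F =ᵐ[volume] 0 := by
  have hz1 : ∀ (x : Plane) (t : ℝ), x ∉ U → F (x, t) = 0 := fun x t hx => h0 _ fun hm => hx hm.1
  have hz2 : ∀ (x : Plane) (t : ℝ), t ∉ J → F (x, t) = 0 := fun x t hx => h0 _ fun hm => hx hm.2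
  -- sets in the first variable, test functions in the second
  have step1 : ∀ (η : ℝ → ℝ), ContDiff ℝ (⊤ : ℕ∞) η → HasCompactSupport η → tsupport η ⊆ J →
      ∀ A : Set Plane, MeasurableSet A → ∫ z, F z * (A.indicator 1 z.1 * η z.2) = 0 := by
    intro η hη hηc hηJ A hA
    obtain ⟨C, hC⟩ := hηc.exists_bound_of_continuous hη.continuous
    have hFη : Integrable fun z : SpaceTime => F z * η z.2 :=
      hF.mul_bdd (c := C) (hη.continuous.comp continuous_snd).aestronglyMeasurable
        (Filter.Eventually.of_forall fun z => hC z.2)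
    have hx : ∀ᵐ x : Plane, x ∈ U → ∫ t, F (x, t) * η t = 0 := by
      have hi : Integrable fun x : Plane => ∫ t, F (x, t) * η t := hFη.integral_prod_left
      refine hU.ae_eq_zero_of_integral_contDiff_smul_eq_zero
        (hi.locallyIntegrable.locallyIntegrableOn _) fun g hg hgc hgU => ?_
      obtain ⟨C', hC'⟩ := hgc.exists_bound_of_continuous hg.continuous
      have hI : Integrable fun z : SpaceTime => F z * (g z.1 * η z.2) := by
        have := hFη.mul_bdd (c := C')
          (hg.continuous.comp continuous_fst).aestronglyMeasurable
          (Filter.Eventually.of_forall fun z : SpaceTime => hC' z.1)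
        refine this.congr (Filter.Eventually.of_forall fun z => ?_)
        simp only [Function.comp]; ring
      rw [← h g η hg hgc hgU hη hηc hηJ, Measure.volume_eq_prod, integral_prod _ hI]
      refine integral_congr_ae (Filter.Eventually.of_forall fun x => ?_)
      simp only [smul_eq_mul, ← integral_const_mul]
      congr 1; ext t; ring
    have hI : Integrable fun z : SpaceTime => F z * (A.indicator 1 z.1 * η z.2) := by
      refine (hFη.indicator (s := A ×ˢ univ) (hA.prod MeasurableSet.univ)).congr
        (Filter.Eventually.of_forall fun z => ?_)
      by_cases hz : z.1 ∈ A <;> simp [indicator, hz]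
    rw [Measure.volume_eq_prod, integral_prod _ hI]
    refine integral_eq_zero_of_ae ?_
    filter_upwards [hx] with x hx
    by_cases hxA : x ∈ A
    · by_cases hxU : x ∈ U
      · simpa [hxA] using hx hxU
      · simp [hz1 x _ hxU]
    · simp [hxA]
  have step2 : ∀ A : Set Plane, MeasurableSet A → ∀ B : Set ℝ, MeasurableSet B →
      ∫ z in A ×ˢ B, F z = 0 := by
    intro A hA B hB
    have hFA : Integrable fun z : SpaceTime => F z * A.indicator 1 z.1 := by
      refine (hF.indicator (s := A ×ˢ univ) (hA.prod MeasurableSet.univ)).congr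
        (Filter.Eventually.of_forall fun z => ?_)
      by_cases hz : z.1 ∈ A <;> simp [indicator, hz]
    have ht : ∀ᵐ t : ℝ, t ∈ J → ∫ x, F (x, t) * A.indicator 1 x = 0 := by
      have hi : Integrable fun t : ℝ => ∫ x, F (x, t) * A.indicator 1 x := hFA.integral_prod_right
      refine hJ.ae_eq_zero_of_integral_contDiff_smul_eq_zero
        (hi.locallyIntegrable.locallyIntegrableOn _) fun η hη hηc hηJ => ?_
      obtain ⟨C', hC'⟩ := hηc.exists_bound_of_continuous hη.continuous
      have hI : Integrable fun z : SpaceTime => F z * (A.indicator 1 z.1 * η z.2) := by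
        have := hFA.mul_bdd (c := C')
          (hη.continuous.comp continuous_snd).aestronglyMeasurable
          (Filter.Eventually.of_forall fun z : SpaceTime => hC' z.2)
        refine this.congr (Filter.Eventually.of_forall fun z => ?_)
        simp only [Function.comp]; ring
      rw [← step1 η hη hηc hηJ A hA, Measure.volume_eq_prod, integral_prod_symm _ hI]
      refine integral_congr_ae (Filter.Eventually.of_forall fun x => ?_)
      simp only [smul_eq_mul, ← integral_const_mul]
      congr 1; ext t; ring
    rw [← integral_indicator (hA.prod hB)]
    have hI : Integrable ((A ×ˢ B).indicator F) := hF.indicator (hA.prod hB)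
    rw [Measure.volume_eq_prod, integral_prod_symm _ hI]
    refine integral_eq_zero_of_ae ?_
    filter_upwards [ht] with t ht
    by_cases htB : t ∈ B
    · by_cases htJ : t ∈ J
      · rw [Pi.zero_apply, ← ht htJ]
        congr 1; ext x
        by_cases hx : x ∈ A <;> simp [indicator, hx, htB]
      · simp only [indicator, hz2 _ t htJ]; simp
    · simp [indicator, htB]
  refine hF.ae_eq_zero_of_forall_setIntegral_eq_zero fun s hs hfin => ?_
  -- Finiteness of the measure is not inherited by complements in the π-λ induction, and global
  -- integrability of `F` makes it superfluous.
  clear hfin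
  induction s, hs using MeasurableSpace.induction_on_inter
    (generateFrom_prod (α := Plane) (β := ℝ)).symm isPiSystem_prod with
  | empty => simp
  | basic t ht =>
    obtain ⟨A, hA, B, hB, rfl⟩ := ht
    exact step2 A hA B hB
  | compl t ht iht =>
    have h1 := integral_add_compl (μ := volume) ht hF
    have h2 := step2 univ MeasurableSet.univ univ MeasurableSet.univ
    rw [univ_prod_univ, setIntegral_univ] at h2
    rw [iht, h2, zero_add] at h1
    exact h1
  | iUnion f hd hf ih =>
    rw [integral_iUnion hf hd hF.integrableOn]
    simp [ih]

/-- The exchange `((x, t), y) ↦ ((y, t), x)` of the space variables. -/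
def swapSpace : SpaceTime × Plane ≃ᵐ SpaceTime × Plane where
  toFun w := ((w.2, w.1.2), w.1.1)
  invFun w := ((w.2, w.1.2), w.1.1)
  left_inv _ := rfl
  right_inv _ := rfl
  measurable_toFun := by dsimp; fun_prop
  measurable_invFun := by dsimp; fun_prop

theorem measurePreserving_swapSpace : MeasurePreserving swapSpace volume volume := by
  have h1 : MeasurePreserving (MeasurableEquiv.prodAssoc : (Plane × ℝ) × Plane ≃ᵐ _) volume volume :=
    measurePreserving_prodAssoc volume volume volume
  have h2 : MeasurePreserving (Prod.swap : Plane × (ℝ × Plane) → _) volume volume :=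
    Measure.measurePreserving_swap
  have h3 : MeasurePreserving (Prod.swap : ℝ × Plane → _) volume volume :=
    Measure.measurePreserving_swap
  exact (h3.prod (MeasurePreserving.id volume)).comp (h2.comp h1)

/-- The potential `∫ k_i(y - x) S(y, t) dy`. -/
def potential (i : Fin 2) (S : SpaceTime → ℝ) (z : SpaceTime) : ℝ :=
  ∫ y, kern i (y - z.1) * S (y, z.2)

/-- Tonelli with the target point integrated first: over the finite-measure set `U` the kernel has
an integral bounded uniformly in the source point. This licenses every later exchange of integrals.
-/
theorem integrable_kern_source (i : Fin 2) {S : SpaceTime → ℝ} (hS : Integrable S)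
    (hSm : Measurable S) {U : Set Plane} (hU : MeasurableSet U) (hfin : volume U ≠ ∞) :
    Integrable (fun w : SpaceTime × Plane =>
      U.indicator 1 w.2 * (kern i (w.1.1 - w.2) * S w.1)) := by
  have hkm : Measurable fun w : SpaceTime × Plane => kern i (w.1.1 - w.2) :=
    (measurable_kern i).comp (by fun_prop)
  have hind : Measurable fun w : SpaceTime × Plane => U.indicator (1 : Plane → ℝ) w.2 :=
    (measurable_one.indicator hU).comp measurable_snd
  have hm : Measurable fun w : SpaceTime × Plane =>
      U.indicator (1 : Plane → ℝ) w.2 * (kern i (w.1.1 - w.2) * S w.1) :=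
    hind.mul (hkm.mul (hSm.comp measurable_fst))
  refine ⟨hm.aestronglyMeasurable, ?_⟩
  rw [hasFiniteIntegral_iff_enorm, Measure.volume_eq_prod, lintegral_prod _ hm.enorm.aemeasurable]
  set κ := ENNReal.ofReal (2 * Real.pi)⁻¹ *
    (ENNReal.ofReal (2 * Real.pi / (2 - 1)) + volume U)
  have hκ : κ < ∞ := ENNReal.mul_lt_top ENNReal.ofReal_lt_top
    (ENNReal.add_lt_top.2 ⟨ENNReal.ofReal_lt_top, hfin.lt_top⟩)
  calc _ ≤ ∫⁻ z : SpaceTime, κ * ‖S z‖ₑ := by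
        refine lintegral_mono fun z => ?_
        calc _ ≤ ∫⁻ x, (U.indicator (fun x => ENNReal.ofReal (2 * Real.pi)⁻¹ *
                ‖z.1 - x‖ₑ⁻¹ ^ (1 : ℝ)) x) * ‖S z‖ₑ := by
              refine lintegral_mono fun x => ?_
              by_cases hx : x ∈ U
              · simp only [hx, indicator_of_mem, Pi.one_apply, one_mul, enorm_mul, ENNReal.rpow_one]
                gcongr
                exact enorm_kern_le i _
              · simp [hx]
          _ ≤ κ * ‖S z‖ₑ := by
              rw [lintegral_mul_const _ (Measurable.indicator (by fun_prop) hU),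
                lintegral_indicator hU, lintegral_const_mul _ (by fun_prop)]
              exact mul_le_mul_left (mul_le_mul_right
                (lintegral_norm_sub_rpow_le zero_le_one one_lt_two U z.1) _) _
    _ < ∞ := by
        rw [lintegral_const_mul _ hSm.enorm]
        exact ENNReal.mul_lt_top hκ hS.2

theorem integrable_indicator_potential (i : Fin 2) {S : SpaceTime → ℝ} (hS : Integrable S)
    (hSm : Measurable S) {U : Set Plane} (hU : MeasurableSet U) (hfin : volume U ≠ ∞) :
    Integrable (fun z : SpaceTime => U.indicator 1 z.1 * potential i S z) := by
  have h1 := (measurePreserving_swapSpace.integrable_comp_emb swapSpace.measurableEmbedding).2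
    (integrable_kern_source i hS hSm hU hfin)
  have h2 := h1.integral_prod_left
  refine h2.congr (Filter.Eventually.of_forall fun z => ?_)
  simp only [Function.comp, swapSpace, potential, MeasurableEquiv.coe_mk, Equiv.coe_fn_mk]
  rw [integral_const_mul]

/-- Fubini moves the kernel from the test function to the source. Test functions supported in `U`
restore the indicator that makes the triple integral absolutely convergent. -/
theorem integral_source_kernConv (i : Fin 2) {S : SpaceTime → ℝ} (hS : Integrable S)
    (hSm : Measurable S) {U : Set Plane} (hU : MeasurableSet U) (hfin : volume U ≠ ∞)
    {g : Plane → ℝ} {η : ℝ → ℝ} (hg : Continuous g) (hgc : HasCompactSupport g)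
    (hgU : tsupport g ⊆ U) (hη : Continuous η) (hηc : HasCompactSupport η) :
    ∫ z, S z * kernConv i g z.1 * η z.2 = ∫ z, potential i S z * (g z.1 * η z.2) := by
  obtain ⟨C, hC⟩ := hgc.exists_bound_of_continuous hg
  obtain ⟨C', hC'⟩ := hηc.exists_bound_of_continuous hη
  have hH : Integrable (fun w : SpaceTime × Plane =>
      kern i (w.1.1 - w.2) * S w.1 * (g w.2 * η w.1.2)) := by
    have h1 := (integrable_kern_source i hS hSm hU hfin).mul_bdd (c := C * C')
      (g := fun w : SpaceTime × Plane => g w.2 * η w.1.2)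
      (by
        apply Continuous.aestronglyMeasurable
        fun_prop)
      (Filter.Eventually.of_forall fun w => by
        rw [norm_mul]
        exact mul_le_mul (hC _) (hC' _) (norm_nonneg _) ((norm_nonneg _).trans (hC 0)))
    refine h1.congr (Filter.Eventually.of_forall fun w => ?_)
    by_cases hw : w.2 ∈ U
    · simp [hw]
    · have : g w.2 = 0 := image_eq_zero_of_notMem_tsupport fun h => hw (hgU h)
      simp [this]
  have h1 : ∫ z, S z * kernConv i g z.1 * η z.2 = ∫ w : SpaceTime × Plane,
      kern i (w.1.1 - w.2) * S w.1 * (g w.2 * η w.1.2) := by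
    rw [Measure.volume_eq_prod SpaceTime Plane, integral_prod _ hH]
    refine integral_congr_ae (Filter.Eventually.of_forall fun z => ?_)
    simp only [kernConv_apply', ← integral_const_mul, ← integral_mul_const]
    congr 1; ext x; ring
  have hG := (measurePreserving_swapSpace.integrable_comp_emb swapSpace.measurableEmbedding).2 hH
  rw [h1, ← measurePreserving_swapSpace.integral_comp' (g := fun w : SpaceTime × Plane =>
      kern i (w.1.1 - w.2) * S w.1 * (g w.2 * η w.1.2)), Measure.volume_eq_prod SpaceTime Plane]
  refine (integral_prod _ hG).trans ?_
  refine integral_congr_ae (Filter.Eventually.of_forall fun z => ?_)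
  simp only [Function.comp, swapSpace, potential, MeasurableEquiv.coe_mk, Equiv.coe_fn_mk]
  rw [integral_mul_const]

/-! ### The local Biot–Savart representation. -/

/-- `u` is divergence free and `ω` is its vorticity in `U × J`, tested against tensor products. -/
structure IsPlanarDivCurl (U : Set Plane) (J : Set ℝ) (u : SpaceTime → Plane)
    (ω : SpaceTime → ℝ) : Prop where
  div_eq : ∀ (φ : Plane → ℝ) (η : ℝ → ℝ), ContDiff ℝ (⊤ : ℕ∞) φ → HasCompactSupport φ →
      tsupport φ ⊆ U → ContDiff ℝ (⊤ : ℕ∞) η → HasCompactSupport η → tsupport η ⊆ J →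
      ∫ z, (u z 0 * pderiv 0 φ z.1 + u z 1 * pderiv 1 φ z.1) * η z.2 = 0
  curl_eq : ∀ (φ : Plane → ℝ) (η : ℝ → ℝ), ContDiff ℝ (⊤ : ℕ∞) φ → HasCompactSupport φ →
      tsupport φ ⊆ U → ContDiff ℝ (⊤ : ℕ∞) η → HasCompactSupport η → tsupport η ⊆ J →
      ∫ z, (ω z * φ z.1 + (u z 1 * pderiv 0 φ z.1 - u z 0 * pderiv 1 φ z.1)) * η z.2 = 0

/-- The vorticity of `χ u`. -/
def curlSource (χ : Plane → ℝ) (u : SpaceTime → Plane) (ω : SpaceTime → ℝ) (z : SpaceTime) : ℝ :=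
  ω z * χ z.1 + (u z 1 * pderiv 0 χ z.1 - u z 0 * pderiv 1 χ z.1)

/-- The negative of the divergence of `χ u`. -/
def divSource (χ : Plane → ℝ) (u : SpaceTime → Plane) (z : SpaceTime) : ℝ :=
  -(u z 0 * pderiv 0 χ z.1 + u z 1 * pderiv 1 χ z.1)

theorem pderiv_mul {f g : Plane → ℝ} (hf : ContDiff ℝ 1 f) (hg : ContDiff ℝ 1 g) (i : Fin 2)
    (x : Plane) : pderiv i (fun y => f y * g y) x = f x * pderiv i g x + g x * pderiv i f x := by
  rw [pderiv, fderiv_fun_mul ((hf.differentiable one_ne_zero) x) ((hg.differentiable one_ne_zero) x)]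
  simp [pderiv]

theorem Integrable.mul_fst_mul_snd {f : SpaceTime → ℝ} (hf : Integrable f) {c : Plane → ℝ}
    {η : ℝ → ℝ} (hc : Continuous c) (hcc : HasCompactSupport c) (hη : Continuous η)
    (hηc : HasCompactSupport η) : Integrable fun z => f z * c z.1 * η z.2 := by
  obtain ⟨C, hC⟩ := hcc.exists_bound_of_continuous hc
  obtain ⟨C', hC'⟩ := hηc.exists_bound_of_continuous hη
  exact (hf.mul_bdd (g := fun z : SpaceTime => c z.1) (c := C)
    (Continuous.aestronglyMeasurable (by fun_prop)) (Filter.Eventually.of_forall fun z => hC _)).mul_bdd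
    (g := fun z : SpaceTime => η z.2) (c := C')
    (Continuous.aestronglyMeasurable (by fun_prop)) (Filter.Eventually.of_forall fun z => hC' _)

theorem Integrable.mul_fst {f : SpaceTime → ℝ} (hf : Integrable f) {c : Plane → ℝ}
    (hc : Continuous c) (hcc : HasCompactSupport c) : Integrable fun z => f z * c z.1 := by
  obtain ⟨C, hC⟩ := hcc.exists_bound_of_continuous hc
  exact hf.mul_bdd (g := fun z : SpaceTime => c z.1) (c := C)
    (Continuous.aestronglyMeasurable (by fun_prop)) (Filter.Eventually.of_forall fun z => hC _)

section Representation

variable {U : Set Plane} {J : Set ℝ} {u : SpaceTime → Plane} {ω : SpaceTime → ℝ}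
  {χ : Plane → ℝ}

theorem Integrable.coord (hui : Integrable u) (i : Fin 2) : Integrable fun z => u z i :=
  (EuclideanSpace.proj i : Plane →L[ℝ] ℝ).integrable_comp hui

theorem measurable_coord (hum : Measurable u) (i : Fin 2) : Measurable fun z => u z i :=
  (EuclideanSpace.proj i : Plane →L[ℝ] ℝ).measurable.comp hum

theorem integrable_curlSource (hui : Integrable u) (hωi : Integrable ω)
    (hχ : ContDiff ℝ (⊤ : ℕ∞) χ) (hχc : HasCompactSupport χ) : Integrable (curlSource χ u ω) := by
  have hχ1 : ContDiff ℝ 1 χ := hχ.of_le (by exact_mod_cast le_top)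
  exact (Integrable.mul_fst hωi hχ.continuous hχc).add
    ((Integrable.mul_fst (Integrable.coord hui 1) (continuous_pderiv hχ1 0)
      (hasCompactSupport_pderiv hχc 0)).sub
    (Integrable.mul_fst (Integrable.coord hui 0) (continuous_pderiv hχ1 1)
      (hasCompactSupport_pderiv hχc 1)))

theorem integrable_divSource (hui : Integrable u)
    (hχ : ContDiff ℝ (⊤ : ℕ∞) χ) (hχc : HasCompactSupport χ) : Integrable (divSource χ u) := by
  have hχ1 : ContDiff ℝ 1 χ := hχ.of_le (by exact_mod_cast le_top)
  exact ((Integrable.mul_fst (Integrable.coord hui 0) (continuous_pderiv hχ1 0)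
      (hasCompactSupport_pderiv hχc 0)).add
    (Integrable.mul_fst (Integrable.coord hui 1) (continuous_pderiv hχ1 1)
      (hasCompactSupport_pderiv hχc 1))).neg

theorem measurable_curlSource (hum : Measurable u) (hωm : Measurable ω)
    (hχ : ContDiff ℝ (⊤ : ℕ∞) χ) : Measurable (curlSource χ u ω) := by
  have hχ1 : ContDiff ℝ 1 χ := hχ.of_le (by exact_mod_cast le_top)
  have h (i : Fin 2) : Measurable fun z : SpaceTime => pderiv i χ z.1 :=
    (continuous_pderiv hχ1 i).measurable.comp measurable_fst
  exact (hωm.mul (hχ.continuous.measurable.comp measurable_fst)).add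
    (((measurable_coord hum 1).mul (h 0)).sub ((measurable_coord hum 0).mul (h 1)))

theorem measurable_divSource (hum : Measurable u)
    (hχ : ContDiff ℝ (⊤ : ℕ∞) χ) : Measurable (divSource χ u) := by
  have hχ1 : ContDiff ℝ 1 χ := hχ.of_le (by exact_mod_cast le_top)
  have h (i : Fin 2) : Measurable fun z : SpaceTime => pderiv i χ z.1 :=
    (continuous_pderiv hχ1 i).measurable.comp measurable_fst
  exact (((measurable_coord hum 0).mul (h 0)).add ((measurable_coord hum 1).mul (h 1))).neg

/-- A linear combination of `u`, `ω` and their potentials vanishes on `U × J` as soon as it is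
orthogonal to all tensor products. -/
theorem ae_eq_potential_of_tensor (hU : IsOpen U) (hfin : volume U ≠ ∞) (hJ : IsOpen J)
    {f S S' : SpaceTime → ℝ} (hf : Integrable f) (hS : Integrable S) (hSm : Measurable S)
    (hS' : Integrable S') (hSm' : Measurable S') (i j : Fin 2)
    (h : ∀ (g : Plane → ℝ) (η : ℝ → ℝ), ContDiff ℝ (⊤ : ℕ∞) g → HasCompactSupport g →
      tsupport g ⊆ U → ContDiff ℝ (⊤ : ℕ∞) η → HasCompactSupport η → tsupport η ⊆ J →
      ∫ z, f z * (g z.1 * η z.2) = (∫ z, S z * kernConv i g z.1 * η z.2) +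
        ∫ z, S' z * kernConv j g z.1 * η z.2) :
    ∀ᵐ z : SpaceTime, z ∈ U ×ˢ J → f z = potential i S z + potential j S' z := by
  have hP := integrable_indicator_potential i hS hSm hU.measurableSet hfin
  have hP' := integrable_indicator_potential j hS' hSm' hU.measurableSet hfin
  have hUJ : MeasurableSet (U ×ˢ J) := hU.measurableSet.prod hJ.measurableSet
  set F : SpaceTime → ℝ := (U ×ˢ J).indicator fun z =>
    f z - (U.indicator 1 z.1 * potential i S z + U.indicator 1 z.1 * potential j S' z) with hFdef
  have hF : Integrable F := (hf.sub (hP.add hP')).indicator hUJ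
  have key := ae_eq_zero_of_integral_tensor_eq_zero hF hU hJ
    (fun z hz => indicator_of_notMem hz _) (fun g η hg hgc hgU hη hηc hηJ => by
      have hb : ∀ {k : SpaceTime → ℝ}, Integrable k → Integrable fun z => k z * (g z.1 * η z.2) := by
        intro k hk
        simpa only [mul_assoc] using
          Integrable.mul_fst_mul_snd hk hg.continuous hgc hη.continuous hηc
      have hind : ∀ k : SpaceTime → ℝ, (fun z => U.indicator 1 z.1 * k z * (g z.1 * η z.2)) =
          fun z => k z * (g z.1 * η z.2) := by
        intro k; ext z
        by_cases hz : z.1 ∈ U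
        · simp [hz]
        · have : g z.1 = 0 := image_eq_zero_of_notMem_tsupport fun h => hz (hgU h)
          simp [this]
      have h1 := hb hP
      have h2 := hb hP'
      rw [hind] at h1 h2
      have hcongr : (fun z => F z * (g z.1 * η z.2)) = fun z => f z * (g z.1 * η z.2) -
          (potential i S z * (g z.1 * η z.2) + potential j S' z * (g z.1 * η z.2)) := by
        ext z
        by_cases hz : z ∈ U ×ˢ J
        · rw [hFdef, indicator_of_mem hz, indicator_of_mem hz.1]
          simp only [Pi.one_apply]
          ring
        · have : g z.1 * η z.2 = 0 := by
            by_contra hne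
            exact hz ⟨hgU (subset_tsupport _ (left_ne_zero_of_mul hne)),
              hηJ (subset_tsupport _ (right_ne_zero_of_mul hne))⟩
          simp [this]
      rw [hcongr, integral_sub (hb hf) (by exact h1.add h2), integral_add h1 h2,
        h g η hg hgc hgU hη hηc hηJ,
        integral_source_kernConv i hS hSm hU.measurableSet hfin hg.continuous hgc hgU
          hη.continuous hηc,
        integral_source_kernConv j hS' hSm' hU.measurableSet hfin hg.continuous hgc hgU
          hη.continuous hηc, sub_self])
  filter_upwards [key] with z hz hmem
  rw [hFdef, indicator_of_mem hmem, indicator_of_mem hmem.1] at hz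
  simp only [Pi.one_apply, Pi.zero_apply, one_mul] at hz
  linarith

theorem integrable_curlSource_mul (hui : Integrable u) (hωi : Integrable ω)
    (hχ : ContDiff ℝ (⊤ : ℕ∞) χ) (hχc : HasCompactSupport χ) {c : Plane → ℝ} (hc : Continuous c)
    {η : ℝ → ℝ} (hη : Continuous η) (hηc : HasCompactSupport η) :
    Integrable fun z => curlSource χ u ω z * c z.1 * η z.2 := by
  have hχ1 : ContDiff ℝ 1 χ := hχ.of_le (by exact_mod_cast le_top)
  have h1 := Integrable.mul_fst_mul_snd hωi (hχ.continuous.mul hc) hχc.mul_right hη hηc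
  have h2 := Integrable.mul_fst_mul_snd (Integrable.coord hui 1) ((continuous_pderiv hχ1 0).mul hc)
    (hasCompactSupport_pderiv hχc 0).mul_right hη hηc
  have h3 := Integrable.mul_fst_mul_snd (Integrable.coord hui 0) ((continuous_pderiv hχ1 1).mul hc)
    (hasCompactSupport_pderiv hχc 1).mul_right hη hηc
  refine (h1.add (h2.sub h3)).congr (Filter.Eventually.of_forall fun z => ?_)
  simp only [curlSource, Pi.add_apply, Pi.sub_apply, Pi.mul_apply]
  ring

theorem integrable_divSource_mul (hui : Integrable u)
    (hχ : ContDiff ℝ (⊤ : ℕ∞) χ) (hχc : HasCompactSupport χ) {c : Plane → ℝ} (hc : Continuous c)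
    {η : ℝ → ℝ} (hη : Continuous η) (hηc : HasCompactSupport η) :
    Integrable fun z => divSource χ u z * c z.1 * η z.2 := by
  have hχ1 : ContDiff ℝ 1 χ := hχ.of_le (by exact_mod_cast le_top)
  have h2 := Integrable.mul_fst_mul_snd (Integrable.coord hui 0) ((continuous_pderiv hχ1 0).mul hc)
    (hasCompactSupport_pderiv hχc 0).mul_right hη hηc
  have h3 := Integrable.mul_fst_mul_snd (Integrable.coord hui 1) ((continuous_pderiv hχ1 1).mul hc)
    (hasCompactSupport_pderiv hχc 1).mul_right hη hηc
  refine (h2.add h3).neg.congr (Filter.Eventually.of_forall fun z => ?_)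
  simp only [divSource, Pi.add_apply, Pi.neg_apply, Pi.mul_apply]
  ring

theorem integrable_div_test (hui : Integrable u) {φ : Plane → ℝ} (hφ : ContDiff ℝ 1 φ)
    (hφc : HasCompactSupport φ) {η : ℝ → ℝ} (hη : Continuous η) (hηc : HasCompactSupport η) :
    Integrable fun z => (u z 0 * pderiv 0 φ z.1 + u z 1 * pderiv 1 φ z.1) * η z.2 := by
  have h2 := Integrable.mul_fst_mul_snd (Integrable.coord hui 0) (continuous_pderiv hφ 0)
    (hasCompactSupport_pderiv hφc 0) hη hηc
  have h3 := Integrable.mul_fst_mul_snd (Integrable.coord hui 1) (continuous_pderiv hφ 1)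
    (hasCompactSupport_pderiv hφc 1) hη hηc
  refine (h2.add h3).congr (Filter.Eventually.of_forall fun z => ?_)
  simp only [Pi.add_apply]
  ring

theorem integrable_curl_test (hui : Integrable u) (hωi : Integrable ω) {φ : Plane → ℝ}
    (hφ : ContDiff ℝ 1 φ) (hφc : HasCompactSupport φ) {η : ℝ → ℝ} (hη : Continuous η)
    (hηc : HasCompactSupport η) :
    Integrable fun z =>
      (ω z * φ z.1 + (u z 1 * pderiv 0 φ z.1 - u z 0 * pderiv 1 φ z.1)) * η z.2 := by
  have h1 := Integrable.mul_fst_mul_snd hωi hφ.continuous hφc hη hηc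
  have h2 := Integrable.mul_fst_mul_snd (Integrable.coord hui 1) (continuous_pderiv hφ 0)
    (hasCompactSupport_pderiv hφc 0) hη hηc
  have h3 := Integrable.mul_fst_mul_snd (Integrable.coord hui 0) (continuous_pderiv hφ 1)
    (hasCompactSupport_pderiv hφc 1) hη hηc
  refine (h1.add (h2.sub h3)).congr (Filter.Eventually.of_forall fun z => ?_)
  simp only [Pi.add_apply, Pi.sub_apply]
  ring

/-- Test the divergence equation with `χ · kernConv 0 g` and the curl equation with `χ · kernConv 1
g`, and subtract. Derivatives falling on the convolutions combine to `u₀ χ g` by `div_kernConv` and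
`curl_kernConv`; the remaining terms are the two sources. -/
theorem ae_coord_zero_eq (hU : IsOpen U) (hfin : volume U ≠ ∞) (hJ : IsOpen J)
    (hum : Measurable u) (hui : Integrable u) (hωm : Measurable ω) (hωi : Integrable ω)
    (h : IsPlanarDivCurl U J u ω) (hχ : ContDiff ℝ (⊤ : ℕ∞) χ) (hχc : HasCompactSupport χ)
    (hχU : tsupport χ ⊆ U) :
    ∀ᵐ z : SpaceTime, z ∈ U ×ˢ J → u z 0 * χ z.1 =
      potential 1 (curlSource χ u ω) z + potential 0 (divSource χ u) z := by
  refine ae_eq_potential_of_tensor hU hfin hJ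
    (Integrable.mul_fst (Integrable.coord hui 0) hχ.continuous hχc)
    (integrable_curlSource hui hωi hχ hχc) (measurable_curlSource hum hωm hχ)
    (integrable_divSource hui hχ hχc) (measurable_divSource hum hχ) 1 0 ?_
  intro g η hg hgc hgU hη hηc hηJ
  have hχ1 : ContDiff ℝ 1 χ := hχ.of_le (by exact_mod_cast le_top)
  have hg1 : ContDiff ℝ 1 g := hg.of_le (by exact_mod_cast le_top)
  have hk (i : Fin 2) := contDiff_kernConv i hg hgc
  have hk1 (i : Fin 2) : ContDiff ℝ 1 (kernConv i g) := (hk i).of_le (by exact_mod_cast le_top)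
  have hsupp (i : Fin 2) : tsupport (fun x => χ x * kernConv i g x) ⊆ U :=
    (tsupport_mul_subset_left (f := χ)).trans hχU
  have hcs (i : Fin 2) : HasCompactSupport (fun x => χ x * kernConv i g x) := hχc.mul_right
  have hD := h.div_eq _ η (hχ.mul (hk 0)) (hcs 0) (hsupp 0) hη hηc hηJ
  have hC := h.curl_eq _ η (hχ.mul (hk 1)) (hcs 1) (hsupp 1) hη hηc hηJ
  have iD := integrable_div_test hui (hχ1.mul (hk1 0)) (hcs 0) hη.continuous hηc
  have iC := integrable_curl_test hui hωi (hχ1.mul (hk1 1)) (hcs 1) hη.continuous hηc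
  have iS := integrable_curlSource_mul hui hωi hχ hχc (hk 1).continuous hη.continuous hηc
  have iS' := integrable_divSource_mul hui hχ hχc (hk 0).continuous hη.continuous hηc
  -- The two vanishing test identities are inserted as `0 - 0`, so that the claim becomes a
  -- pointwise identity of integrands.
  rw [← integral_add iS iS', ← add_zero (∫ z, _ + _), ← sub_self (0 : ℝ)]
  nth_rewrite 1 [← hD]
  rw [← hC, ← integral_sub iD iC, ← integral_add (by exact iS.add iS') (by exact iD.sub iC)]
  congr 1
  ext z
  rw [pderiv_mul hχ1 (hk1 0), pderiv_mul hχ1 (hk1 0), pderiv_mul hχ1 (hk1 1),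
    pderiv_mul hχ1 (hk1 1), curl_kernConv hg1 hgc, ← div_kernConv hg1 hgc z.1, curlSource, divSource]
  ring

/-- Same argument with the two convolutions interchanged and the identities added instead of
subtracted, which produces the minus sign on the curl source. -/
theorem ae_coord_one_eq (hU : IsOpen U) (hfin : volume U ≠ ∞) (hJ : IsOpen J)
    (hum : Measurable u) (hui : Integrable u) (hωm : Measurable ω) (hωi : Integrable ω)
    (h : IsPlanarDivCurl U J u ω) (hχ : ContDiff ℝ (⊤ : ℕ∞) χ) (hχc : HasCompactSupport χ)
    (hχU : tsupport χ ⊆ U) :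
    ∀ᵐ z : SpaceTime, z ∈ U ×ˢ J → u z 1 * χ z.1 =
      potential 0 (fun z => -curlSource χ u ω z) z + potential 1 (divSource χ u) z := by
  refine ae_eq_potential_of_tensor hU hfin hJ
    (Integrable.mul_fst (Integrable.coord hui 1) hχ.continuous hχc)
    (integrable_curlSource hui hωi hχ hχc).fun_neg (measurable_curlSource hum hωm hχ).fun_neg
    (integrable_divSource hui hχ hχc) (measurable_divSource hum hχ) 0 1 ?_
  intro g η hg hgc hgU hη hηc hηJ
  have hχ1 : ContDiff ℝ 1 χ := hχ.of_le (by exact_mod_cast le_top)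
  have hg1 : ContDiff ℝ 1 g := hg.of_le (by exact_mod_cast le_top)
  have hk (i : Fin 2) := contDiff_kernConv i hg hgc
  have hk1 (i : Fin 2) : ContDiff ℝ 1 (kernConv i g) := (hk i).of_le (by exact_mod_cast le_top)
  have hsupp (i : Fin 2) : tsupport (fun x => χ x * kernConv i g x) ⊆ U :=
    (tsupport_mul_subset_left (f := χ)).trans hχU
  have hcs (i : Fin 2) : HasCompactSupport (fun x => χ x * kernConv i g x) := hχc.mul_right
  have hD := h.div_eq _ η (hχ.mul (hk 1)) (hcs 1) (hsupp 1) hη hηc hηJ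
  have hC := h.curl_eq _ η (hχ.mul (hk 0)) (hcs 0) (hsupp 0) hη hηc hηJ
  have iD := integrable_div_test hui (hχ1.mul (hk1 1)) (hcs 1) hη.continuous hηc
  have iC := integrable_curl_test hui hωi (hχ1.mul (hk1 0)) (hcs 0) hη.continuous hηc
  have iS : Integrable fun z => -curlSource χ u ω z * kernConv 0 g z.1 * η z.2 := by
    simpa only [neg_mul] using
      (integrable_curlSource_mul hui hωi hχ hχc (hk 0).continuous hη.continuous hηc).fun_neg
  have iS' := integrable_divSource_mul hui hχ hχc (hk 1).continuous hη.continuous hηc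
  rw [← integral_add iS iS', ← add_zero (∫ z, _ + _), ← add_zero (0 : ℝ)]
  nth_rewrite 1 [← hD]
  rw [← hC, ← integral_add iD iC, ← integral_add (by exact iS.add iS') (by exact iD.add iC)]
  congr 1
  ext z
  rw [pderiv_mul hχ1 (hk1 0), pderiv_mul hχ1 (hk1 0), pderiv_mul hχ1 (hk1 1),
    pderiv_mul hχ1 (hk1 1), curl_kernConv hg1 hgc, ← div_kernConv hg1 hgc z.1, curlSource, divSource]
  ring

end Representation

/-! ### Smooth cutoffs with quantitative derivative bounds. -/

theorem exists_abs_deriv_smoothTransition_le :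
    ∃ S : ℝ, 0 < S ∧ ∀ x, |deriv Real.smoothTransition x| ≤ S := by
  have hc : Continuous (deriv Real.smoothTransition) :=
    (Real.smoothTransition.contDiff (n := 1)).continuous_deriv le_rfl
  obtain ⟨C, hC⟩ := (isCompact_Icc (a := (0 : ℝ)) (b := 1)).exists_bound_of_continuousOn
    hc.continuousOn
  refine ⟨max C 1, by positivity, fun x => ?_⟩
  by_cases hx : x ∈ Icc (0 : ℝ) 1
  · exact (hC x hx).trans (le_max_left _ _)
  · have : deriv Real.smoothTransition x = 0 := by
      rw [mem_Icc, not_and_or, not_le, not_le] at hx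
      rcases hx with hx | hx
      · have h : Real.smoothTransition =ᶠ[nhds x] fun _ => 0 := by
          filter_upwards [Iio_mem_nhds hx] with y hy
          exact Real.smoothTransition.zero_of_nonpos (le_of_lt hy)
        rw [h.deriv_eq]; simp
      · have h : Real.smoothTransition =ᶠ[nhds x] fun _ => 1 := by
          filter_upwards [Ioi_mem_nhds hx] with y hy
          exact Real.smoothTransition.one_of_one_le (le_of_lt hy)
        rw [h.deriv_eq]; simp
    rw [this, abs_zero]; positivity

/-- A bound for the derivative of the smooth transition function. -/
def transitionBound : ℝ := exists_abs_deriv_smoothTransition_le.choose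

theorem transitionBound_pos : 0 < transitionBound :=
  exists_abs_deriv_smoothTransition_le.choose_spec.1

theorem abs_deriv_smoothTransition_le (x : ℝ) :
    |deriv Real.smoothTransition x| ≤ transitionBound :=
  exists_abs_deriv_smoothTransition_le.choose_spec.2 x

/-- The profile is a function of `‖x - x₀‖²`, hence smooth at the centre. Its slope `2b/(b² - a²)`
is at most `2/(b - a)` because `b ≤ a + b`. -/
theorem exists_space_cutoff (x₀ : Plane) {a b : ℝ} (ha : 0 < a) (hab : a < b) :
    ∃ χ : Plane → ℝ, ContDiff ℝ (⊤ : ℕ∞) χ ∧ (∀ x, 0 ≤ χ x) ∧ (∀ x, χ x ≤ 1) ∧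
      (∀ x ∈ Metric.closedBall x₀ a, χ x = 1) ∧ tsupport χ ⊆ Metric.closedBall x₀ b ∧
      ∀ x, ‖fderiv ℝ χ x‖ ≤ 2 * transitionBound / (b - a) := by
  have hd : 0 < b ^ 2 - a ^ 2 := by nlinarith
  have hb : 0 < b := ha.trans hab
  have hS := transitionBound_pos
  set q : Plane → ℝ := fun x => (b ^ 2 - ‖x - x₀‖ ^ 2) / (b ^ 2 - a ^ 2) with hq
  have hqs : ContDiff ℝ (⊤ : ℕ∞) q :=
    (contDiff_const.sub ((contDiff_id.sub contDiff_const).norm_sq ℝ)).div_const _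
  have hts : tsupport (fun x => Real.smoothTransition (q x)) ⊆ Metric.closedBall x₀ b := by
    refine closure_minimal (fun x hx => ?_) Metric.isClosed_closedBall
    by_contra hn
    rw [Metric.mem_closedBall, dist_eq_norm, not_le] at hn
    refine hx (Real.smoothTransition.zero_of_nonpos ?_)
    refine div_nonpos_of_nonpos_of_nonneg ?_ hd.le
    nlinarith
  refine ⟨fun x => Real.smoothTransition (q x), Real.smoothTransition.contDiff.comp hqs,
    fun x => Real.smoothTransition.nonneg _, fun x => Real.smoothTransition.le_one _, ?_, hts, ?_⟩
  · intro x hx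
    rw [Metric.mem_closedBall, dist_eq_norm] at hx
    refine Real.smoothTransition.one_of_one_le ?_
    rw [hq, one_le_div hd]
    nlinarith [norm_nonneg (x - x₀)]
  · intro x
    by_cases hx : x ∈ Metric.closedBall x₀ b
    · rw [Metric.mem_closedBall, dist_eq_norm] at hx
      have h1 : HasFDerivAt q ((b ^ 2 - a ^ 2)⁻¹ • -((2 : ℕ) •
          ((innerSL ℝ (x - x₀) : Plane →L[ℝ] ℝ).comp (ContinuousLinearMap.id ℝ Plane)))) x := by
        have h2 := ((hasFDerivAt_id x).sub_const x₀).norm_sq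
        have h3 := ((hasFDerivAt_const (b ^ 2) x).sub h2).mul_const ((b ^ 2 - a ^ 2)⁻¹)
        simp only [zero_sub] at h3
        exact h3
      have h2 : HasDerivAt Real.smoothTransition (deriv Real.smoothTransition (q x)) (q x) :=
        ((Real.smoothTransition.contDiff (n := 1)).differentiable one_ne_zero _).hasDerivAt
      have h3 := h2.comp_hasFDerivAt x h1
      have h4 : fderiv ℝ (fun x => Real.smoothTransition (q x)) x = _ := h3.fderiv
      rw [h4, norm_smul, norm_smul, norm_neg, ContinuousLinearMap.comp_id, Real.norm_eq_abs,
        Real.norm_eq_abs, abs_of_pos (inv_pos.2 hd)]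
      have h5 : ‖(2 : ℕ) • (innerSL ℝ (x - x₀) : Plane →L[ℝ] ℝ)‖ ≤ 2 * b := by
        refine (norm_nsmul_le).trans ?_
        rw [innerSL_apply_norm]
        norm_num
        exact hx
      calc _ ≤ transitionBound * ((b ^ 2 - a ^ 2)⁻¹ * (2 * b)) := by
            gcongr
            exact abs_deriv_smoothTransition_le _
        _ ≤ 2 * transitionBound / (b - a) := by
            have : b ^ 2 - a ^ 2 = (b - a) * (b + a) := by ring
            have h0 : 0 < b - a := sub_pos.2 hab
            rw [this]
            field_simp
            linarith
    · have : x ∉ Function.support (fderiv ℝ fun x => Real.smoothTransition (q x)) := fun hm =>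
        hx (hts (support_fderiv_subset ℝ hm))
      rw [Function.notMem_support.1 this, norm_zero]
      have : 0 < b - a := sub_pos.2 hab
      positivity

theorem exists_time_cutoff {a a' b' b : ℝ} (ha : a < a') (hb : b' < b) :
    ∃ η : ℝ → ℝ, ContDiff ℝ (⊤ : ℕ∞) η ∧ (∀ t, 0 ≤ η t) ∧ (∀ t, η t ≤ 1) ∧
      (∀ t ∈ Icc a' b', η t = 1) ∧ (∀ t, t ∉ Ioo a b → η t = 0) ∧
      ∀ t, |deriv η t| ≤ transitionBound / (a' - a) + transitionBound / (b - b') := by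
  have ha0 : 0 < a' - a := sub_pos.2 ha
  have hb0 : 0 < b - b' := sub_pos.2 hb
  set p : ℝ → ℝ := fun t => Real.smoothTransition ((t - a) / (a' - a))
  set q : ℝ → ℝ := fun t => Real.smoothTransition ((b - t) / (b - b'))
  have hT : ∀ x, HasDerivAt Real.smoothTransition (deriv Real.smoothTransition x) x := fun x =>
    ((Real.smoothTransition.contDiff (n := 1)).differentiable one_ne_zero _).hasDerivAt
  refine ⟨fun t => p t * q t, ?_, fun t => mul_nonneg (Real.smoothTransition.nonneg _)
    (Real.smoothTransition.nonneg _), fun t => mul_le_one₀ (Real.smoothTransition.le_one _)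
    (Real.smoothTransition.nonneg _) (Real.smoothTransition.le_one _), ?_, ?_, ?_⟩
  · exact (Real.smoothTransition.contDiff.comp ((contDiff_id.sub contDiff_const).div_const _)).mul
      (Real.smoothTransition.contDiff.comp ((contDiff_const.sub contDiff_id).div_const _))
  · rintro t ⟨h1, h2⟩
    have e1 : p t = 1 := Real.smoothTransition.one_of_one_le (by rw [one_le_div ha0]; linarith)
    have e2 : q t = 1 := Real.smoothTransition.one_of_one_le (by rw [one_le_div hb0]; linarith)
    simp [e1, e2]
  · intro t ht
    rw [mem_Ioo, not_and_or, not_lt, not_lt] at ht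
    rcases ht with ht | ht
    · have : p t = 0 := Real.smoothTransition.zero_of_nonpos
        (div_nonpos_of_nonpos_of_nonneg (by linarith) ha0.le)
      simp [this]
    · have : q t = 0 := Real.smoothTransition.zero_of_nonpos
        (div_nonpos_of_nonpos_of_nonneg (by linarith) hb0.le)
      simp [this]
  · intro t
    have hp : HasDerivAt p (deriv Real.smoothTransition ((t - a) / (a' - a)) * (1 / (a' - a))) t :=
      (hT _).comp t (((hasDerivAt_id t).sub_const a).div_const _)
    have hq : HasDerivAt q (deriv Real.smoothTransition ((b - t) / (b - b')) * (-1 / (b - b'))) t :=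
      (hT _).comp t (((hasDerivAt_id t).const_sub b).div_const _)
    have hpq : deriv (fun t => p t * q t) t = _ := (hp.mul hq).deriv
    rw [hpq]
    refine (abs_add_le _ _).trans (add_le_add ?_ ?_)
    · rw [abs_mul, abs_mul, abs_of_pos (a := 1 / (a' - a)) (by positivity),
        abs_of_nonneg (Real.smoothTransition.nonneg _)]
      calc _ ≤ transitionBound * (1 / (a' - a)) * 1 :=
            mul_le_mul (mul_le_mul_of_nonneg_right (abs_deriv_smoothTransition_le _) (by positivity))
              (Real.smoothTransition.le_one _) (Real.smoothTransition.nonneg _)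
              (mul_nonneg transitionBound_pos.le (by positivity))
        _ = _ := by ring
    · rw [abs_mul, abs_mul, abs_div, abs_neg, abs_one, abs_of_pos hb0,
        abs_of_nonneg (a := p t) (Real.smoothTransition.nonneg _)]
      calc _ ≤ 1 * (transitionBound * (1 / (b - b'))) :=
            mul_le_mul (Real.smoothTransition.le_one _)
              (mul_le_mul_of_nonneg_right (abs_deriv_smoothTransition_le _) (by positivity))
              (by positivity) zero_le_one
        _ = _ := by ring

theorem abs_pderiv_le (i : Fin 2) (χ : Plane → ℝ) (x : Plane) : |pderiv i χ x| ≤ ‖fderiv ℝ χ x‖ := by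
  have := (fderiv ℝ χ x).le_opNorm (EuclideanSpace.single i 1)
  simpa [pderiv] using this

/-! ### The pointwise elliptic bound for the velocity. -/

section Bound

variable {u : SpaceTime → Plane} {ω : SpaceTime → ℝ} {χ : Plane → ℝ}

/-- The part `L v` of the source comes from the derivative of a cutoff and lives outside the ball of
radius `m`, at distance at least `m - a` from `x`. There the kernel is bounded, so this part costs
only an `L¹` norm. -/
theorem enorm_integral_kern_mul_le {x₀ x : Plane} {a m b L : ℝ} (hx : x ∈ Metric.ball x₀ a)
    (ham : a < m) (hL : 0 ≤ L) {s w v : Plane → ℝ} (hw : Measurable w) (hv : ∀ y, 0 ≤ v y)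
    (h_out : ∀ y, y ∉ Metric.closedBall x₀ b → s y = 0)
    (h_in : ∀ y ∈ Metric.ball x₀ m, |s y| ≤ |w y|)
    (h_mid : ∀ y, |s y| ≤ |w y| + L * v y) (i : Fin 2) :
    ‖∫ y, kern i (y - x) * s y‖ₑ ≤ ENNReal.ofReal (2 * Real.pi)⁻¹ *
      ((∫⁻ y in Metric.closedBall x₀ b, ‖w y‖ₑ * ‖x - y‖ₑ⁻¹) +
        ENNReal.ofReal (L / (m - a)) * ∫⁻ y in Metric.closedBall x₀ b, ENNReal.ofReal (v y)) := by
  have hma : 0 < m - a := sub_pos.2 ham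
  refine (enorm_integral_le_lintegral_enorm _).trans ?_
  rw [← lintegral_const_mul' _ _ ENNReal.ofReal_ne_top,
    ← lintegral_add_left (by fun_prop), ← lintegral_const_mul' _ _ ENNReal.ofReal_ne_top,
    ← lintegral_indicator Metric.isClosed_closedBall.measurableSet]
  refine lintegral_mono fun y => ?_
  by_cases hy : y ∈ Metric.closedBall x₀ b
  swap
  · simp [h_out y hy]
  rw [indicator_of_mem hy, enorm_mul]
  have hk := enorm_kern_le i (y - x)
  rw [← neg_sub x y, enorm_neg, neg_sub] at hk
  refine (mul_le_mul_left hk _).trans ?_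
  rw [mul_assoc]
  refine mul_le_mul_right ?_ _
  have abs_enorm : ∀ r : ℝ, ‖r‖ₑ = ENNReal.ofReal |r| := fun r => by
    rw [← ofReal_norm, Real.norm_eq_abs]
  by_cases hym : y ∈ Metric.ball x₀ m
  · rw [mul_comm]
    refine le_add_right (mul_le_mul_left ?_ _)
    rw [abs_enorm, abs_enorm]
    exact ENNReal.ofReal_le_ofReal (h_in y hym)
  · have hd : m - a ≤ ‖x - y‖ := by
      rw [Metric.mem_ball, not_lt] at hym
      rw [Metric.mem_ball] at hx
      have := dist_triangle y x x₀
      rw [← dist_eq_norm, dist_comm x y]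
      linarith
    have h1 : ‖x - y‖ₑ⁻¹ ≤ ENNReal.ofReal (1 / (m - a)) := by
      rw [one_div, ENNReal.ofReal_inv_of_pos hma, ENNReal.inv_le_inv, ← ofReal_norm]
      exact ENNReal.ofReal_le_ofReal hd
    calc ‖x - y‖ₑ⁻¹ * ‖s y‖ₑ ≤ ‖x - y‖ₑ⁻¹ * (‖w y‖ₑ + ENNReal.ofReal (L * v y)) := by
          gcongr
          rw [abs_enorm, abs_enorm, ← ENNReal.ofReal_add (abs_nonneg _) (mul_nonneg hL (hv y))]
          exact ENNReal.ofReal_le_ofReal (h_mid y)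
      _ ≤ _ := by
          rw [mul_add, mul_comm ‖w y‖ₑ]
          refine add_le_add le_rfl ?_
          calc _ ≤ ENNReal.ofReal (1 / (m - a)) * ENNReal.ofReal (L * v y) := by gcongr
            _ = _ := by
              rw [← ENNReal.ofReal_mul (by positivity), ← ENNReal.ofReal_mul (by positivity)]
              congr 1; ring

theorem pderiv_eq_zero_of_ball {x₀ : Plane} {m : ℝ} (h1 : ∀ x ∈ Metric.closedBall x₀ m, χ x = 1)
    (i : Fin 2) {y : Plane} (hy : y ∈ Metric.ball x₀ m) : pderiv i χ y = 0 := by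
  have h : χ =ᶠ[nhds y] fun _ => 1 := by
    filter_upwards [Metric.isOpen_ball.mem_nhds hy] with z hz
    exact h1 z (Metric.ball_subset_closedBall hz)
  rw [pderiv, h.fderiv_eq]
  simp

theorem pderiv_eq_zero_of_notMem {A : Set Plane} (h1 : tsupport χ ⊆ A)
    (i : Fin 2) {y : Plane} (hy : y ∉ A) : pderiv i χ y = 0 := by
  have : y ∉ Function.support (fderiv ℝ χ) := fun hm => hy (h1 (support_fderiv_subset ℝ hm))
  rw [pderiv, Function.notMem_support.1 this]
  simp

/-- Local elliptic bound: `u` is controlled by the potential of its vorticity and its `L¹` norm. -/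
theorem ae_enorm_le_potential {x₀ : Plane} {R a b : ℝ} {J : Set ℝ} (ha : 0 < a) (hab : a < b)
    (hbR : b < R) (hJ : IsOpen J) (hum : Measurable u) (hui : Integrable u) (hωm : Measurable ω)
    (hωi : Integrable ω) (h : IsPlanarDivCurl (Metric.ball x₀ R) J u ω) :
    ∀ᵐ z : SpaceTime, z ∈ Metric.ball x₀ a ×ˢ J →
      ‖u z‖ₑ ≤ (∫⁻ y in Metric.closedBall x₀ b, ‖ω (y, z.2)‖ₑ * ‖z.1 - y‖ₑ⁻¹) +
        ENNReal.ofReal (32 * transitionBound / (b - a) ^ 2) *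
          ∫⁻ y in Metric.closedBall x₀ b, ‖u (y, z.2)‖ₑ := by
  have hS := transitionBound_pos
  have hba : 0 < b - a := sub_pos.2 hab
  -- The cutoff is constant up to the midpoint radius, so half of the gap separates `∇χ` from the
  -- points of interest and the other half carries the transition.
  obtain ⟨χ, hχ, hχ0, hχ1, hχm, hχb, hχd⟩ :=
    exists_space_cutoff x₀ (a := (a + b) / 2) (b := b) (by linarith) (by linarith)
  set m := (a + b) / 2 with hm
  have hχc : HasCompactSupport χ :=
    (isCompact_closedBall x₀ b).of_isClosed_subset (isClosed_tsupport χ) hχb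
  have hχU : tsupport χ ⊆ Metric.ball x₀ R := hχb.trans (Metric.closedBall_subset_ball hbR)
  have hfin : volume (Metric.ball x₀ R) ≠ ∞ := measure_ball_lt_top.ne
  filter_upwards [ae_coord_zero_eq Metric.isOpen_ball hfin hJ hum hui hωm hωi h hχ hχc hχU,
    ae_coord_one_eq Metric.isOpen_ball hfin hJ hum hui hωm hωi h hχ hχc hχU] with z h0 h1 hz
  have hzU : z ∈ Metric.ball x₀ R ×ˢ J :=
    ⟨Metric.ball_subset_ball (by linarith) hz.1, hz.2⟩
  have hχz : χ z.1 = 1 := hχm _ (Metric.ball_subset_closedBall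
    (Metric.ball_subset_ball (by linarith) hz.1))
  have e0 := h0 hzU
  have e1 := h1 hzU
  rw [hχz, mul_one] at e0 e1
  set d := 2 * transitionBound / (b - m) with hd
  have hd0 : 0 ≤ d := div_nonneg (by positivity) (by linarith)
  have hp : ∀ (i : Fin 2) y, |pderiv i χ y| ≤ d := fun i y => (abs_pderiv_le i χ y).trans (hχd y)
  have hmul : ∀ (i j : Fin 2) y, |u (y, z.2) i * pderiv j χ y| ≤ d * ‖u (y, z.2)‖ := by
    intro i j y
    rw [abs_mul, mul_comm]
    exact mul_le_mul (hp j y) (abs_apply_le_norm _ i) (abs_nonneg _) hd0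
  have hχabs : ∀ y, |ω (y, z.2) * χ y| ≤ |ω (y, z.2)| := fun y => by
    rw [abs_mul, abs_of_nonneg (hχ0 y)]
    exact mul_le_of_le_one_right (abs_nonneg _) (hχ1 y)
  have hcurl_out : ∀ y, y ∉ Metric.closedBall x₀ b → curlSource χ u ω (y, z.2) = 0 := by
    intro y hy
    have : χ y = 0 := image_eq_zero_of_notMem_tsupport fun hh => hy (hχb hh)
    simp [curlSource, this, pderiv_eq_zero_of_notMem hχb _ hy]
  have hdiv_out : ∀ y, y ∉ Metric.closedBall x₀ b → divSource χ u (y, z.2) = 0 := by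
    intro y hy
    simp [divSource, pderiv_eq_zero_of_notMem hχb _ hy]
  have hcurl_in : ∀ y ∈ Metric.ball x₀ m, |curlSource χ u ω (y, z.2)| ≤ |ω (y, z.2)| := by
    intro y hy
    simpa [curlSource, pderiv_eq_zero_of_ball hχm _ hy] using hχabs y
  have hdiv_in : ∀ y ∈ Metric.ball x₀ m, |divSource χ u (y, z.2)| ≤ |(0 : ℝ)| := by
    intro y hy
    simp [divSource, pderiv_eq_zero_of_ball hχm _ hy]
  have hcurl_mid : ∀ y, |curlSource χ u ω (y, z.2)| ≤ |ω (y, z.2)| + 2 * d * ‖u (y, z.2)‖ := by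
    intro y
    have h2 := hmul 1 0 y
    have h3 := hmul 0 1 y
    have h4 := hχabs y
    simp only [curlSource]
    have h5 := abs_add_le (ω (y, z.2) * χ y)
      (u (y, z.2) 1 * pderiv 0 χ y - u (y, z.2) 0 * pderiv 1 χ y)
    have h6 := abs_sub (u (y, z.2) 1 * pderiv 0 χ y) (u (y, z.2) 0 * pderiv 1 χ y)
    linarith
  have hdiv_mid : ∀ y, |divSource χ u (y, z.2)| ≤ |(0 : ℝ)| + 2 * d * ‖u (y, z.2)‖ := by
    intro y
    have h2 := hmul 0 0 y
    have h3 := hmul 1 1 y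
    simp only [divSource, abs_neg, abs_zero]
    have h5 := abs_add_le (u (y, z.2) 0 * pderiv 0 χ y) (u (y, z.2) 1 * pderiv 1 χ y)
    linarith
  have ham : a < m := by rw [hm]; linarith
  have hωz : Measurable fun y => ω (y, z.2) := hωm.comp (by fun_prop)
  set W := ∫⁻ y in Metric.closedBall x₀ b, ‖ω (y, z.2)‖ₑ * ‖z.1 - y‖ₑ⁻¹ with hW
  set E := ∫⁻ y in Metric.closedBall x₀ b, ‖u (y, z.2)‖ₑ with hE
  have bc : ∀ i, ‖potential i (curlSource χ u ω) z‖ₑ ≤ ENNReal.ofReal (2 * Real.pi)⁻¹ *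
      (W + ENNReal.ofReal (2 * d / (m - a)) * E) := by
    intro i
    simpa only [ofReal_norm] using! enorm_integral_kern_mul_le hz.1 ham (L := 2 * d) (by positivity) hωz
      (fun y => norm_nonneg (u (y, z.2))) hcurl_out hcurl_in hcurl_mid i
  have bd : ∀ i, ‖potential i (divSource χ u) z‖ₑ ≤ ENNReal.ofReal (2 * Real.pi)⁻¹ *
      (ENNReal.ofReal (2 * d / (m - a)) * E) := by
    intro i
    simpa only [ofReal_norm, enorm_zero, zero_mul, lintegral_zero, zero_add] using!
      enorm_integral_kern_mul_le hz.1 ham (L := 2 * d) (by positivity)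
      (measurable_const (a := (0 : ℝ)))
      (fun y => norm_nonneg (u (y, z.2))) hdiv_out hdiv_in hdiv_mid i
  have hneg : ‖potential 0 (fun z => -curlSource χ u ω z) z‖ₑ = ‖potential 0 (curlSource χ u ω) z‖ₑ := by
    simp only [potential, mul_neg, integral_neg, enorm_neg]
  have hu : ‖u z‖ₑ ≤ ‖u z 0‖ₑ + ‖u z 1‖ₑ := by
    rw [← ofReal_norm, ← ofReal_norm, ← ofReal_norm, ← ENNReal.ofReal_add (norm_nonneg _) (norm_nonneg _)]
    apply ENNReal.ofReal_le_ofReal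
    rw [EuclideanSpace.norm_eq, Fin.sum_univ_two]
    refine Real.sqrt_le_iff.2 ⟨by positivity, ?_⟩
    nlinarith [mul_nonneg (norm_nonneg (u z 0)) (norm_nonneg (u z 1))]
  -- Both half gaps equal `(b - a)/2`, so `d = 4 transitionBound/(b - a)`. The final factor `2`
  -- counts the curl and the divergence source.
  have hda : 2 * d / (m - a) * 2 = 32 * transitionBound / (b - a) ^ 2 := by
    have e1 : b - m = (b - a) / 2 := by rw [hm]; ring
    have e2 : m - a = (b - a) / 2 := by rw [hm]; ring
    rw [hd, e1, e2]
    field_simp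
    ring
  -- The two velocity components are added, each with the kernel constant `1/(2π)`.
  have hpi : ENNReal.ofReal (2 * Real.pi)⁻¹ * 2 ≤ 1 := by
    rw [← ENNReal.ofReal_ofNat 2, ← ENNReal.ofReal_mul (by positivity), ENNReal.ofReal_le_one]
    have := Real.two_le_pi
    field_simp
    linarith
  set P := ENNReal.ofReal (2 * d / (m - a)) * E with hP
  have hPE : P * 2 = ENNReal.ofReal (32 * transitionBound / (b - a) ^ 2) * E := by
    rw [← hda, ENNReal.ofReal_mul (div_nonneg (by positivity) (by linarith)),
      ENNReal.ofReal_ofNat, hP]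
    ring
  calc ‖u z‖ₑ ≤ ‖u z 0‖ₑ + ‖u z 1‖ₑ := hu
    _ ≤ (ENNReal.ofReal (2 * Real.pi)⁻¹ * (W + P) + ENNReal.ofReal (2 * Real.pi)⁻¹ * P) +
        (ENNReal.ofReal (2 * Real.pi)⁻¹ * (W + P) + ENNReal.ofReal (2 * Real.pi)⁻¹ * P) := by
        rw [e0, e1]
        refine add_le_add ((enorm_add_le _ _).trans (add_le_add (bc 1) (bd 0)))
          ((enorm_add_le _ _).trans (add_le_add ?_ (bd 1)))
        rw [hneg]; exact bc 0
    _ = ENNReal.ofReal (2 * Real.pi)⁻¹ * 2 * (W + P * 2) := by ring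
    _ ≤ 1 * (W + P * 2) := by gcongr
    _ = _ := by rw [one_mul, hPE]

end Bound

/-! ### Young's inequality for the truncated potential. -/

/-- Young's inequality for the kernel `|x - y|⁻¹` on sets of finite measure. -/
theorem lintegral_rieszPotential_rpow_le {A B : Set Plane} {f : Plane → ℝ≥0∞} (hf : Measurable f)
    {p q s : ℝ} (hq : 0 < q) (hqp : q ≤ p) (hs : 0 < s) (hs2 : s < 2) (hsp : s ≤ p)
    (hpqs : 1 / p + 1 = 1 / s + 1 / q) {κ : ℝ≥0∞}
    (hA : ENNReal.ofReal (2 * Real.pi / (2 - s)) + volume A ≤ κ)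
    (hB : ENNReal.ofReal (2 * Real.pi / (2 - s)) + volume B ≤ κ) :
    ∫⁻ x in A, (∫⁻ y in B, f y * ‖x - y‖ₑ⁻¹) ^ p ≤
      (κ ^ (1 / s) * (∫⁻ y in B, f y ^ q) ^ (1 / q)) ^ p := by
  have hp : 0 < p := hq.trans_le hqp
  set N := ∫⁻ y in B, f y ^ q with hN
  have e1 : 0 ≤ 1 / q - 1 / p := sub_nonneg.2 (one_div_le_one_div_of_le hq hqp)
  have e2 : 0 ≤ 1 / s - 1 / p := sub_nonneg.2 (one_div_le_one_div_of_le hs hsp)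
  have e3 : 0 ≤ 1 / p := by positivity
  -- With `k = 1/|x - y|`, write `f k = (f^q k^s)^{1/p} (f^q)^{1/q-1/p} (k^s)^{1/s-1/p}` and apply
  -- three-factor Hölder; the weights sum to `1` exactly by the relation among `p`, `q`, `s`. After
  -- raising to the power `p`, only the first factor depends on `x` beyond the uniform kernel bound.
  have pointwise : ∀ x, (∫⁻ y in B, f y * ‖x - y‖ₑ⁻¹) ^ p ≤
      (∫⁻ y in B, f y ^ q * ‖x - y‖ₑ⁻¹ ^ s) * (N ^ (p / q - 1) * κ ^ (p / s - 1)) := by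
    intro x
    have hk : Measurable fun y : Plane => ‖x - y‖ₑ⁻¹ := by fun_prop
    have holder := ENNReal.lintegral_prod_norm_pow_le (μ := volume.restrict B)
      (Finset.univ : Finset (Fin 3))
      (f := ![fun y => f y ^ q * ‖x - y‖ₑ⁻¹ ^ s, fun y => f y ^ q, fun y => ‖x - y‖ₑ⁻¹ ^ s])
      (p := ![1 / p, 1 / q - 1 / p, 1 / s - 1 / p])
      (by
        intro i _
        fin_cases i
        · exact ((hf.pow_const q).mul (hk.pow_const s)).aemeasurable
        · exact (hf.pow_const q).aemeasurable
        · exact (hk.pow_const s).aemeasurable)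
      (by simp [Fin.sum_univ_three]; simp only [one_div] at hpqs; linarith)
      (by intro i _; fin_cases i; exacts [e3, e1, e2])
    simp only [Fin.prod_univ_three, Matrix.cons_val_zero, Matrix.cons_val_one, Matrix.cons_val] at holder
    have hfun : ∀ y, (f y ^ q * ‖x - y‖ₑ⁻¹ ^ s) ^ (1 / p) * (f y ^ q) ^ (1 / q - 1 / p) *
        (‖x - y‖ₑ⁻¹ ^ s) ^ (1 / s - 1 / p) = f y * ‖x - y‖ₑ⁻¹ := by
      intro y
      have split : ∀ (c : ℝ≥0∞) (r : ℝ), 0 < r → 0 ≤ 1 / r - 1 / p →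
          (c ^ r) ^ (1 / p) * (c ^ r) ^ (1 / r - 1 / p) = c := by
        intro c r hr hrp
        rw [← ENNReal.rpow_add_of_nonneg _ _ e3 hrp, ← ENNReal.rpow_mul,
          (by field_simp; ring : r * (1 / p + (1 / r - 1 / p)) = 1), ENNReal.rpow_one]
      rw [ENNReal.mul_rpow_of_nonneg _ _ e3]
      rw [mul_right_comm ((f y ^ q) ^ (1 / p)), mul_assoc, split _ q hq e1, split _ s hs e2]
    simp only [hfun] at holder
    calc _ ≤ ((∫⁻ y in B, f y ^ q * ‖x - y‖ₑ⁻¹ ^ s) ^ (1 / p) * N ^ (1 / q - 1 / p) *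
          κ ^ (1 / s - 1 / p)) ^ p := by
          refine ENNReal.rpow_le_rpow (holder.trans ?_) hp.le
          refine mul_le_mul_right (ENNReal.rpow_le_rpow ?_ e2) _
          exact (lintegral_norm_sub_rpow_le hs.le hs2 B x).trans hB
      _ = _ := by
          rw [ENNReal.mul_rpow_of_nonneg _ _ hp.le, ENNReal.mul_rpow_of_nonneg _ _ hp.le,
            ← ENNReal.rpow_mul, ← ENNReal.rpow_mul, ← ENNReal.rpow_mul, one_div_mul_cancel hp.ne',
            ENNReal.rpow_one, mul_assoc]
          congr 3 <;> field_simp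
  have hjoint : Measurable fun w : Plane × Plane => f w.2 ^ q * ‖w.1 - w.2‖ₑ⁻¹ ^ s := by fun_prop
  calc _ ≤ ∫⁻ x in A, (∫⁻ y in B, f y ^ q * ‖x - y‖ₑ⁻¹ ^ s) *
        (N ^ (p / q - 1) * κ ^ (p / s - 1)) := lintegral_mono pointwise
    _ = (∫⁻ x in A, ∫⁻ y in B, f y ^ q * ‖x - y‖ₑ⁻¹ ^ s) *
        (N ^ (p / q - 1) * κ ^ (p / s - 1)) :=
        lintegral_mul_const _ hjoint.lintegral_prod_right'
    _ = (∫⁻ y in B, ∫⁻ x in A, f y ^ q * ‖y - x‖ₑ⁻¹ ^ s) *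
        (N ^ (p / q - 1) * κ ^ (p / s - 1)) := by
        rw [lintegral_lintegral_swap hjoint.aemeasurable]
        simp only [fun x y : Plane => (by rw [← neg_sub, enorm_neg] : ‖x - y‖ₑ = ‖y - x‖ₑ)]
    _ ≤ (κ * N) * (N ^ (p / q - 1) * κ ^ (p / s - 1)) := by
        refine mul_le_mul_left ?_ _
        rw [hN, ← lintegral_const_mul _ (hf.pow_const q)]
        refine lintegral_mono fun y => ?_
        rw [lintegral_const_mul _ (by fun_prop), mul_comm]
        exact mul_le_mul_left ((lintegral_norm_sub_rpow_le hs.le hs2 A y).trans hA) _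
    _ = _ := by
        have r1 : 0 ≤ p / q - 1 := by rw [sub_nonneg, one_le_div hq]; exact hqp
        have r2 : 0 ≤ p / s - 1 := by rw [sub_nonneg, one_le_div hs]; exact hsp
        have t1 : N * N ^ (p / q - 1) = N ^ (p / q) := by
          nth_rewrite 1 [← ENNReal.rpow_one N]
          rw [← ENNReal.rpow_add_of_nonneg _ _ zero_le_one r1]; congr 1; ring
        have t2 : κ * κ ^ (p / s - 1) = κ ^ (p / s) := by
          nth_rewrite 1 [← ENNReal.rpow_one κ]
          rw [← ENNReal.rpow_add_of_nonneg _ _ zero_le_one r2]; congr 1; ring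
        rw [ENNReal.mul_rpow_of_nonneg _ _ hp.le, ← ENNReal.rpow_mul, ← ENNReal.rpow_mul,
          one_div_mul_eq_div, one_div_mul_eq_div, ← t1, ← t2]
        ring

/-! ### Exponential weights dominated by a series of powers. -/

/-- `exp (s ^ (1/γ))` is dominated by a series of powers of `1 + s` with geometric exponents. -/
theorem exists_exp_rpow_le_tsum {p₀ l D G γ : ℝ} (hp₀ : 0 < p₀) (hl : 1 < l) (hD : 1 < D)
    (hG : 1 ≤ G) (hγ : 0 < γ) (hDγ : D ^ (1 / γ) ≤ l) :
    ∃ A : ℝ, 0 ≤ A ∧ ∀ s : ℝ, 0 ≤ s → ENNReal.ofReal (Real.exp (s ^ (1 / γ))) ≤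
      ENNReal.ofReal A * (1 + ∑' n : ℕ, 2⁻¹ ^ (n + 1) *
        (ENNReal.ofReal ((1 + s) / (G * D ^ (n + 1)))) ^ (p₀ * (l ^ 2) ^ (n + 1))) := by
  have hE : 0 < Real.exp 1 := Real.exp_pos 1
  have hG0 : 0 < G := by linarith
  have hD0 : 0 < D := by linarith
  have hγ' : 0 ≤ 1 / γ := by positivity
  set K := (Real.exp 1 * G * D) ^ (1 / γ) with hK
  have hK0 : 0 ≤ K := by positivity
  -- `K` governs `s^{1/γ}`; the extra `1/(l - 1)` pays for the summand `m` that turns into the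
  -- geometric weight.
  set k := K + 1 / (l - 1) with hk
  refine ⟨max (Real.exp K) (Real.exp (k ^ 2 / (4 * p₀))), by positivity, fun s hs => ?_⟩
  by_cases hσ : 1 + s ≤ Real.exp 1 * G * D
  · calc _ ≤ ENNReal.ofReal (max (Real.exp K) (Real.exp (k ^ 2 / (4 * p₀)))) * 1 := by
          rw [mul_one]
          refine ENNReal.ofReal_le_ofReal (le_max_of_le_left (Real.exp_le_exp.2 ?_))
          exact Real.rpow_le_rpow hs (by linarith) hγ'
      _ ≤ _ := by gcongr; exact le_self_add
  · rw [not_le] at hσ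
    have hx : 1 ≤ (1 + s) / (Real.exp 1 * G * D) := by
      rw [one_le_div (by positivity)]; exact hσ.le
    -- A single term of the series suffices. The choice makes `(1 + s)/(G D^m) ≥ e` for `m = n + 1`,
    -- so that the term dominates `exp(p₀ l^{2m})`, while the upper bound keeps `s^{1/γ}` below `K
    -- l^m`.
    obtain ⟨n, hn1, hn2⟩ := exists_nat_pow_near hx hD
    rw [le_div_iff₀ (by positivity)] at hn1
    rw [div_lt_iff₀ (by positivity)] at hn2
    set m := n + 1 with hm
    have hlm : 0 < l ^ m := by positivity
    have h1 : s ^ (1 / γ) ≤ K * l ^ m := by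
      calc s ^ (1 / γ) ≤ (D ^ m * (Real.exp 1 * G * D)) ^ (1 / γ) :=
            Real.rpow_le_rpow hs (by linarith) hγ'
        _ = (D ^ (1 / γ)) ^ m * K := by
            rw [Real.mul_rpow (by positivity) (by positivity), ← Real.rpow_natCast, ← Real.rpow_mul hD0.le,
              mul_comm (m : ℝ), Real.rpow_mul hD0.le, Real.rpow_natCast]
        _ ≤ l ^ m * K := by gcongr
        _ = _ := mul_comm _ _
    -- Bernoulli's inequality.
    have h2 : (m : ℝ) ≤ 1 / (l - 1) * l ^ m := by
      have hb := one_add_mul_le_pow (a := l - 1) (by linarith) m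
      have hl1 : 0 < l - 1 := by linarith
      rw [one_div, inv_mul_eq_div, le_div_iff₀ hl1]
      rw [add_sub_cancel] at hb
      linarith
    have h3 : s ^ (1 / γ) ≤ k ^ 2 / (4 * p₀) + (p₀ * (l ^ 2) ^ m - m) := by
      -- Completing the square: the quadratic term in `l^m` absorbs the linear one at the price of a
      -- constant. This is where `G`, hidden in `K`, ceases to matter.
      have h4 : k * l ^ m ≤ k ^ 2 / (4 * p₀) + p₀ * (l ^ m) ^ 2 := by
        have : k ^ 2 / (4 * p₀) + p₀ * (l ^ m) ^ 2 - k * l ^ m =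
            (2 * p₀ * l ^ m - k) ^ 2 / (4 * p₀) := by field_simp; ring
        have h5 : 0 ≤ (2 * p₀ * l ^ m - k) ^ 2 / (4 * p₀) := by positivity
        linarith
      rw [← pow_mul, mul_comm 2 m, pow_mul]
      rw [hk, add_mul] at h4
      linarith
    have h6 : Real.exp (p₀ * (l ^ 2) ^ m) ≤ ((1 + s) / (G * D ^ m)) ^ (p₀ * (l ^ 2) ^ m) := by
      rw [← Real.exp_one_rpow]
      refine Real.rpow_le_rpow hE.le ?_ (by positivity)
      rw [le_div_iff₀ (by positivity)]
      calc _ = D ^ n * (Real.exp 1 * G * D) := by rw [hm, pow_succ]; ring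
        _ ≤ _ := hn1
    have h7 : Real.exp (s ^ (1 / γ)) ≤ max (Real.exp K) (Real.exp (k ^ 2 / (4 * p₀))) *
        ((2⁻¹) ^ m * ((1 + s) / (G * D ^ m)) ^ (p₀ * (l ^ 2) ^ m)) := by
      calc _ ≤ Real.exp (k ^ 2 / (4 * p₀) + (p₀ * (l ^ 2) ^ m - m)) := Real.exp_le_exp.2 h3
        _ = Real.exp (k ^ 2 / (4 * p₀)) * (Real.exp (-m) * Real.exp (p₀ * (l ^ 2) ^ m)) := by
            rw [← Real.exp_add, ← Real.exp_add]; congr 1; ring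
        _ ≤ _ := by
            gcongr
            · exact le_max_right _ _
            · rw [Real.exp_neg, inv_pow]
              gcongr
              rw [← Real.exp_one_pow]
              gcongr
              have := Real.add_one_le_exp 1
              linarith
    calc _ ≤ ENNReal.ofReal (max (Real.exp K) (Real.exp (k ^ 2 / (4 * p₀))) *
        ((2⁻¹) ^ m * ((1 + s) / (G * D ^ m)) ^ (p₀ * (l ^ 2) ^ m))) := ENNReal.ofReal_le_ofReal h7
      _ = ENNReal.ofReal (max (Real.exp K) (Real.exp (k ^ 2 / (4 * p₀)))) *
        (2⁻¹ ^ (n + 1) * (ENNReal.ofReal ((1 + s) / (G * D ^ (n + 1)))) ^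
          (p₀ * (l ^ 2) ^ (n + 1))) := by
          rw [ENNReal.ofReal_mul (by positivity), ENNReal.ofReal_mul (by positivity),
            ENNReal.ofReal_rpow_of_nonneg (by positivity) (by positivity),
            ENNReal.ofReal_pow (by positivity), ENNReal.ofReal_inv_of_pos two_pos,
            ENNReal.ofReal_ofNat]
      _ ≤ _ := by
          gcongr
          refine le_add_left ?_
          exact ENNReal.le_tsum (f := fun n : ℕ => (2 : ℝ≥0∞)⁻¹ ^ (n + 1) *
            (ENNReal.ofReal ((1 + s) / (G * D ^ (n + 1)))) ^ (p₀ * (l ^ 2) ^ (n + 1))) n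

/-! ### Exponents and the iteration of `L^p` bounds. -/

/-- The exponents of one iteration step: `L^p` integrability of the velocity gives `L^q`
integrability of the vorticity with `q = 2 - 2/p`, hence `L^{λp}` integrability of the velocity by
Young's inequality with kernel exponent `s`. -/
theorem exists_young_exponent {p₀ p q₀ q l : ℝ} (hp₀ : 2 < p₀) (hp : p₀ ≤ p)
    (hq₀ : q₀ = 2 - 2 / p₀) (hq : q = 2 - 2 / p) (hl : l = (1 + q₀) / 2) :
    1 < q₀ ∧ q₀ ≤ q ∧ q < 2 ∧ 1 < l ∧ l < 2 ∧ 0 < 1 / l - 1 / q₀ ∧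
    ∃ s : ℝ, 1 ≤ s ∧ s < 2 ∧ s ≤ l * p ∧ 1 / (l * p) + 1 = 1 / s + 1 / q ∧
      2 * Real.pi / (2 - s) ≤ Real.pi * p / (1 / l - 1 / q₀) := by
  have hp0 : 0 < p := by linarith
  have h1 : 1 < q₀ := by
    have : 2 / p₀ < 1 := by rw [div_lt_one (by linarith)]; exact hp₀
    linarith
  have h2 : q₀ ≤ q := by
    have : 2 / p ≤ 2 / p₀ := by gcongr
    linarith
  have h3 : q < 2 := by
    have : 0 < 2 / p := by positivity
    linarith
  have h4 : 1 < l := by linarith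
  have h5 : l < q₀ := by linarith
  have hc : 0 < 1 / l - 1 / q₀ := sub_pos.2 (one_div_lt_one_div_of_lt (by linarith) h5)
  refine ⟨h1, h2, h3, h4, by linarith, hc, ?_⟩
  have hl0 : 0 < l := by linarith
  have hq0 : 0 < q := by linarith
  have hpq : p * q = 2 * p - 2 := by rw [hq]; field_simp
  -- `v` is `1/s`, solved from Young's relation. Subcriticality `s < 2` means `v > 1/2`.
  set v := 1 / (l * p) + 1 - 1 / q with hv
  have hlp : q ≤ l * p := by nlinarith
  have e1 : 1 / (l * p) ≤ 1 / q := one_div_le_one_div_of_le hq0 hlp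
  have e2 : 1 / q ≤ 1 := by rw [div_le_one hq0]; linarith
  have hv1 : v ≤ 1 := by linarith
  -- The critical exponent is `pq`, because `1/q - 1/2 = 1/(pq)`; the distance to it is of order
  -- `1/p` since `l < q₀ ≤ q`. Hence `1/(2 - s)` grows only linearly in `p`.
  have hvh : v - 1 / 2 = 1 / p * (1 / l - 1 / q) := by
    have : 1 / q = 1 / 2 + 1 / p * (1 / q) := by
      field_simp
      linarith
    have e3 : 1 / (l * p) = 1 / p * (1 / l) := by field_simp
    rw [hv, e3, mul_sub]; linarith
  have hvc : 1 / p * (1 / l - 1 / q₀) ≤ v - 1 / 2 := by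
    rw [hvh]
    have : 1 / q ≤ 1 / q₀ := one_div_le_one_div_of_le (by linarith) h2
    gcongr
  have hvpos : 0 < 1 / p * (1 / l - 1 / q₀) := by positivity
  have hv0 : 1 / 2 < v := by linarith
  have hv00 : 0 < v := by linarith
  refine ⟨1 / v, ?_, ?_, ?_, ?_, ?_⟩
  · rw [one_le_div hv00]; exact hv1
  · rw [div_lt_iff₀ hv00]; linarith
  · rw [div_le_iff₀ hv00]
    have h6 : 1 / (l * p) ≤ v := by linarith
    have h7 : 0 < l * p := by positivity
    rw [div_le_iff₀ h7] at h6
    linarith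
  · rw [one_div_one_div]; linarith
  · have h8 : 2 - 1 / v = 2 * (v - 1 / 2) / v := by field_simp
    have h9 : 2 * (1 / p * (1 / l - 1 / q₀)) ≤ 2 - 1 / v := by
      rw [h8, le_div_iff₀ hv00]
      nlinarith
    calc 2 * Real.pi / (2 - 1 / v) ≤ 2 * Real.pi / (2 * (1 / p * (1 / l - 1 / q₀))) := by
          have := Real.pi_pos
          gcongr
      _ = _ := by field_simp

/-- Hölder with exponents `p/(p - 1)` and `p`; the value of `q` is the one for which `q p/(p - 1) =
2`. Since `W ≥ 1`, its power `1 - 1/p` is rounded up to `1`. -/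
theorem lintegral_rpow_mul_le {α : Type*} [MeasurableSpace α] {μ : Measure α} {f g : α → ℝ≥0∞}
    (hf : AEMeasurable f μ) (hg : AEMeasurable g μ) {p q : ℝ} (hp : 2 < p) (hq : q = 2 - 2 / p)
    {W Y : ℝ} (hW : 1 ≤ W) (hfW : ∫⁻ x, f x ^ (2 : ℝ) ∂μ ≤ ENNReal.ofReal W)
    (hgY : ∫⁻ x, g x ^ p ∂μ ≤ ENNReal.ofReal Y ^ p) :
    ∫⁻ x, f x ^ q * g x ∂μ ≤ ENNReal.ofReal (W * Y) := by
  have hp0 : 0 < p := by linarith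
  have hp1 : 0 < p - 1 := by linarith
  have hconj : (p / (p - 1)).HolderConjugate p := by
    rw [Real.holderConjugate_iff]
    constructor
    · rw [one_lt_div hp1]; linarith
    · field_simp; ring
  have h := ENNReal.lintegral_mul_le_Lp_mul_Lq μ hconj (hf.pow_const q) hg
  have hq2 : q * (p / (p - 1)) = 2 := by rw [hq]; field_simp
  simp only [Pi.mul_apply, ← ENNReal.rpow_mul, hq2] at h
  refine h.trans ?_
  rw [ENNReal.ofReal_mul (by linarith)]
  refine mul_le_mul' ?_ ?_
  · calc _ ≤ ENNReal.ofReal W ^ (1 / (p / (p - 1))) := by gcongr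
      _ ≤ ENNReal.ofReal W ^ (1 : ℝ) := by
          refine ENNReal.rpow_le_rpow_of_exponent_le (by simpa using hW) ?_
          rw [one_div_div, div_le_one hp0]; linarith
      _ = _ := ENNReal.rpow_one _
  · calc _ ≤ (ENNReal.ofReal Y ^ p) ^ (1 / p) := by gcongr
      _ = _ := by rw [← ENNReal.rpow_mul, mul_one_div_cancel hp0.ne', ENNReal.rpow_one]

/-- From an `L^q` bound on the vorticity to an `L^p` bound on the velocity, at a fixed time. -/
theorem lintegral_one_add_rpow_le {A B : Set Plane} {w v : Plane → ℝ≥0∞} (hw : Measurable w)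
    {p q s κ M c b : ℝ} (hq : 1 ≤ q) (hqp : q ≤ p) (hs : 1 ≤ s) (hs2 : s < 2) (hsp : s ≤ p)
    (hpqs : 1 / p + 1 = 1 / s + 1 / q) (hb : 1 ≤ b) (hA : volume A ≤ ENNReal.ofReal b)
    (hB : volume B ≤ ENNReal.ofReal b) (hκ : 2 * Real.pi / (2 - s) + b ≤ κ) (hM : 0 ≤ M) (hc : 0 ≤ c)
    (hwM : ∫⁻ y in B, w y ^ q ≤ ENNReal.ofReal M)
    (hv : ∀ᵐ x ∂volume.restrict A, v x ≤ (∫⁻ y in B, w y * ‖x - y‖ₑ⁻¹) + ENNReal.ofReal c) :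
    ∫⁻ x in A, (1 + v x) ^ p ≤ ENNReal.ofReal (κ * M ^ (1 / q) + (1 + c) * b) ^ p := by
  have hp1 : 1 ≤ p := hq.trans hqp
  have hp0 : 0 < p := by linarith
  have hkpos : 0 ≤ 2 * Real.pi / (2 - s) := div_nonneg (by positivity) (by linarith)
  have hκ1 : 1 ≤ κ := by linarith
  have hjoint : Measurable fun z : Plane × Plane => w z.2 * ‖z.1 - z.2‖ₑ⁻¹ := by fun_prop
  have hPm : Measurable fun x => ∫⁻ y in B, w y * ‖x - y‖ₑ⁻¹ := hjoint.lintegral_prod_right'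
  have hsum : ∀ S : Set Plane, volume S ≤ ENNReal.ofReal b →
      ENNReal.ofReal (2 * Real.pi / (2 - s)) + volume S ≤ ENNReal.ofReal κ := fun S hS => by
    refine (add_le_add le_rfl hS).trans ?_
    rw [← ENNReal.ofReal_add hkpos (by linarith)]
    exact ENNReal.ofReal_le_ofReal hκ
  have young := lintegral_rieszPotential_rpow_le (A := A) (B := B) hw (by linarith) hqp
    (by linarith) hs2 hsp hpqs (hsum A hA) (hsum B hB)
  have mink := ENNReal.lintegral_Lp_add_le (μ := volume.restrict A)
    (f := fun x => ∫⁻ y in B, w y * ‖x - y‖ₑ⁻¹) (g := fun _ => ENNReal.ofReal (1 + c))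
    hPm.aemeasurable aemeasurable_const hp1
  simp only [Pi.add_apply] at mink
  have h1 : (∫⁻ x in A, (∫⁻ y in B, w y * ‖x - y‖ₑ⁻¹) ^ p) ^ (1 / p) ≤
      ENNReal.ofReal (κ * M ^ (1 / q)) := by
    calc _ ≤ ((ENNReal.ofReal κ ^ (1 / s) * (∫⁻ y in B, w y ^ q) ^ (1 / q)) ^ p) ^ (1 / p) := by
          gcongr
      _ = ENNReal.ofReal κ ^ (1 / s) * (∫⁻ y in B, w y ^ q) ^ (1 / q) := by
          rw [← ENNReal.rpow_mul, mul_one_div_cancel hp0.ne', ENNReal.rpow_one]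
      _ ≤ ENNReal.ofReal κ ^ (1 : ℝ) * ENNReal.ofReal M ^ (1 / q) := by
          refine mul_le_mul' (ENNReal.rpow_le_rpow_of_exponent_le (by simpa using hκ1) ?_) ?_
          · rw [div_le_one (by linarith)]; exact hs
          · gcongr
      _ = _ := by
          rw [ENNReal.rpow_one, ENNReal.ofReal_mul (by linarith),
            ENNReal.ofReal_rpow_of_nonneg hM (by positivity)]
  have h2 : (∫⁻ _ in A, ENNReal.ofReal (1 + c) ^ p) ^ (1 / p) ≤ ENNReal.ofReal ((1 + c) * b) := by
    rw [setLIntegral_const, ENNReal.mul_rpow_of_nonneg _ _ (by positivity), ← ENNReal.rpow_mul,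
      mul_one_div_cancel hp0.ne', ENNReal.rpow_one, ENNReal.ofReal_mul (by linarith)]
    refine mul_le_mul_right ?_ _
    calc _ ≤ ENNReal.ofReal b ^ (1 / p) := by gcongr
      _ ≤ ENNReal.ofReal b ^ (1 : ℝ) := by
          refine ENNReal.rpow_le_rpow_of_exponent_le (by simpa using hb) ?_
          rw [div_le_one hp0]; exact hp1
      _ = _ := ENNReal.rpow_one _
  calc _ ≤ ∫⁻ x in A, ((∫⁻ y in B, w y * ‖x - y‖ₑ⁻¹) + ENNReal.ofReal (1 + c)) ^ p := by
        refine lintegral_mono_ae ?_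
        filter_upwards [hv] with x hx
        refine ENNReal.rpow_le_rpow ?_ hp0.le
        rw [ENNReal.ofReal_add zero_le_one hc, ENNReal.ofReal_one]
        calc 1 + v x ≤ 1 + ((∫⁻ y in B, w y * ‖x - y‖ₑ⁻¹) + ENNReal.ofReal c) := by gcongr
          _ = _ := by ring
    _ = ((∫⁻ x in A, ((∫⁻ y in B, w y * ‖x - y‖ₑ⁻¹) + ENNReal.ofReal (1 + c)) ^ p) ^ (1 / p)) ^ p := by
        rw [← ENNReal.rpow_mul, one_div_mul_cancel hp0.ne', ENNReal.rpow_one]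
    _ ≤ _ := by
        refine ENNReal.rpow_le_rpow (mink.trans ?_) hp0.le
        rw [ENNReal.ofReal_add (mul_nonneg (by linarith) (by positivity)) (by positivity : 0 ≤ (1 + c) * b)]
        exact add_le_add h1 h2

/-- One iteration step: an `L^p` bound for the velocity on `B₀ × J₀` gives `L^{lp}` bounds on `B₂`
at almost every time in `J₁`. -/
theorem ae_lintegral_one_add_rpow_le {u : SpaceTime → Plane} {ω : SpaceTime → ℝ}
    (hum : Measurable u) (hωm : Measurable ω) {B₀ B₁ B₂ : Set Plane} {J₀ J₁ : Set ℝ}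
    {p₀ p q₀ q l a b c W Y : ℝ} {n : ℕ} (hp₀ : 2 < p₀) (hp : p = p₀ * l ^ n)
    (hq₀ : q₀ = 2 - 2 / p₀) (hq : q = 2 - 2 / p) (hl : l = (1 + q₀) / 2)
    (ha : 1 ≤ a) (hb : 1 ≤ b) (hc : 0 ≤ c) (hW : 1 ≤ W) (hY : 1 ≤ Y)
    (hB₁ : volume B₁ ≤ ENNReal.ofReal b) (hB₂ : volume B₂ ≤ ENNReal.ofReal b)
    (hωW : ∫⁻ z in B₀ ×ˢ J₀, ‖ω z‖ₑ ^ (2 : ℝ) ≤ ENNReal.ofReal W)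
    (hvort : ∀ᵐ t ∂volume.restrict J₁, ∫⁻ x in B₁, ‖ω (x, t)‖ₑ ^ q ≤
      ENNReal.ofReal (a * 2 ^ n) * ∫⁻ z in B₀ ×ˢ J₀, ‖ω z‖ₑ ^ q * (1 + ‖u z‖ₑ))
    (hell : ∀ᵐ t ∂volume.restrict J₁, ∀ᵐ x ∂volume.restrict B₂, ‖u (x, t)‖ₑ ≤
      (∫⁻ y in B₁, ‖ω (y, t)‖ₑ * ‖x - y‖ₑ⁻¹) + ENNReal.ofReal (c * 4 ^ n))
    (huY : ∫⁻ z in B₀ ×ˢ J₀, (1 + ‖u z‖ₑ) ^ p ≤ ENNReal.ofReal Y ^ p) :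
    ∀ᵐ t ∂volume.restrict J₁, ∫⁻ x in B₂, (1 + ‖u (x, t)‖ₑ) ^ (l * p) ≤
      ENNReal.ofReal (((Real.pi * p₀ / (1 / l - 1 / q₀) + b) * (a * W) + (1 + c) * b) * 4 ^ n *
        Y ^ (1 / q₀)) ^ (l * p) := by
  have hl1 : 1 < l := by
    have : 2 / p₀ < 1 := by rw [div_lt_one (by linarith)]; exact hp₀
    linarith
  have hln : 1 ≤ l ^ n := one_le_pow₀ hl1.le
  have hpp : p₀ ≤ p := by rw [hp]; nlinarith
  obtain ⟨hq1, hqq, hq2, -, hl2, hc0, s, hs1, hs2, hsp, hpqs, hκ⟩ :=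
    exists_young_exponent hp₀ hpp hq₀ hq hl
  have hp2 : 2 < p := by linarith
  have hol := lintegral_rpow_mul_le (μ := volume.restrict (B₀ ×ˢ J₀)) (f := fun z => ‖ω z‖ₑ)
    (g := fun z => 1 + ‖u z‖ₑ) (by fun_prop) (by fun_prop) hp2 hq hW hωW huY
  filter_upwards [hvort, hell] with t ht1 ht2
  have hWY : 1 ≤ W * Y := one_le_mul_of_one_le_of_one_le hW hY
  have h2n : (1 : ℝ) ≤ 2 ^ n := one_le_pow₀ one_le_two
  have hwM : ∫⁻ x in B₁, ‖ω (x, t)‖ₑ ^ q ≤ ENNReal.ofReal (a * 2 ^ n * (W * Y)) := by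
    refine ht1.trans ?_
    rw [ENNReal.ofReal_mul (p := a * 2 ^ n) (by positivity)]
    exact mul_le_mul_right hol _
  have hlp : q ≤ l * p := by nlinarith
  refine (lintegral_one_add_rpow_le (A := B₂) (B := B₁) (w := fun y => ‖ω (y, t)‖ₑ)
    (v := fun x => ‖u (x, t)‖ₑ) (by fun_prop) (by linarith) hlp hs1 hs2 hsp hpqs hb hB₂ hB₁
    (κ := Real.pi * p / (1 / l - 1 / q₀) + b) (by linarith) (by positivity) (by positivity)
    hwM ht2).trans ?_
  refine ENNReal.rpow_le_rpow (ENNReal.ofReal_le_ofReal ?_) (by positivity)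
  have hpi := Real.pi_pos
  have hYβ : 1 ≤ Y ^ (1 / q₀) := Real.one_le_rpow hY (by positivity)
  have e4 : (4 : ℝ) ^ n = 2 ^ n * 2 ^ n := by rw [← mul_pow]; norm_num
  -- The exponent on `Y` must stay below `1`, uniformly in `n`; it is enlarged only to `1/q₀`. The
  -- other factors are at least `1` and may lose the root.
  have hM : (a * 2 ^ n * (W * Y)) ^ (1 / q) ≤ a * W * 2 ^ n * Y ^ (1 / q₀) := by
    have h1 : a * 2 ^ n * (W * Y) = (a * W * 2 ^ n) * Y := by ring
    have h2 : 1 ≤ a * W * 2 ^ n :=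
      one_le_mul_of_one_le_of_one_le (one_le_mul_of_one_le_of_one_le ha hW) h2n
    rw [h1, Real.mul_rpow (by positivity) (by positivity)]
    gcongr
    calc (a * W * 2 ^ n) ^ (1 / q) ≤ (a * W * 2 ^ n) ^ (1 : ℝ) :=
          Real.rpow_le_rpow_of_exponent_le h2 (by rw [div_le_one (by linarith)]; linarith)
      _ = _ := Real.rpow_one _
  -- The linear growth in `p = p₀ lⁿ` costs `2ⁿ` because `l < 2`. Together with the `2ⁿ` of the
  -- vorticity estimate this yields the `4ⁿ`, which also covers the elliptic term.
  have hK : Real.pi * p / (1 / l - 1 / q₀) + b ≤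
      (Real.pi * p₀ / (1 / l - 1 / q₀) + b) * 2 ^ n := by
    have h1 : l ^ n ≤ 2 ^ n := by gcongr
    have h2 : Real.pi * p / (1 / l - 1 / q₀) = Real.pi * p₀ / (1 / l - 1 / q₀) * l ^ n := by
      rw [hp]; ring
    have h3 : 0 ≤ Real.pi * p₀ / (1 / l - 1 / q₀) := by positivity
    rw [h2, add_mul]
    gcongr
    nlinarith
  have h4n : (1 : ℝ) ≤ 4 ^ n := one_le_pow₀ (by norm_num)
  calc _ ≤ (Real.pi * p₀ / (1 / l - 1 / q₀) + b) * 2 ^ n * (a * W * 2 ^ n * Y ^ (1 / q₀)) +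
        ((1 + c) * 4 ^ n) * b * Y ^ (1 / q₀) := by
        refine add_le_add (mul_le_mul hK hM (by positivity) (by positivity)) ?_
        calc (1 + c * 4 ^ n) * b ≤ ((1 + c) * 4 ^ n) * b := by gcongr; nlinarith
          _ ≤ _ := le_mul_of_one_le_right (by positivity) hYβ
    _ = _ := by rw [e4]; ring

/-- The iteration: polynomial growth of the `L^p` norms of the velocity along `p = p₀ lⁿ`. -/
theorem exists_ae_lintegral_le_geometric {u : SpaceTime → Plane} {ω : SpaceTime → ℝ}
    (hum : Measurable u) (hωm : Measurable ω) {B B' : ℕ → Set Plane} {J : ℕ → Set ℝ}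
    {p₀ q₀ l a b c W Y D : ℝ} (hp₀ : 2 < p₀)
    (hq₀ : q₀ = 2 - 2 / p₀) (hl : l = (1 + q₀) / 2) (hD : D = 4 ^ (1 / (1 - 1 / q₀)))
    (ha : 1 ≤ a) (hb : 1 ≤ b) (hc : 0 ≤ c) (hW : 1 ≤ W)
    (hB : ∀ n, volume (B n) ≤ ENNReal.ofReal b) (hB' : ∀ n, volume (B' n) ≤ ENNReal.ofReal b)
    (hJ : ∀ n, volume (J n) ≤ ENNReal.ofReal b)
    (hωW : ∀ n, ∫⁻ z in B n ×ˢ J n, ‖ω z‖ₑ ^ (2 : ℝ) ≤ ENNReal.ofReal W)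
    (hvort : ∀ q : ℝ, 1 ≤ q → q < 2 → ∀ n, ∀ᵐ t ∂volume.restrict (J (n + 1)),
      ∫⁻ x in B' n, ‖ω (x, t)‖ₑ ^ q ≤
      ENNReal.ofReal (a * 2 ^ n) * ∫⁻ z in B n ×ˢ J n, ‖ω z‖ₑ ^ q * (1 + ‖u z‖ₑ))
    (hell : ∀ n, ∀ᵐ t ∂volume.restrict (J (n + 1)), ∀ᵐ x ∂volume.restrict (B (n + 1)),
      ‖u (x, t)‖ₑ ≤
      (∫⁻ y in B' n, ‖ω (y, t)‖ₑ * ‖x - y‖ₑ⁻¹) + ENNReal.ofReal (c * 4 ^ n))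
    (hu0 : ∫⁻ z in B 0 ×ˢ J 0, (1 + ‖u z‖ₑ) ^ p₀ ≤ ENNReal.ofReal Y ^ p₀) :
    ∃ G : ℝ, 1 ≤ G ∧ ∀ n : ℕ, ∀ᵐ t ∂volume.restrict (J (n + 1)),
      ∫⁻ x in B (n + 1), (1 + ‖u (x, t)‖ₑ) ^ (p₀ * l ^ (n + 1)) ≤
        ENNReal.ofReal (G * D ^ (n + 1)) ^ (p₀ * l ^ (n + 1)) := by
  obtain ⟨hq1, -, -, hl1, -, hc0, -⟩ := exists_young_exponent hp₀ le_rfl hq₀ hq₀ hl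
  set β := 1 / q₀ with hβ
  have hβ1 : β < 1 := by rw [hβ, div_lt_one (by linarith)]; exact hq1
  have hβ0 : 0 < β := by positivity
  have h1β : 0 < 1 - β := by linarith
  have hD1 : 1 ≤ D := by rw [hD]; exact Real.one_le_rpow (by norm_num) (by positivity)
  have hD0 : 0 < D := by linarith
  -- `D` is the fixed point of `x ↦ 4 x^β`, so the factors `4ⁿ` reproduce the geometric rate.
  have hDβ : 4 * D ^ β = D := by
    have h4 : D ^ (1 - β) = 4 := by
      rw [hD, ← Real.rpow_mul (by norm_num), one_div_mul_cancel h1β.ne', Real.rpow_one]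
    nth_rewrite 1 [← h4]
    rw [← Real.rpow_add hD0, sub_add_cancel, Real.rpow_one]
  set K := (Real.pi * p₀ / (1 / l - β) + b) * (a * W) + (1 + c) * b with hK
  have hpi := Real.pi_pos
  have hK1 : 1 ≤ K := by
    have h1 : 0 ≤ (Real.pi * p₀ / (1 / l - β) + b) * (a * W) := by positivity
    have h2 : 1 ≤ (1 + c) * b := one_le_mul_of_one_le_of_one_le (by linarith) hb
    linarith
  -- The second entry is the fixed point of `x ↦ b K x^β`; the first covers the initial norm. The
  -- extra factor `b` bounds the length of the time window when slice bounds are integrated in time.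
  set G := max Y ((b * K) ^ (1 / (1 - β))) with hG
  have hbK : 1 ≤ b * K := one_le_mul_of_one_le_of_one_le hb hK1
  have hG1 : 1 ≤ G := le_max_of_le_right (Real.one_le_rpow hbK (by positivity))
  have hG0 : 0 < G := by linarith
  have hGK : b * K * G ^ β ≤ G := by
    have h1 : b * K ≤ G ^ (1 - β) := by
      calc b * K = ((b * K) ^ (1 / (1 - β))) ^ (1 - β) := by
            rw [← Real.rpow_mul (by positivity), one_div_mul_cancel h1β.ne', Real.rpow_one]
        _ ≤ _ := Real.rpow_le_rpow (by positivity) (le_max_right _ _) h1β.le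
    calc b * K * G ^ β ≤ G ^ (1 - β) * G ^ β := by gcongr
      _ = G := by rw [← Real.rpow_add hG0, sub_add_cancel, Real.rpow_one]
  have hYn : ∀ n : ℕ, b * (K * 4 ^ n * (G * D ^ n) ^ β) ≤ G * D ^ (n + 1) := by
    intro n
    calc b * (K * 4 ^ n * (G * D ^ n) ^ β) = (b * K * G ^ β) * (4 * D ^ β) ^ n := by
          rw [Real.mul_rpow (by positivity) (by positivity), mul_pow, ← Real.rpow_natCast D n,
            ← Real.rpow_mul hD0.le, mul_comm (n : ℝ) β, Real.rpow_mul hD0.le, Real.rpow_natCast]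
          ring
      _ ≤ G * D ^ n := by rw [hDβ]; gcongr
      _ ≤ G * D ^ (n + 1) := by
          gcongr
          omega
  have hGD : ∀ n : ℕ, 1 ≤ G * D ^ n := fun n =>
    one_le_mul_of_one_le_of_one_le hG1 (one_le_pow₀ hD1)
  have step : ∀ n : ℕ,
      ∫⁻ z in B n ×ˢ J n, (1 + ‖u z‖ₑ) ^ (p₀ * l ^ n) ≤
        ENNReal.ofReal (G * D ^ n) ^ (p₀ * l ^ n) →
      ∀ᵐ t ∂volume.restrict (J (n + 1)), ∫⁻ x in B (n + 1),
        (1 + ‖u (x, t)‖ₑ) ^ (p₀ * l ^ (n + 1)) ≤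
        ENNReal.ofReal (K * 4 ^ n * (G * D ^ n) ^ β) ^ (p₀ * l ^ (n + 1)) := by
    intro n hn
    have hpn : p₀ ≤ p₀ * l ^ n := le_mul_of_one_le_right (by linarith) (one_le_pow₀ hl1.le)
    obtain ⟨-, hqq, hq2, -⟩ := exists_young_exponent hp₀ hpn hq₀ rfl hl
    have := ae_lintegral_one_add_rpow_le hum hωm hp₀ rfl hq₀ rfl hl ha hb hc hW (hGD n) (hB' n)
      (hB (n + 1)) (hωW n) (hvort _ (by linarith) hq2 n) (hell n) hn
    have hexp : l * (p₀ * l ^ n) = p₀ * l ^ (n + 1) := by ring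
    rw [hexp] at this
    exact this
  have main : ∀ n : ℕ, ∫⁻ z in B n ×ˢ J n, (1 + ‖u z‖ₑ) ^ (p₀ * l ^ n) ≤
        ENNReal.ofReal (G * D ^ n) ^ (p₀ * l ^ n) := by
    intro n
    induction n with
    | zero =>
      simp only [pow_zero, mul_one]
      exact hu0.trans (ENNReal.rpow_le_rpow (ENNReal.ofReal_le_ofReal (le_max_left _ _))
        (by linarith))
    | succ n ih =>
      have hp1 : 1 ≤ p₀ * l ^ (n + 1) :=
        one_le_mul_of_one_le_of_one_le (by linarith) (one_le_pow₀ hl1.le)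
      have hs := step n ih
      rw [Measure.volume_eq_prod, setLIntegral_prod_symm _ (by fun_prop)]
      calc _ ≤ ∫⁻ t in J (n + 1),
            ENNReal.ofReal (K * 4 ^ n * (G * D ^ n) ^ β) ^ (p₀ * l ^ (n + 1)) :=
            lintegral_mono_ae hs
        _ ≤ ENNReal.ofReal b ^ (p₀ * l ^ (n + 1)) *
            ENNReal.ofReal (K * 4 ^ n * (G * D ^ n) ^ β) ^ (p₀ * l ^ (n + 1)) := by
            rw [setLIntegral_const, mul_comm]
            refine mul_le_mul_left ((hJ _).trans ?_) _
            -- Since `b ≥ 1`, the window length can be placed under the large power, so its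
            -- contribution to the norm is a factor at most `b`.
            nth_rewrite 1 [← ENNReal.rpow_one (ENNReal.ofReal b)]
            exact ENNReal.rpow_le_rpow_of_exponent_le (by simpa using hb) hp1
        _ ≤ _ := by
            rw [← ENNReal.mul_rpow_of_nonneg _ _ (by linarith), ← ENNReal.ofReal_mul (by linarith)]
            exact ENNReal.rpow_le_rpow (ENNReal.ofReal_le_ofReal (hYn n)) (by linarith)
  refine ⟨G, hG1, fun n => ?_⟩
  filter_upwards [step n (main n)] with t ht
  refine ht.trans (ENNReal.rpow_le_rpow (ENNReal.ofReal_le_ofReal ?_) (by positivity))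
  refine le_trans ?_ (hYn n)
  exact le_mul_of_one_le_left (by positivity) hb

/-- The dominating series, taken with `√l` so that its exponents are `p₀ lⁿ`, is integrated term by
term: each normalised moment is at most `1` and the weights `2^{-(n+1)}` sum to `1`. Countability of
the exponents gives one null set of times. -/
theorem uniformlyExpIntegrable_of_geometric {u : SpaceTime → Plane} (hum : Measurable u)
    {I : Set ℝ} {B : Set Plane} (hB : volume B ≠ ∞) {p₀ l D G γ : ℝ} (hp₀ : 0 < p₀) (hl : 1 < l)
    (hD : 1 < D) (hG : 1 ≤ G) (hγ : 0 < γ) (hDγ : D ^ (1 / γ) ≤ √l)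
    (h : ∀ n : ℕ, ∀ᵐ t ∂volume.restrict I, ∫⁻ x in B, (1 + ‖u (x, t)‖ₑ) ^ (p₀ * l ^ (n + 1)) ≤
        ENNReal.ofReal (G * D ^ (n + 1)) ^ (p₀ * l ^ (n + 1))) :
    UniformlyExpIntegrable γ u I B := by
  have hsq : √l ^ 2 = l := Real.sq_sqrt (by linarith)
  have hl' : 1 < √l := by rw [Real.lt_sqrt zero_le_one]; simpa using hl
  obtain ⟨A, hA0, hA⟩ := exists_exp_rpow_le_tsum hp₀ hl' hD hG hγ hDγ
  rw [hsq] at hA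
  have hbound : ∀ᵐ t ∂volume.restrict I,
      ∫⁻ x in B, ENNReal.ofReal (Real.exp (‖u (x, t)‖ ^ (1 / γ))) ≤
        ENNReal.ofReal A * (volume B + 1) := by
    filter_upwards [ae_all_iff.2 h] with t ht
    have hm : Measurable fun x => u (x, t) := by fun_prop
    have hterm : ∀ n : ℕ, Measurable fun x => (2 : ℝ≥0∞)⁻¹ ^ (n + 1) *
        (ENNReal.ofReal ((1 + ‖u (x, t)‖) / (G * D ^ (n + 1)))) ^ (p₀ * l ^ (n + 1)) := by
      intro n; fun_prop
    calc _ ≤ ∫⁻ x in B, ENNReal.ofReal A * (1 + ∑' n : ℕ, 2⁻¹ ^ (n + 1) *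
        (ENNReal.ofReal ((1 + ‖u (x, t)‖) / (G * D ^ (n + 1)))) ^ (p₀ * l ^ (n + 1))) :=
          lintegral_mono fun x => hA _ (norm_nonneg _)
      _ = ENNReal.ofReal A * (volume B + ∑' n : ℕ, ∫⁻ x in B, 2⁻¹ ^ (n + 1) *
        (ENNReal.ofReal ((1 + ‖u (x, t)‖) / (G * D ^ (n + 1)))) ^ (p₀ * l ^ (n + 1))) := by
          rw [lintegral_const_mul' _ _ ENNReal.ofReal_ne_top, lintegral_add_left measurable_const,
            setLIntegral_one, lintegral_tsum fun n => (hterm n).aemeasurable]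
      _ ≤ ENNReal.ofReal A * (volume B + ∑' n : ℕ, 2⁻¹ ^ (n + 1)) := by
          gcongr with n
          have hg : 0 < G * D ^ (n + 1) := by positivity
          have hp : 0 < p₀ * l ^ (n + 1) := by positivity
          rw [lintegral_const_mul' _ _ (by finiteness)]
          refine mul_le_of_le_one_right' ?_
          have he : ∀ x, ENNReal.ofReal ((1 + ‖u (x, t)‖) / (G * D ^ (n + 1))) ^
              (p₀ * l ^ (n + 1)) = (1 + ‖u (x, t)‖ₑ) ^ (p₀ * l ^ (n + 1)) *
              (ENNReal.ofReal (G * D ^ (n + 1)) ^ (p₀ * l ^ (n + 1)))⁻¹ := by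
            intro x
            rw [ENNReal.ofReal_div_of_pos hg, ENNReal.div_rpow_of_nonneg _ _ hp.le,
              ENNReal.ofReal_add zero_le_one (norm_nonneg _), ENNReal.ofReal_one, ofReal_norm,
              div_eq_mul_inv]
          simp only [he]
          rw [lintegral_mul_const _ (by fun_prop)]
          refine (mul_le_mul_left (ht n) _).trans (ENNReal.mul_inv_le_one _)
      _ = _ := by rw [ENNReal.tsum_geometric_add_one, ENNReal.one_sub_inv_two, inv_inv,
            ENNReal.inv_mul_cancel (by norm_num) (by norm_num)]
  refine (essSup_le_of_ae_le _ hbound).trans_lt ?_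
  exact ENNReal.mul_lt_top ENNReal.ofReal_lt_top
    (ENNReal.add_lt_top.2 ⟨hB.lt_top, ENNReal.one_lt_top⟩)

/-! ### Shrinking cylinders and the core regularity statement. -/

/-- The shrinking radii between `3r` and `r`. -/
def radius (r : ℝ) (n : ℕ) : ℝ := r + 2 * r / 2 ^ n

/-- The shrinking time intervals, cut at the final time `T`. -/
def timeWindow (t₀ r d T : ℝ) (n : ℕ) : Set ℝ :=
  Ioo (t₀ - radius r n) (t₀ + d / 2 ^ n) ∩ Iic T

theorem radius_succ (r : ℝ) (n : ℕ) : radius r n = radius r (n + 1) + r / 2 ^ n := by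
  rw [radius, radius, pow_succ]; field_simp; ring

theorem le_radius {r : ℝ} (hr : 0 < r) (n : ℕ) : r < radius r n := by
  rw [radius]; have : 0 < 2 * r / 2 ^ n := by positivity
  linarith

theorem radius_le {r : ℝ} (hr : 0 < r) (n : ℕ) : radius r n ≤ 3 * r := by
  rw [radius]
  have : 2 * r / 2 ^ n ≤ 2 * r := div_le_self (by positivity) (one_le_pow₀ one_le_two)
  linarith

theorem timeWindow_subset {t₀ r d T : ℝ} (hr : 0 < r) (hd : 0 < d) (n : ℕ) :
    timeWindow t₀ r d T n ⊆ Ioo (t₀ - 4 * r) (t₀ + d) ∩ Iic T := by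
  rintro t ⟨⟨h1, h2⟩, h3⟩
  have h4 := radius_le hr n
  have h5 : d / 2 ^ n ≤ d := div_le_self hd.le (one_le_pow₀ one_le_two)
  exact ⟨⟨by linarith, by linarith⟩, h3⟩

theorem timeInterval_subset_timeWindow {t₀ r d T : ℝ} (hr : 0 < r) (hd : 0 < d) (hT : t₀ ≤ T)
    (n : ℕ) : timeInterval t₀ r ⊆ timeWindow t₀ r d T n := by
  rintro t ⟨h1, h2⟩
  have h4 := le_radius hr n
  have h5 : 0 < d / 2 ^ n := by positivity
  exact ⟨⟨by linarith, by linarith⟩, h2.le.trans hT⟩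

/-- The regularity statement for globally measurable `u` and `ω`, from the elliptic system and the
vorticity estimates on the shrinking cylinders. -/
theorem uniformlyExpIntegrable_core {u : SpaceTime → Plane} {ω : SpaceTime → ℝ}
    (hum : Measurable u) (hui : Integrable u) (hωm : Measurable ω) (hωi : Integrable ω)
    {x₀ : Plane} {t₀ r d T p₀ q₀ l D γ a E : ℝ} (hr : 0 < r) (hd : 0 < d) (hT : t₀ ≤ T)
    (hp₀ : 2 < p₀) (hq₀ : q₀ = 2 - 2 / p₀) (hl : l = (1 + q₀) / 2)
    (hD : D = 4 ^ (1 / (1 - 1 / q₀))) (hγ : 0 < γ) (hDγ : D ^ (1 / γ) ≤ √l) (ha : 1 ≤ a)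
    (hE : 0 ≤ E)
    (hdc : IsPlanarDivCurl (Metric.ball x₀ (4 * r)) (Ioo (t₀ - 4 * r) (min (t₀ + d) T)) u ω)
    (hω2 : ∫⁻ z, ‖ω z‖ₑ ^ (2 : ℝ) < ∞)
    (hup : ∫⁻ z in Metric.closedBall x₀ (radius r 0) ×ˢ timeWindow t₀ r d T 0,
      (1 + ‖u z‖ₑ) ^ p₀ < ∞)
    (hu1 : ∀ᵐ t ∂volume.restrict (Ioo (t₀ - 4 * r) (min (t₀ + d) T)),
      ∫⁻ x in Metric.ball x₀ (4 * r), ‖u (x, t)‖ₑ ≤ ENNReal.ofReal E)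
    (hvort : ∀ q : ℝ, 1 ≤ q → q < 2 → ∀ n, ∀ᵐ t ∂volume.restrict (timeWindow t₀ r d T (n + 1)),
      ∫⁻ x in Metric.closedBall x₀ (radius r (n + 1) + r / 2 ^ (n + 1)), ‖ω (x, t)‖ₑ ^ q ≤
      ENNReal.ofReal (a * 2 ^ n) * ∫⁻ z in Metric.closedBall x₀ (radius r n) ×ˢ
        timeWindow t₀ r d T n, ‖ω z‖ₑ ^ q * (1 + ‖u z‖ₑ)) :
    UniformlyExpIntegrable γ u (timeInterval t₀ r) (spaceBall x₀ r) := by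
  obtain ⟨hq1, -, -, hl1, -, -, -⟩ := exists_young_exponent hp₀ le_rfl hq₀ hq₀ hl
  have hβ : 0 < 1 - 1 / q₀ := by
    have : 1 / q₀ < 1 := by rw [div_lt_one (by linarith)]; exact hq1
    linarith
  have hD1 : 1 < D := by rw [hD]; exact Real.one_lt_rpow (by norm_num) (by positivity)
  have hS := transitionBound_pos
  -- The elliptic bound is used with gap `r/2^{n+2}`, whose inverse square is `16 · 4ⁿ/r²`; hence
  -- `512 = 32 · 16`.
  set c := 512 * transitionBound / r ^ 2 * E with hc
  have hc0 : 0 ≤ c := by positivity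
  set b := max 1 (max (volume (Metric.ball x₀ (4 * r))).toReal (4 * r + d)) with hb
  have hb1 : 1 ≤ b := le_max_left _ _
  have hball : volume (Metric.ball x₀ (4 * r)) ≤ ENNReal.ofReal b := by
    rw [← ENNReal.ofReal_toReal (measure_ball_lt_top (x := x₀) (r := 4 * r)).ne]
    exact ENNReal.ofReal_le_ofReal (le_max_of_le_right (le_max_left _ _))
  have hrad : ∀ n, Metric.closedBall x₀ (radius r n) ⊆ Metric.ball x₀ (4 * r) := fun n =>
    Metric.closedBall_subset_ball (by linarith [radius_le hr n])
  have hrad' : ∀ n, radius r (n + 1) + r / 2 ^ (n + 1) < 4 * r := fun n => by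
    have h1 := radius_le hr n
    rw [radius_succ] at h1
    have : r / 2 ^ (n + 1) ≤ r / 2 ^ n := by gcongr <;> simp
    linarith
  obtain ⟨G, hG1, hG⟩ := exists_ae_lintegral_le_geometric hum hωm
    (B := fun n => Metric.closedBall x₀ (radius r n))
    (B' := fun n => Metric.closedBall x₀ (radius r (n + 1) + r / 2 ^ (n + 1)))
    (J := timeWindow t₀ r d T) (c := c) (b := b) (W := max 1 (∫⁻ z, ‖ω z‖ₑ ^ (2 : ℝ)).toReal)
    (Y := ((∫⁻ z in Metric.closedBall x₀ (radius r 0) ×ˢ timeWindow t₀ r d T 0,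
      (1 + ‖u z‖ₑ) ^ p₀) ^ (1 / p₀)).toReal)
    hp₀ hq₀ hl hD ha hb1 hc0 (le_max_left _ _)
    (fun n => (measure_mono (hrad n)).trans hball)
    (fun n => (measure_mono (Metric.closedBall_subset_ball (hrad' n))).trans hball)
    (fun n => by
      refine (measure_mono ((timeWindow_subset hr hd n).trans inter_subset_left)).trans ?_
      rw [Real.volume_Ioo]
      refine ENNReal.ofReal_le_ofReal (le_max_of_le_right (le_max_of_le_right ?_))
      linarith)
    (fun n => by
      refine (setLIntegral_le_lintegral _ _).trans ?_
      rw [← ENNReal.ofReal_toReal hω2.ne]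
      refine ENNReal.ofReal_le_ofReal ?_
      rw [ENNReal.toReal_ofReal ENNReal.toReal_nonneg]
      exact le_max_right _ _)
    hvort
    (fun n => by
      have hg : 0 < r / 2 ^ (n + 2) := by positivity
      have e2 : r / 2 ^ (n + 1) = 2 * (r / 2 ^ (n + 2)) := by
        rw [pow_succ 2 (n + 1)]; field_simp
      -- The gap from level `n + 1` to level `n` is `r/2ⁿ`. Its outer half is used by the vorticity
      -- cutoff; the elliptic estimate works inside the inner half.
      have key := ae_enorm_le_potential (u := u) (ω := ω) (x₀ := x₀) (R := 4 * r)
        (a := radius r (n + 1) + r / 2 ^ (n + 2)) (b := radius r (n + 1) + r / 2 ^ (n + 1))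
        (by linarith [le_radius hr (n + 1)]) (by linarith) (hrad' n) isOpen_Ioo hum hui hωm hωi hdc
      have hgap : radius r (n + 1) + r / 2 ^ (n + 1) - (radius r (n + 1) + r / 2 ^ (n + 2)) =
          r / 2 ^ (n + 2) := by linarith
      have hconst : 32 * transitionBound / (r / 2 ^ (n + 2)) ^ 2 * E = c * 4 ^ n := by
        have : ((2 : ℝ) ^ (n + 2)) ^ 2 = 16 * 4 ^ n := by
          rw [← pow_mul, mul_comm, pow_mul, pow_add]; norm_num; ring
        rw [div_pow, this, hc]; field_simp; ring
      rw [hgap, Measure.volume_eq_prod] at key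
      have key2 : ∀ᵐ t : ℝ, ∀ᵐ x : Plane, _ :=
        Measure.ae_ae_of_ae_prod (Measure.measurePreserving_swap.quasiMeasurePreserving.ae key)
      -- The div–curl system is available on an open time interval, whereas the window may contain
      -- the final time.
      have hT' : ∀ᵐ t : ℝ, t ≠ T := by
        rw [ae_iff]; simp
      have hu1' := (ae_restrict_iff' measurableSet_Ioo).1 hu1
      have hJm : MeasurableSet (timeWindow t₀ r d T (n + 1)) :=
        measurableSet_Ioo.inter measurableSet_Iic
      rw [ae_restrict_iff' hJm]
      filter_upwards [key2, hT', hu1'] with t h1 h2 h3 ht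
      rw [ae_restrict_iff' Metric.isClosed_closedBall.measurableSet]
      have ht' := timeWindow_subset hr hd _ ht
      have htJ : t ∈ Ioo (t₀ - 4 * r) (min (t₀ + d) T) :=
        ⟨ht'.1.1, lt_min ht'.1.2 (lt_of_le_of_ne ht'.2 h2)⟩
      filter_upwards [h1] with x hx hxB
      refine (hx ⟨Metric.closedBall_subset_ball (by linarith) hxB, htJ⟩).trans ?_
      refine add_le_add le_rfl ?_
      rw [← hconst, ENNReal.ofReal_mul (by positivity)]
      refine mul_le_mul_right ?_ _
      exact (lintegral_mono_set (Metric.closedBall_subset_ball (hrad' n))).trans (h3 htJ))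
    (by
      rw [ENNReal.ofReal_toReal (ENNReal.rpow_lt_top_of_nonneg (by positivity) hup.ne).ne,
        ← ENNReal.rpow_mul, one_div_mul_cancel (by linarith), ENNReal.rpow_one])
  refine uniformlyExpIntegrable_of_geometric hum (measure_ball_lt_top (x := x₀) (r := r)).ne
    (p₀ := p₀) (by linarith) hl1 hD1 hG1 hγ hDγ fun n => ?_
  filter_upwards [ae_restrict_of_ae_restrict_of_subset
    (timeInterval_subset_timeWindow hr hd hT (n + 1)) (hG n)] with t ht
  refine (lintegral_mono_set ?_).trans ht
  exact (Metric.ball_subset_ball (le_radius hr _).le).trans Metric.ball_subset_closedBall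

/-! ### From the weak formulation to the tensor-tested div–curl system. -/

theorem fderiv_apply_eq (φ : Plane → ℝ) (x v : Plane) :
    fderiv ℝ φ x v = v 0 * pderiv 0 φ x + v 1 * pderiv 1 φ x := by
  have hv : v = v 0 • EuclideanSpace.single (0 : Fin 2) (1 : ℝ) +
      v 1 • EuclideanSpace.single (1 : Fin 2) (1 : ℝ) := by
    ext i; fin_cases i <;> simp
  conv_lhs => rw [hv]
  simp [pderiv]

theorem inner_gradient_eq (φ : Plane → ℝ) (x v : Plane) :
    inner ℝ v (gradient φ x) = v 0 * pderiv 0 φ x + v 1 * pderiv 1 φ x := by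
  rw [real_inner_comm, gradient, InnerProductSpace.toDual_symm_apply, fderiv_apply_eq]

theorem norm_gradient_eq (φ : Plane → ℝ) (x : Plane) : ‖gradient φ x‖ = ‖fderiv ℝ φ x‖ := by
  rw [gradient, LinearIsometryEquiv.norm_map]

theorem spaceDeriv_tensor (φ : Plane → ℝ) (hφ : ContDiff ℝ 1 φ) (η : ℝ → ℝ) (i : Fin 2) (z : SpaceTime) :
    spaceDeriv i (fun w => φ w.1 * η w.2) z = pderiv i φ z.1 * η z.2 := by
  rw [spaceDeriv]
  dsimp only
  rw [fderiv_mul_const ((hφ.differentiable one_ne_zero) _)]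
  simp [pderiv, mul_comm]

theorem norm_spaceGrad_tensor (φ : Plane → ℝ) (hφ : ContDiff ℝ 1 φ) (η : ℝ → ℝ) (z : SpaceTime) :
    ‖spaceGrad (fun w => φ w.1 * η w.2) z‖ = ‖fderiv ℝ φ z.1‖ * |η z.2| := by
  rw [spaceGrad, norm_gradient_eq]
  dsimp only
  rw [fderiv_mul_const ((hφ.differentiable one_ne_zero) _), norm_smul,
    Real.norm_eq_abs, mul_comm]

theorem timeDeriv_tensor (φ : Plane → ℝ) (η : ℝ → ℝ) (z : SpaceTime) :
    timeDeriv (fun w => φ w.1 * η w.2) z = φ z.1 * deriv η z.2 := by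
  rw [timeDeriv]
  dsimp only
  rw [deriv_const_mul_field]

theorem tsupport_tensor_subset (φ : Plane → ℝ) (η : ℝ → ℝ) :
    tsupport (fun w : SpaceTime => φ w.1 * η w.2) ⊆ tsupport φ ×ˢ tsupport η := by
  refine closure_minimal (fun z hz => ?_) ((isClosed_tsupport φ).prod (isClosed_tsupport η))
  exact ⟨subset_tsupport _ (left_ne_zero_of_mul hz), subset_tsupport _ (right_ne_zero_of_mul hz)⟩

theorem hasCompactSupport_tensor {φ : Plane → ℝ} {η : ℝ → ℝ} (hφ : HasCompactSupport φ)
    (hη : HasCompactSupport η) : HasCompactSupport (fun w : SpaceTime => φ w.1 * η w.2) :=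
  (hφ.isCompact.prod hη.isCompact).of_isClosed_subset (isClosed_tsupport _)
    (tsupport_tensor_subset φ η)

theorem contDiff_tensor {φ : Plane → ℝ} {η : ℝ → ℝ} (hφ : ContDiff ℝ (⊤ : ℕ∞) φ)
    (hη : ContDiff ℝ (⊤ : ℕ∞) η) :
    ContDiff ℝ (⊤ : ℕ∞) (fun w : SpaceTime => φ w.1 * η w.2) :=
  (hφ.comp contDiff_fst).mul (hη.comp contDiff_snd)

theorem ae_ae_slice {P : SpaceTime → Prop} (h : ∀ᵐ z : SpaceTime, P z) :
    ∀ᵐ t : ℝ, ∀ᵐ x : Plane, P (x, t) := by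
  rw [Measure.volume_eq_prod] at h
  exact Measure.ae_ae_of_ae_prod (Measure.measurePreserving_swap.quasiMeasurePreserving.ae h)

section Transfer

variable {Ω U : Set Plane} {T : ℝ} {J : Set ℝ} {u u' : SpaceTime → Plane} {ω ω' : SpaceTime → ℝ}

theorem measurableSet_spaceTimeDomain (hΩ : IsOpen Ω) : MeasurableSet (spaceTimeDomain Ω T) :=
  hΩ.measurableSet.prod measurableSet_Ioc

/-- The divergence condition holds on almost every time slice for each `φ` and is integrated against
`η`; the curl condition is the definition of vorticity tested with `φ(x) η(t)`. The supports lie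
where `u', ω'` agree with `u, ω`. -/
theorem IsPlanarDivCurl.of_distributional (hΩ : IsOpen Ω) (hUΩ : U ⊆ Ω) (hJ : J ⊆ Ioo 0 T)
    (hui : Integrable u') (hωi : Integrable ω')
    (hu : ∀ᵐ z : SpaceTime, z ∈ U ×ˢ J → u z = u' z)
    (hω : ∀ᵐ z : SpaceTime, z ∈ U ×ˢ J → ω z = ω' z)
    (hsol : IsWeakSolution Ω T u) (hvor : IsVorticity Ω T u ω) :
    IsPlanarDivCurl U J u' ω' where
  div_eq φ η hφ hφc hφU hη hηc hηJ := by
    have hφ1 : ContDiff ℝ 1 φ := hφ.of_le (by exact_mod_cast le_top)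
    rw [Measure.volume_eq_prod, integral_prod_symm _
      (integrable_div_test hui hφ1 hφc hη.continuous hηc)]
    refine integral_eq_zero_of_ae ?_
    have hdiv := (ae_restrict_iff' measurableSet_Icc).1
      (hsol.divergence_free φ hφ hφc (hφU.trans hUΩ))
    filter_upwards [hdiv, ae_ae_slice hu] with t h1 h2
    by_cases ht : t ∈ J
    · have hzero := h1 (Ioo_subset_Icc_self (hJ ht))
      rw [← integral_indicator hΩ.measurableSet] at hzero
      have heq : ∫ x, (u' (x, t) 0 * pderiv 0 φ x + u' (x, t) 1 * pderiv 1 φ x) =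
          ∫ x, Ω.indicator (fun x => inner ℝ (u (x, t)) (gradient φ x)) x := by
        refine integral_congr_ae ?_
        filter_upwards [h2] with x hx
        simp only [inner_gradient_eq]
        by_cases hxU : x ∈ U
        · rw [indicator_of_mem (hUΩ hxU), hx ⟨hxU, ht⟩]
        · simp [indicator, pderiv_eq_zero_of_notMem hφU _ hxU]
      simp only [integral_mul_const, Pi.zero_apply, heq, hzero, zero_mul]
    · have : η t = 0 := image_eq_zero_of_notMem_tsupport fun hh => ht (hηJ hh)
      simp [this]
  curl_eq φ η hφ hφc hφU hη hηc hηJ := by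
    have hφ1 : ContDiff ℝ 1 φ := hφ.of_le (by exact_mod_cast le_top)
    have h := hvor _ (contDiff_tensor hφ hη) (hasCompactSupport_tensor hφc hηc)
      ((tsupport_tensor_subset φ η).trans (prod_mono (hφU.trans hUΩ) (hηJ.trans hJ)))
    simp only [spaceDeriv_tensor φ hφ1] at h
    rw [← integral_indicator (measurableSet_spaceTimeDomain hΩ),
      ← integral_indicator (measurableSet_spaceTimeDomain hΩ)] at h
    have hsub : ∀ z : SpaceTime, z ∈ U ×ˢ J → z ∈ spaceTimeDomain Ω T := fun z hz =>
      ⟨hUΩ hz.1, Ioo_subset_Ioc_self (hJ hz.2)⟩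
    have hout : ∀ z : SpaceTime, z ∉ U ×ˢ J →
        φ z.1 * η z.2 = 0 ∧ ∀ i, pderiv i φ z.1 * η z.2 = 0 := by
      intro z hz
      by_cases hz1 : z.1 ∈ U
      · have : η z.2 = 0 := image_eq_zero_of_notMem_tsupport fun hh => hz ⟨hz1, hηJ hh⟩
        simp [this]
      · have : φ z.1 = 0 := image_eq_zero_of_notMem_tsupport fun hh => hz1 (hφU hh)
        simp [this, pderiv_eq_zero_of_notMem hφU _ hz1]
    have e1 : ∫ z, (spaceTimeDomain Ω T).indicator (fun z => ω z * (φ z.1 * η z.2)) z =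
        ∫ z, ω' z * φ z.1 * η z.2 := by
      refine integral_congr_ae ?_
      filter_upwards [hω] with z hz
      by_cases hm : z ∈ U ×ˢ J
      · rw [indicator_of_mem (hsub z hm), hz hm, mul_assoc]
      · rw [mul_assoc, (hout z hm).1, mul_zero]
        simp only [indicator, (hout z hm).1, mul_zero, ite_self]
    have e2 : ∫ z, (spaceTimeDomain Ω T).indicator (fun z => u z 1 * (pderiv 0 φ z.1 * η z.2) -
        u z 0 * (pderiv 1 φ z.1 * η z.2)) z =
        ∫ z, (u' z 1 * pderiv 0 φ z.1 * η z.2 - u' z 0 * pderiv 1 φ z.1 * η z.2) := by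
      refine integral_congr_ae ?_
      filter_upwards [hu] with z hz
      by_cases hm : z ∈ U ×ˢ J
      · rw [indicator_of_mem (hsub z hm), hz hm, mul_assoc, mul_assoc]
      · rw [mul_assoc, mul_assoc, (hout z hm).2, (hout z hm).2, mul_zero, mul_zero]
        simp only [indicator, (hout z hm).2, mul_zero, sub_self, ite_self]
    rw [e1, e2] at h
    have i1 := Integrable.mul_fst_mul_snd hωi hφ1.continuous hφc hη.continuous hηc
    have i2 := Integrable.mul_fst_mul_snd (Integrable.coord hui 1) (continuous_pderiv hφ1 0)
      (hasCompactSupport_pderiv hφc 0) hη.continuous hηc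
    have i3 := Integrable.mul_fst_mul_snd (Integrable.coord hui 0) (continuous_pderiv hφ1 1)
      (hasCompactSupport_pderiv hφc 1) hη.continuous hηc
    have i4 : Integrable fun z => u' z 1 * pderiv 0 φ z.1 * η z.2 -
      u' z 0 * pderiv 1 φ z.1 * η z.2 := i2.sub i3
    rw [← add_eq_zero_iff_eq_neg, ← integral_add i1 i4] at h
    rw [← h]
    congr 1; ext z; ring

end Transfer

/-! ### Localising the vorticity estimate. -/

/-- The vorticity estimate on shrinking cylinders. -/
theorem VorticityEstimates.ae_lintegral_le {Ω : Set Plane} {T V : ℝ}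
    {u u' : SpaceTime → Plane} {ω ω' : SpaceTime → ℝ} (hΩ : IsOpen Ω) (hV : 0 ≤ V)
    (hest : VorticityEstimates Ω T V u ω) {x₀ : Plane} {t₀ r d : ℝ} (hr : 0 < r) (hd : 0 < d)
    (hball : Metric.closedBall x₀ (4 * r) ⊆ Ω) (ht₀ : 0 < t₀ - 4 * r)
    (hu : ∀ᵐ z : SpaceTime, z ∈ Metric.closedBall x₀ (4 * r) ×ˢ
      (Ioo (t₀ - 4 * r) (t₀ + d) ∩ Iic T) → u z = u' z)
    (hω : ∀ᵐ z : SpaceTime, z ∈ Metric.closedBall x₀ (4 * r) ×ˢ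
      (Ioo (t₀ - 4 * r) (t₀ + d) ∩ Iic T) → ω z = ω' z)
    {a : ℝ} (ha : V * (transitionBound * (4 / r + 2 / d)) ≤ a)
    {q : ℝ} (hq1 : 1 ≤ q) (hq2 : q < 2) (n : ℕ) :
    ∀ᵐ t ∂volume.restrict (timeWindow t₀ r d T (n + 1)),
      ∫⁻ x in Metric.closedBall x₀ (radius r (n + 1) + r / 2 ^ (n + 1)), ‖ω' (x, t)‖ₑ ^ q ≤
      ENNReal.ofReal (a * 2 ^ n) * ∫⁻ z in Metric.closedBall x₀ (radius r n) ×ˢ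
        timeWindow t₀ r d T n, ‖ω' z‖ₑ ^ q * (1 + ‖u' z‖ₑ) := by
  have hS := transitionBound_pos
  have hrn := radius_succ r n
  have hrn1 := le_radius hr (n + 1)
  have hrn3 := radius_le hr n
  have e2 : r / 2 ^ n = 2 * (r / 2 ^ (n + 1)) := by rw [pow_succ]; field_simp
  have f2 : d / 2 ^ n = 2 * (d / 2 ^ (n + 1)) := by rw [pow_succ]; field_simp
  have hrpos : 0 < r / 2 ^ (n + 1) := by positivity
  have hdpos : 0 < d / 2 ^ (n + 1) := by positivity
  obtain ⟨χ, hχ, hχ0, hχ1, hχin, hχsupp, hχd⟩ := exists_space_cutoff x₀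
    (a := radius r (n + 1) + r / 2 ^ (n + 1)) (b := radius r n) (by linarith) (by linarith)
  -- The cutoff equals `1` on the next window and decays only after `t₀ + d/2^{n+1}`. It need not
  -- vanish at `T`, so the same choice serves `t₀ < T` and `t₀ = T`.
  obtain ⟨η, hη, hη0, hη1, hηin, hηout, hηd⟩ := exists_time_cutoff
    (a := t₀ - radius r n) (a' := t₀ - radius r (n + 1)) (b' := t₀ + d / 2 ^ (n + 1))
    (b := t₀ + d / 2 ^ n) (by linarith) (by linarith)
  have hχ1' : ContDiff ℝ 1 χ := hχ.of_le (by exact_mod_cast le_top)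
  have hχc : HasCompactSupport χ :=
    (isCompact_closedBall x₀ _).of_isClosed_subset (isClosed_tsupport χ) hχsupp
  have hηsupp : tsupport η ⊆ Icc (t₀ - radius r n) (t₀ + d / 2 ^ n) := by
    refine closure_minimal (fun t ht => ?_) isClosed_Icc
    by_contra hn
    exact ht (hηout t fun hh => hn (Ioo_subset_Icc_self hh))
  have hηc : HasCompactSupport η :=
    isCompact_Icc.of_isClosed_subset (isClosed_tsupport η) hηsupp
  have hsub : Metric.closedBall x₀ (radius r n) ⊆ Metric.closedBall x₀ (4 * r) :=
    Metric.closedBall_subset_closedBall (by linarith)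
  have est := hest.estimate (q - 1) (by linarith) (by linarith) _ (contDiff_tensor hχ hη)
    (hasCompactSupport_tensor hχc hηc) ((tsupport_tensor_subset χ η).trans (prod_mono
      (hχsupp.trans (hsub.trans hball)) (hηsupp.trans fun t ht => by
        have := ht.1
        rw [mem_Ioi]; linarith))) (fun z => mul_nonneg (hχ0 _) (hη0 _))
  rw [add_sub_cancel] at est
  -- The spatial gap `r/2^{n+1}` gives `4 · 2ⁿ/r`; the temporal gaps `r/2ⁿ` and `d/2^{n+1}` give
  -- `2ⁿ/r + 2 · 2ⁿ/d`. One constant bounds both derivatives.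
  set L := transitionBound * (4 / r + 2 / d) with hL
  have hL0 : 0 ≤ L := by positivity
  have hgrad : ∀ z : SpaceTime,
      ‖spaceGrad (fun w => χ w.1 * η w.2) z‖ₑ ≤ ENNReal.ofReal (L * 2 ^ n) := by
    intro z
    rw [← ofReal_norm, norm_spaceGrad_tensor χ hχ1' η]
    refine ENNReal.ofReal_le_ofReal ?_
    calc _ ≤ 2 * transitionBound / (radius r n - (radius r (n + 1) + r / 2 ^ (n + 1))) * 1 := by
          refine mul_le_mul (hχd z.1) ?_ (abs_nonneg _) (div_nonneg (by positivity) (by linarith))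
          rw [abs_of_nonneg (hη0 _)]; exact hη1 _
      _ = transitionBound * (4 / r) * 2 ^ n := by
          have : radius r n - (radius r (n + 1) + r / 2 ^ (n + 1)) = r / 2 ^ (n + 1) := by linarith
          rw [this, pow_succ]; field_simp; ring
      _ ≤ _ := by
          rw [hL]
          have : 0 ≤ 2 / d := by positivity
          gcongr
          linarith
  have htime : ∀ z : SpaceTime,
      ‖timeDeriv (fun w => χ w.1 * η w.2) z‖ₑ ≤ ENNReal.ofReal (L * 2 ^ n) := by
    intro z
    rw [← ofReal_norm, timeDeriv_tensor, norm_mul, Real.norm_eq_abs, Real.norm_eq_abs]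
    refine ENNReal.ofReal_le_ofReal ?_
    have h1 : t₀ - radius r (n + 1) - (t₀ - radius r n) = r / 2 ^ n := by linarith
    have h2 : t₀ + d / 2 ^ n - (t₀ + d / 2 ^ (n + 1)) = d / 2 ^ (n + 1) := by linarith
    rw [h1, h2] at hηd
    calc _ ≤ 1 * (transitionBound / (r / 2 ^ n) + transitionBound / (d / 2 ^ (n + 1))) := by
          refine mul_le_mul ?_ (hηd _) (abs_nonneg _) zero_le_one
          rw [abs_of_nonneg (hχ0 _)]; exact hχ1 _
      _ = transitionBound * (1 / r + 2 / d) * 2 ^ n := by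
          rw [pow_succ]; field_simp
      _ ≤ _ := by
          rw [hL]
          have : 1 / r ≤ 4 / r := by gcongr; norm_num
          gcongr
  have hzero : ∀ z : SpaceTime, z ∉ Metric.closedBall x₀ (radius r n) ×ˢ
      Ioo (t₀ - radius r n) (t₀ + d / 2 ^ n) →
      ‖spaceGrad (fun w => χ w.1 * η w.2) z‖ₑ = 0 ∧
        ‖timeDeriv (fun w => χ w.1 * η w.2) z‖ₑ = 0 := by
    intro z hz
    rw [← ofReal_norm, norm_spaceGrad_tensor χ hχ1' η, timeDeriv_tensor]
    by_cases hz1 : z.1 ∈ Metric.closedBall x₀ (radius r n)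
    · have hz2 : z.2 ∉ Ioo (t₀ - radius r n) (t₀ + d / 2 ^ n) := fun hh => hz ⟨hz1, hh⟩
      have h1 : η z.2 = 0 := hηout _ hz2
      -- A zero of a non-negative function is a minimum; this covers the endpoints of the open
      -- interval as well.
      have h2 : deriv η z.2 = 0 :=
        IsLocalMin.deriv_eq_zero (Filter.Eventually.of_forall fun t => by rw [h1]; exact hη0 t)
      simp [h1, h2]
    · have h1 : χ z.1 = 0 := image_eq_zero_of_notMem_tsupport fun hh => hz1 (hχsupp hh)
      have h2 : fderiv ℝ χ z.1 = 0 := by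
        by_contra hne
        exact hz1 (hχsupp (support_fderiv_subset ℝ hne))
      simp [h1, h2]
  have hJm : ∀ k, MeasurableSet (timeWindow t₀ r d T k) := fun k =>
    measurableSet_Ioo.inter measurableSet_Iic
  have hQm : MeasurableSet (Metric.closedBall x₀ (radius r n) ×ˢ timeWindow t₀ r d T n) :=
    Metric.isClosed_closedBall.measurableSet.prod (hJm n)
  have hrhs : ∫⁻ z in spaceTimeDomain Ω T, ‖ω z‖ₑ ^ q *
      (‖u z‖ₑ * ‖spaceGrad (fun w => χ w.1 * η w.2) z‖ₑ +
        ‖timeDeriv (fun w => χ w.1 * η w.2) z‖ₑ) ≤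
      ENNReal.ofReal (L * 2 ^ n) * ∫⁻ z in Metric.closedBall x₀ (radius r n) ×ˢ
        timeWindow t₀ r d T n, ‖ω' z‖ₑ ^ q * (1 + ‖u' z‖ₑ) := by
    rw [← lintegral_const_mul' _ _ ENNReal.ofReal_ne_top,
      ← lintegral_indicator (measurableSet_spaceTimeDomain hΩ), ← lintegral_indicator hQm]
    refine lintegral_mono_ae ?_
    filter_upwards [hu, hω] with z h1 h2
    by_cases hzΩ : z ∈ spaceTimeDomain Ω T
    swap
    · rw [indicator_of_notMem hzΩ]; exact zero_le
    rw [indicator_of_mem hzΩ]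
    by_cases hzQ : z ∈ Metric.closedBall x₀ (radius r n) ×ˢ timeWindow t₀ r d T n
    · have hzK : z ∈ Metric.closedBall x₀ (4 * r) ×ˢ (Ioo (t₀ - 4 * r) (t₀ + d) ∩ Iic T) :=
        ⟨hsub hzQ.1, timeWindow_subset hr hd n hzQ.2⟩
      rw [indicator_of_mem hzQ, h1 hzK, h2 hzK]
      calc _ ≤ ‖ω' z‖ₑ ^ q * (‖u' z‖ₑ * ENNReal.ofReal (L * 2 ^ n) + ENNReal.ofReal (L * 2 ^ n)) := by
            gcongr
            · exact hgrad z
            · exact htime z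
        _ = _ := by ring
    · have : z ∉ Metric.closedBall x₀ (radius r n) ×ˢ
          Ioo (t₀ - radius r n) (t₀ + d / 2 ^ n) := fun hh => hzQ ⟨hh.1, hh.2, hzΩ.2.2⟩
      simp [hzero z this]
  have hess := (ae_restrict_iff' measurableSet_Icc).1 (ENNReal.ae_le_essSup (μ := volume.restrict (Icc 0 T))
    (fun t => ∫⁻ x in Ω, ‖ω (x, t)‖ₑ ^ q * ‖χ x * η t‖ₑ))
  rw [ae_restrict_iff' (hJm _)]
  filter_upwards [hess, ae_ae_slice hω] with t h1 h2 ht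
  have htw := timeWindow_subset hr hd _ ht
  have htT : t ∈ Icc 0 T := ⟨by have := htw.1.1; linarith, htw.2⟩
  have hηt : η t = 1 := hηin t ⟨ht.1.1.le, ht.1.2.le⟩
  have hsub' : Metric.closedBall x₀ (radius r (n + 1) + r / 2 ^ (n + 1)) ⊆
      Metric.closedBall x₀ (4 * r) := Metric.closedBall_subset_closedBall (by linarith)
  calc _ ≤ ∫⁻ x in Ω, ‖ω (x, t)‖ₑ ^ q * ‖χ x * η t‖ₑ := by
        rw [← lintegral_indicator Metric.isClosed_closedBall.measurableSet,
          ← lintegral_indicator hΩ.measurableSet]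
        refine lintegral_mono_ae ?_
        filter_upwards [h2] with x hx
        by_cases hxB : x ∈ Metric.closedBall x₀ (radius r (n + 1) + r / 2 ^ (n + 1))
        · rw [indicator_of_mem hxB, indicator_of_mem (hball (hsub' hxB)), hx ⟨hsub' hxB, htw⟩,
            hηt, hχin x hxB]
          simp
        · rw [indicator_of_notMem hxB]; exact zero_le
    _ ≤ _ := h1 htT
    _ ≤ _ := est
    _ ≤ ENNReal.ofReal V * (ENNReal.ofReal (L * 2 ^ n) *
        ∫⁻ z in Metric.closedBall x₀ (radius r n) ×ˢ
        timeWindow t₀ r d T n, ‖ω' z‖ₑ ^ q * (1 + ‖u' z‖ₑ)) := by gcongr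
    _ ≤ _ := by
        rw [← mul_assoc, ← ENNReal.ofReal_mul hV, ← mul_assoc]
        gcongr

/-! ### Uniform `L¹` bounds, the exponent, and conclusion. -/

/-- Uniform `L¹` bounds for the velocity on the cylinder, up to a time `t₀ + d` if `t₀ < T`. -/
theorem exists_ae_lintegral_ball_le {Ω : Set Plane} {T : ℝ} {u : SpaceTime → Plane}
    (hE : LocallyBoundedEnergy Ω T u) {x₀ : Plane} {t₀ r : ℝ} (hr : 0 < r)
    (hball : Metric.closedBall x₀ (4 * r) ⊆ Ω) (ht₀ : 0 < t₀ - 4 * r) (hT : t₀ ≤ T)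
    (h : t₀ < T ∨ supAvgNorm u x₀ t₀ (4 * r) < ⊤) :
    ∃ d E : ℝ, 0 < d ∧ 0 ≤ E ∧ ∀ᵐ t ∂volume.restrict (Ioo (t₀ - 4 * r) (min (t₀ + d) T)),
      ∫⁻ x in Metric.ball x₀ (4 * r), ‖u (x, t)‖ₑ ≤ ENNReal.ofReal E := by
  rcases lt_or_eq_of_le hT with hlt | heq
  -- Half of the remaining time keeps the enlarged interval compact in `(0, T)`, where the energy
  -- bound applies; `s ≤ 1 + s²` converts it to `L¹`.
  · set d := (T - t₀) / 2 with hd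
    have hd0 : 0 < d := by rw [hd]; linarith
    have hb := hE (Icc (t₀ - 4 * r) (t₀ + d)) (Metric.closedBall x₀ (4 * r)) isCompact_Icc
      (fun t ht => ⟨by linarith [ht.1], by have := ht.2; rw [hd] at this; linarith⟩)
      (isCompact_closedBall _ _) hball
    set M := essSup (fun t => ∫⁻ x in Metric.closedBall x₀ (4 * r), ‖u (x, t)‖ₑ ^ 2)
      (volume.restrict (Icc (t₀ - 4 * r) (t₀ + d)))
    have hfin : volume (Metric.ball x₀ (4 * r)) + M < ∞ :=
      ENNReal.add_lt_top.2 ⟨measure_ball_lt_top, hb⟩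
    refine ⟨d, (volume (Metric.ball x₀ (4 * r)) + M).toReal, hd0, ENNReal.toReal_nonneg, ?_⟩
    rw [ENNReal.ofReal_toReal hfin.ne]
    refine ae_restrict_of_ae_restrict_of_subset (t := Icc (t₀ - 4 * r) (t₀ + d)) (fun t ht =>
      ⟨ht.1.le, ht.2.le.trans (min_le_left _ _)⟩) ?_
    filter_upwards [ENNReal.ae_le_essSup (μ := volume.restrict (Icc (t₀ - 4 * r) (t₀ + d)))
      (fun t => ∫⁻ x in Metric.closedBall x₀ (4 * r), ‖u (x, t)‖ₑ ^ 2)] with t ht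
    calc _ ≤ ∫⁻ x in Metric.ball x₀ (4 * r), (1 + ‖u (x, t)‖ₑ ^ 2) := by
          refine lintegral_mono fun x => ?_
          rcases le_total ‖u (x, t)‖ₑ 1 with h1 | h1
          · exact h1.trans le_self_add
          · refine le_add_left ?_
            rw [sq]
            exact le_mul_of_one_le_left' h1
      _ = volume (Metric.ball x₀ (4 * r)) + ∫⁻ x in Metric.ball x₀ (4 * r), ‖u (x, t)‖ₑ ^ 2 := by
          rw [lintegral_add_left measurable_const, setLIntegral_one]
      _ ≤ _ := by
          gcongr
          exact (lintegral_mono_set Metric.ball_subset_closedBall).trans ht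
  · have hsup : supAvgNorm u x₀ t₀ (4 * r) < ⊤ := h.resolve_left (by linarith)
    have hfin : volume (Metric.ball x₀ (4 * r)) * supAvgNorm u x₀ t₀ (4 * r) < ∞ :=
      ENNReal.mul_lt_top measure_ball_lt_top hsup
    -- For `t₀ = T` the value of `d` is arbitrary, since the interval is cut at `T`.
    refine ⟨1, (volume (Metric.ball x₀ (4 * r)) * supAvgNorm u x₀ t₀ (4 * r)).toReal, one_pos,
      ENNReal.toReal_nonneg, ?_⟩
    rw [ENNReal.ofReal_toReal hfin.ne]
    have hset : Ioo (t₀ - 4 * r) (min (t₀ + 1) T) = timeInterval t₀ (4 * r) := by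
      rw [← heq, min_eq_right (by linarith), timeInterval]
    rw [hset]
    filter_upwards [ENNReal.ae_le_essSup (μ := volume.restrict (timeInterval t₀ (4 * r)))
      (fun t => laverage (volume.restrict (spaceBall x₀ (4 * r))) fun x => ‖u (x, t)‖ₑ)] with t ht
    have hpos : volume (Metric.ball x₀ (4 * r)) ≠ 0 :=
      (Metric.measure_ball_pos _ _ (by linarith)).ne'
    rw [setLAverage_eq] at ht
    exact ((ENNReal.div_le_iff hpos measure_ball_lt_top.ne).1 ht).trans_eq (mul_comm _ _)

/-- Both factors of the product are at least `1` and the supremum term is non-negative. This lower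
bound is all that the argument needs to know about `γ`. -/
theorem le_gammaExponent {C : ℝ} (hC : 0 < C) {ε : ℝ} (hε : 0 < ε) (u : SpaceTime → Plane)
    (ω : SpaceTime → ℝ) (x₀ : Plane) (t₀ r : ℝ) : C ≤ gammaExponent C ε u ω x₀ t₀ r := by
  have h1 : 0 ≤ ⨍ z in cylinder x₀ t₀ (4 * r), |ω z| ^ 2 := by
    rw [setAverage_eq]
    exact mul_nonneg (by positivity) (integral_nonneg fun z => by positivity)
  have h2 : 0 ≤ ⨍ z in cylinder x₀ t₀ (4 * r), ‖u z‖ ^ (2 + ε) := by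
    rw [setAverage_eq]
    exact mul_nonneg (by positivity) (integral_nonneg fun z => by positivity)
  have h3 : 1 ≤ (r ^ 2 * (⨍ z in cylinder x₀ t₀ (4 * r), |ω z| ^ 2) + 1) ^ (1 / 2 : ℝ) :=
    Real.one_le_rpow (by nlinarith [mul_nonneg (sq_nonneg r) h1]) (by norm_num)
  have h4 : 1 ≤ ((⨍ z in cylinder x₀ t₀ (4 * r), ‖u z‖ ^ (2 + ε)) + 1) ^ (1 / (2 + ε)) :=
    Real.one_le_rpow (by linarith) (by positivity)
  have h5 : 0 ≤ (supAvgNorm u x₀ t₀ (4 * r)).toReal := ENNReal.toReal_nonneg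
  refine le_mul_of_one_le_right hC.le ?_
  have := one_le_mul_of_one_le_of_one_le h3 h4
  linarith

theorem closure_cylinder (x₀ : Plane) (t₀ : ℝ) {r : ℝ} (hr : 0 < r) :
    closure (cylinder x₀ t₀ r) = Metric.closedBall x₀ r ×ˢ Icc (t₀ - r) t₀ := by
  rw [cylinder, spaceBall, timeInterval, closure_prod_eq, closure_ball x₀ hr.ne',
    closure_Ioo (by linarith)]

theorem UniformlyExpIntegrable.congr_ae {γ : ℝ} {u u' : SpaceTime → Plane} {I : Set ℝ}
    {B : Set Plane} (hI : MeasurableSet I) (hB : MeasurableSet B)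
    (hu : ∀ᵐ z : SpaceTime, z ∈ B ×ˢ I → u z = u' z) (h : UniformlyExpIntegrable γ u' I B) :
    UniformlyExpIntegrable γ u I B := by
  refine lt_of_eq_of_lt (essSup_congr_ae ?_) h
  rw [Filter.EventuallyEq, ae_restrict_iff' hI]
  filter_upwards [ae_ae_slice hu] with t ht htI
  refine lintegral_congr_ae ?_
  rw [Filter.EventuallyEq, ae_restrict_iff' hB]
  filter_upwards [ht] with x hx hxB
  rw [hx ⟨hxB, htI⟩]

/-- Reduction to the core statement: `u` and `ω` are replaced by Borel representatives on a compact
set containing all the windows, extended by zero. Each hypothesis and the conclusion survive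
modification on null sets. -/
theorem uniformlyExpIntegrable_of_vorticityEstimates {ε V p₀ q₀ l D γ : ℝ} (hε : 0 < ε)
    (hV : 0 < V) (hp₀ : p₀ = 2 + ε) (hq₀ : q₀ = 2 - 2 / p₀) (hl : l = (1 + q₀) / 2)
    (hD : D = 4 ^ (1 / (1 - 1 / q₀))) (hγ : 0 < γ) (hDγ : D ^ (1 / γ) ≤ √l)
    {Ω : Set Plane} {T : ℝ} {u : SpaceTime → Plane} {ω : SpaceTime → ℝ} (hΩ : IsOpen Ω)
    (hsol : IsWeakSolution Ω T u) (hE : LocallyBoundedEnergy Ω T u) (hvor : IsVorticity Ω T u ω)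
    (hest : VorticityEstimates Ω T V u ω) (hup : MemLpLoc (ENNReal.ofReal (2 + ε)) Ω T u)
    {x₀ : Plane} {t₀ r : ℝ} (hr : 0 < r)
    (hcyl : closure (cylinder x₀ t₀ (4 * r)) ⊆ spaceTimeDomain Ω T)
    (h : t₀ < T ∨ supAvgNorm u x₀ t₀ (4 * r) < ⊤) :
    UniformlyExpIntegrable γ u (timeInterval t₀ r) (spaceBall x₀ r) := by
  rw [closure_cylinder x₀ t₀ (by linarith), spaceTimeDomain, prod_subset_prod_iff] at hcyl
  have hne1 : (Metric.closedBall x₀ (4 * r)).Nonempty :=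
    ⟨x₀, Metric.mem_closedBall_self (by linarith)⟩
  have hne2 : (Icc (t₀ - 4 * r) t₀).Nonempty := nonempty_Icc.2 (by linarith)
  obtain ⟨hball, htime⟩ : Metric.closedBall x₀ (4 * r) ⊆ Ω ∧ Icc (t₀ - 4 * r) t₀ ⊆ Ioc 0 T := by
    rcases hcyl with h1 | h1 | h1
    · exact h1
    · exact absurd h1 hne1.ne_empty
    · exact absurd h1 hne2.ne_empty
  have ht₀ : 0 < t₀ - 4 * r := (htime (left_mem_Icc.2 (by linarith))).1
  have hT : t₀ ≤ T := (htime (right_mem_Icc.2 (by linarith))).2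
  obtain ⟨d, E, hd, hE0, hu1⟩ := exists_ae_lintegral_ball_le hE hr hball ht₀ hT h
  set K : Set SpaceTime := Metric.closedBall x₀ (4 * r) ×ˢ Icc (t₀ - 4 * r) (min (t₀ + d) T)
    with hK
  have hKc : IsCompact K := (isCompact_closedBall _ _).prod isCompact_Icc
  have hKm : MeasurableSet K := hKc.measurableSet
  have hKΩ : K ⊆ spaceTimeDomain Ω T := fun z hz =>
    ⟨hball hz.1, by linarith [hz.2.1], hz.2.2.trans (min_le_right _ _)⟩
  have : IsFiniteMeasure (volume.restrict K) := ⟨by simpa using hKc.measure_lt_top⟩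
  have hu2 := hsol.memLpLoc_two K hKc hKΩ
  have hω2 := hest.memLpLoc_two K hKc hKΩ
  have hupK := hup K hKc hKΩ
  set u' : SpaceTime → Plane := K.indicator (hu2.1.mk u) with hu'
  set ω' : SpaceTime → ℝ := K.indicator (hω2.1.mk ω) with hω'
  have hum : Measurable u' := hu2.1.stronglyMeasurable_mk.measurable.indicator hKm
  have hωm : Measurable ω' := hω2.1.stronglyMeasurable_mk.measurable.indicator hKm
  have hu : ∀ᵐ z : SpaceTime, z ∈ K → u z = u' z := by
    filter_upwards [(ae_restrict_iff' hKm).1 hu2.1.ae_eq_mk] with z hz hzK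
    rw [hu', indicator_of_mem hzK, hz hzK]
  have hω : ∀ᵐ z : SpaceTime, z ∈ K → ω z = ω' z := by
    filter_upwards [(ae_restrict_iff' hKm).1 hω2.1.ae_eq_mk] with z hz hzK
    rw [hω', indicator_of_mem hzK, hz hzK]
  have hui : Integrable u' := by
    rw [hu', integrable_indicator_iff hKm]
    exact (hu2.integrable one_le_two).congr hu2.1.ae_eq_mk
  have hωi : Integrable ω' := by
    rw [hω', integrable_indicator_iff hKm]
    exact (hω2.integrable one_le_two).congr hω2.1.ae_eq_mk
  have hωL : ∫⁻ z, ‖ω' z‖ₑ ^ (2 : ℝ) < ∞ := by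
    have h1 : MemLp ω' 2 := by
      rw [hω', memLp_indicator_iff_restrict hKm]
      exact hω2.ae_eq hω2.1.ae_eq_mk
    have h2 := lintegral_rpow_enorm_lt_top_of_eLpNorm_lt_top (by norm_num) (by norm_num) h1.2
    simpa using h2
  have hJK : ∀ S : Set SpaceTime, S ⊆ K → ∀ᵐ z : SpaceTime, z ∈ S → u z = u' z ∧ ω z = ω' z :=
    fun S hS => by
      filter_upwards [hu, hω] with z h1 h2 hz
      exact ⟨h1 (hS hz), h2 (hS hz)⟩
  have hsub1 : Metric.ball x₀ (4 * r) ×ˢ Ioo (t₀ - 4 * r) (min (t₀ + d) T) ⊆ K :=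
    prod_mono Metric.ball_subset_closedBall Ioo_subset_Icc_self
  have hsub2 : Metric.closedBall x₀ (4 * r) ×ˢ (Ioo (t₀ - 4 * r) (t₀ + d) ∩ Iic T) ⊆ K :=
    prod_mono le_rfl fun t ht => ⟨ht.1.1.le, le_min ht.1.2.le ht.2⟩
  have hsub3 : Metric.closedBall x₀ (radius r 0) ×ˢ timeWindow t₀ r d T 0 ⊆ K :=
    (prod_mono (Metric.closedBall_subset_closedBall (by linarith [radius_le hr 0]))
      (timeWindow_subset hr hd 0)).trans hsub2
  have hsub4 : spaceBall x₀ r ×ˢ timeInterval t₀ r ⊆ K := by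
    refine prod_mono (Metric.ball_subset_closedBall.trans
      (Metric.closedBall_subset_closedBall (by linarith))) fun t ht => ?_
    have h1 := ht.1
    have h2 := ht.2
    exact ⟨by linarith, le_min (by linarith) (by linarith)⟩
  have hupL : ∫⁻ z in Metric.closedBall x₀ (radius r 0) ×ˢ timeWindow t₀ r d T 0,
      (1 + ‖u' z‖ₑ) ^ p₀ < ∞ := by
    refine (lintegral_mono_set hsub3).trans_lt ?_
    have h1 : MemLp u' (ENNReal.ofReal (2 + ε)) (volume.restrict K) := by
      refine hupK.ae_eq ?_
      rw [Filter.EventuallyEq, ae_restrict_iff' hKm]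
      exact hu
    have h2 : MemLp (fun z => 1 + ‖u' z‖) (ENNReal.ofReal (2 + ε)) (volume.restrict K) :=
      MemLp.add (f := fun _ => (1 : ℝ)) (g := fun z => ‖u' z‖) (memLp_const 1) h1.norm
    have hne : ENNReal.ofReal (2 + ε) ≠ 0 := (ENNReal.ofReal_pos.2 (by linarith)).ne'
    have h3 := lintegral_rpow_enorm_lt_top_of_eLpNorm_lt_top hne ENNReal.ofReal_ne_top h2.2
    rw [ENNReal.toReal_ofReal (by linarith), ← hp₀] at h3
    refine lt_of_eq_of_lt (lintegral_congr fun z => ?_) h3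
    congr 1
    rw [← ofReal_norm (1 + ‖u' z‖), Real.norm_of_nonneg (by positivity),
      ENNReal.ofReal_add zero_le_one (norm_nonneg _), ENNReal.ofReal_one, ofReal_norm]
  have hu1' : ∀ᵐ t ∂volume.restrict (Ioo (t₀ - 4 * r) (min (t₀ + d) T)),
      ∫⁻ x in Metric.ball x₀ (4 * r), ‖u' (x, t)‖ₑ ≤ ENNReal.ofReal E := by
    rw [ae_restrict_iff' measurableSet_Ioo] at hu1 ⊢
    filter_upwards [hu1, ae_ae_slice hu] with t h1 h2 ht
    refine le_of_eq_of_le (lintegral_congr_ae ?_) (h1 ht)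
    rw [Filter.EventuallyEq, ae_restrict_iff' Metric.isOpen_ball.measurableSet]
    filter_upwards [h2] with x hx hxB
    rw [hx (hsub1 ⟨hxB, ht⟩)]
  have hdc : IsPlanarDivCurl (Metric.ball x₀ (4 * r)) (Ioo (t₀ - 4 * r) (min (t₀ + d) T)) u' ω' :=
    IsPlanarDivCurl.of_distributional hΩ (Metric.ball_subset_closedBall.trans hball)
      (fun t ht => ⟨by linarith [ht.1], ht.2.trans_le (min_le_right _ _)⟩) hui hωi
      ((hJK _ hsub1).mono fun z hz hm => (hz hm).1) ((hJK _ hsub1).mono fun z hz hm => (hz hm).2)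
      hsol hvor
  refine UniformlyExpIntegrable.congr_ae measurableSet_Ioo Metric.isOpen_ball.measurableSet
    ((hJK _ hsub4).mono fun z hz hm => (hz hm).1) ?_
  exact uniformlyExpIntegrable_core hum hui hωm hωi
    (a := max 1 (V * (transitionBound * (4 / r + 2 / d)))) hr hd hT (by linarith) hq₀ hl hD hγ hDγ
    (le_max_left _ _) hE0 hdc hωL hupL hu1' fun q hq1 hq2 n =>
      hest.ae_lintegral_le hΩ hV.le hr hd hball ht₀
        ((hJK _ hsub2).mono fun z hz hm => (hz hm).1) ((hJK _ hsub2).mono fun z hz hm => (hz hm).2)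
        (le_max_right _ _) hq1 hq2 n

end EulerPlane

end

theorem theorem1 (ε V : ℝ) (hε : 0 < ε) (hV : 0 < V) :
    ∃ C : ℝ, 0 < C ∧
      ∀ (Ω : Set EulerPlane.Plane) (T : ℝ) (u : EulerPlane.SpaceTime → EulerPlane.Plane)
        (ω : EulerPlane.SpaceTime → ℝ),
        IsOpen Ω → 0 < T →
        EulerPlane.IsWeakSolution Ω T u →
        EulerPlane.LocallyBoundedEnergy Ω T u →
        EulerPlane.IsVorticity Ω T u ω →
        EulerPlane.VorticityEstimates Ω T V u ω →
        EulerPlane.MemLpLoc (ENNReal.ofReal (2 + ε)) Ω T u →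
        ∀ (x₀ : EulerPlane.Plane) (t₀ r : ℝ), 0 < r →
          closure (EulerPlane.cylinder x₀ t₀ (4 * r)) ⊆ EulerPlane.spaceTimeDomain Ω T →
          -- the averaged norm is automatically finite when `t₀ < T`
          (t₀ < T ∨ EulerPlane.supAvgNorm u x₀ t₀ (4 * r) < ⊤) →
          EulerPlane.UniformlyExpIntegrable (EulerPlane.gammaExponent C ε u ω x₀ t₀ r) u
            (EulerPlane.timeInterval t₀ r) (EulerPlane.spaceBall x₀ r) := by
  have hp₀ : 2 < 2 + ε := by linarith
  obtain ⟨hq1, -, -, hl1, -, -, -⟩ :=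
    EulerPlane.exists_young_exponent hp₀ le_rfl rfl rfl rfl
  set q₀ := 2 - 2 / (2 + ε) with hq₀
  set l := (1 + q₀) / 2 with hl
  have hβ : 0 < 1 - 1 / q₀ := by
    have : 1 / q₀ < 1 := by rw [div_lt_one (by linarith)]; exact hq1
    linarith
  set D : ℝ := 4 ^ (1 / (1 - 1 / q₀)) with hD
  have hD1 : 1 < D := Real.one_lt_rpow (by norm_num) (by positivity)
  have hlogl : 0 < Real.log l := Real.log_pos hl1
  have hlogD : 0 < Real.log D := Real.log_pos hD1
  have hC : 0 < 2 * Real.log D / Real.log l := by positivity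
  -- This is the solution of `D^{1/C} = √l`; any larger `γ` then satisfies `D^{1/γ} ≤ √l`.
  refine ⟨2 * Real.log D / Real.log l, hC, ?_⟩
  intro Ω T u ω hΩ _ hsol hE hvor hest hup x₀ t₀ r hr hcyl h
  have hγ := EulerPlane.le_gammaExponent hC hε u ω x₀ t₀ r
  set γ := EulerPlane.gammaExponent (2 * Real.log D / Real.log l) ε u ω x₀ t₀ r
  have hγ0 : 0 < γ := hC.trans_le hγ
  refine EulerPlane.uniformlyExpIntegrable_of_vorticityEstimates hε hV rfl hq₀ hl hD hγ0 ?_ hΩ hsol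
    hE hvor hest hup hr hcyl h
  rw [Real.sqrt_eq_rpow, Real.rpow_def_of_pos (by linarith), Real.rpow_def_of_pos (by linarith),
    Real.exp_le_exp]
  rw [div_le_iff₀ hlogl] at hγ
  rw [mul_one_div, mul_one_div, div_le_div_iff₀ hγ0 two_pos]
  linarith
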